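/- Conventions. A complex manifold with corners $V$ is equipped with a germ of codimension zero embedding into an open complex manifold, and holomorphic (smooth) functions on $V$ are those that extend holomorphically (smoothly) to a neighbourhood. A smooth function $\phi: V \to \mathbb R$ is $J$-convex if $\omega_\phi(v,Jv) > 0$ for all nonzero real tangent vectors $v$, where $\omega_\phi := i\partial\bar\partial\phi$. Let $D^2 \subseteq \mathbb C$ be the closed unit disk. A Stein Lefschetz fibration is a holomorphic map $\pi: V \to D^2$, with $V$ a compact complex manifold with corners, such that: (i) $\pi$ is a smooth fibration whose fibres are manifolds with boundary, except at finitely many critical points, which lie in the interior of $V$; (ii) near each critical point $p$ there are holomorphic coordinates in which $\pi = \pi(p) + \sum_i z_i^2$, and the critical values are distinct; (iii) there is a smooth $J$-convex function on $V$ with the horizontal boundary $\partial_h V := \bigcup_{x \in D^2} \partial(\pi^{-1}(x))$ as its zero set, cut out regularly. For $g: \mathbb R_{<0} \to \mathbb R$ smooth with $g'>0$ and $g''>0$, the symplectic connection on $\pi: V \setminus \partial_h V \to D^2$ induced by $\omega_{g(\phi)}$ is the one whose horizontal vectors are those $\omega_{g(\phi)}$-orthogonal to $\ker d\pi$. It is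 complete if for every smooth path $\gamma: [0,1] \to D^2$, parallel transport along $\gamma$ is a well-defined diffeomorphism between the fibres over $\gamma(0)$ and $\gamma(1)$, away from the critical points of $\pi$. That is, one first removes from the fibre over $\gamma(0)$ the critical points and the points whose horizontal lift along $\gamma$ converges to a critical point at some time $T \le 1$, and removes from the fibre over $\gamma(1)$ the corresponding points for the reversed path; if $\gamma$ avoids the critical values, nothing is removed. Lemma. Let $\mathcal G$ be the set of smooth functions $g: \mathbb R_{<0} \to \mathbb R$ with $g' > 0$, $g'' > 0$, $\lim_{x \to 0^-} g(x) = \infty$ and $$\limsup_{x \to 0^-} \frac{g'(x)}{|x|\, g''(x)} < \infty,$$ with the $C^\infty$ topology (uniform convergence of all derivatives on compact subsets of $\mathbb R_{<0}$). (1) $\mathcal G$ is contractible (in particular non-empty). (2) Let $\pi: V \to D^2$ be any Stein Lefschetz fibration and $\phi: V \to \mathbb R$ any smooth $J$-convex function with $\partial_h V = \{\phi = 0\}$ as a regular level set. Then for every $g \in \mathcal G$ the symplectic connection on $\pi: V \setminus \partial_h V \to D^2$ induced by $\omega_{g(\phi)}$ is complete. In particular there exists a smooth $g: \mathbb R_{<0}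 \to \mathbb R$ with $g'>0$, $g''>0$ and $\lim_{x\to 0^-} g(x) = \infty$ for which this connection is complete. -/

import Mathlib

open Set Filter Topology
open scoped Manifold ContDiff

noncomputable section

namespace SteinLefschetz

/-- The model space `ℂⁿ`. -/
abbrev Cn (n : ℕ) : Type := EuclideanSpace ℂ (Fin n)

section Geometry

variable {n : ℕ} {M : Type*} [TopologicalSpace M] [ChartedSpace (Cn n) M]

/-! ### The Levi form

`M` is a complex manifold modelled on `ℂⁿ`. The tangent space at `p` is identified with `ℂⁿ`
through the preferred holomorphic chart at `p`, as Mathlib does; `J` is multiplication by `i`. -/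

/-- The real Hessian at `p` of a real-valued function, in the preferred chart at `p`. -/
def chartHessian (ψ : M → ℝ) (p : M) : Cn n →L[ℝ] Cn n →L[ℝ] ℝ :=
  fderiv ℝ (fderiv ℝ (ψ ∘ (chartAt (Cn n) p).symm)) (chartAt (Cn n) p p)

/-- The real two-form `ω_ψ = i d'd''ψ` at `p`. In holomorphic coordinates with real Hessian `H` it
is `ω_ψ(v, w) = (H(Jv, w) - H(v, Jw)) / 2`, and this does not depend on the coordinates. -/
def omegaForm (ψ : M → ℝ) (p : M) (v w : Cn n) : ℝ :=
  (chartHessian ψ p (Complex.I • v) w - chartHessian ψ p v (Complex.I • w)) / 2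

/-- `ψ` is `J`-convex at `p`: `(i d'd''ψ)(v, Jv) > 0` for every nonzero real tangent vector. -/
def JConvexAt (ψ : M → ℝ) (p : M) : Prop :=
  ∀ v : Cn n, v ≠ 0 → 0 < omegaForm ψ p v (Complex.I • v)

/-- The complex differential of `π : M → ℂ` at `p`. -/
def dPi (π : M → ℂ) (p : M) : Cn n →L[ℂ] ℂ :=
  mfderiv 𝓘(ℂ, Cn n) 𝓘(ℂ, ℂ) π p

/-- The real differential of `ψ : M → ℝ` at `p`. -/
def dReal (ψ : M → ℝ) (p : M) : Cn n →L[ℝ] ℝ :=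
  mfderiv 𝓘(ℝ, Cn n) 𝓘(ℝ, ℝ) ψ p

/-! ### Stein Lefschetz fibrations

A complex manifold with corners comes with a germ of a codimension zero embedding into an open
complex manifold, so the total space is a subset `V` of a complex manifold `M`; functions on `V`
are functions on `M`, of which only the restriction to a neighbourhood of `V` is ever used. -/

/-- The critical points of `π` on `V`. -/
def crit (V : Set M) (π : M → ℂ) : Set M :=
  {p | p ∈ V ∧ dPi (n := n) π p = 0}

/-- The horizontal boundary: the union of the boundaries of the fibres of `π : V → D²`. A point
of `V` is in the boundary of its fibre iff, arbitrarily near it, the ambient fibre leaves `V`. -/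
def horizontalBoundary (V : Set M) (π : M → ℂ) : Set M :=
  {p | p ∈ V ∧ ∃ᶠ q in 𝓝 p, π q = π p ∧ q ∉ V}

/-- `φ` is a smooth `J`-convex function on `V` with `∂_h V = {φ = 0}` as a regular level set. -/
structure CutsOutHorizontalBoundary (V : Set M) (π : M → ℂ) (φ : M → ℝ) : Prop where
  smooth : ∃ W : Set M, IsOpen W ∧ V ⊆ W ∧ ContMDiffOn 𝓘(ℝ, Cn n) 𝓘(ℝ, ℝ) ∞ φ W
  jConvex : ∀ p ∈ V, JConvexAt (n := n) φ p
  zero_iff : ∀ p ∈ V, φ p = 0 ↔ p ∈ horizontalBoundary V π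
  regular : ∀ p ∈ horizontalBoundary V π, dReal (n := n) φ p ≠ 0

/-- `π : V → D²` is a Stein Lefschetz fibration. -/
structure IsSteinLefschetzFibration [IsManifold 𝓘(ℂ, Cn n) ω M]
    (V : Set M) (π : M → ℂ) : Prop where
  compact : IsCompact V
  holomorphic : ∃ W : Set M, IsOpen W ∧ V ⊆ W ∧ ContMDiffOn 𝓘(ℂ, Cn n) 𝓘(ℂ, ℂ) ω π W
  mapsTo_disk : MapsTo π V (Metric.closedBall 0 1)
  /-- Away from its critical points `π` is a smooth fibration whose fibres are manifolds with
  boundary: near each such point `V` is cut out by `|π| ≤ 1` and `ρ ≤ 0` for a smooth real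
  function `ρ` which is either negative at the point or has nonzero differential along the fibre.
  (So `V` is a codimension zero submanifold with corners there.) -/
  fibration : ∀ p ∈ V, p ∉ crit (n := n) V π → ∃ (U : Set M) (ρ : M → ℝ),
    IsOpen U ∧ p ∈ U ∧ ContMDiffOn 𝓘(ℝ, Cn n) 𝓘(ℝ, ℝ) ∞ ρ U ∧
    V ∩ U = {q ∈ U | ‖π q‖ ≤ 1 ∧ ρ q ≤ 0} ∧
    (ρ p = 0 → ∃ v : Cn n, dPi π p v = 0 ∧ dReal ρ p v ≠ 0)
  crit_finite : (crit (n := n) V π).Finite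
  crit_interior : crit (n := n) V π ⊆ interior V
  /-- Near each critical point there are holomorphic coordinates with `π = π(p) + ∑ zᵢ²`. -/
  crit_nondegenerate : ∀ p ∈ crit (n := n) V π,
    ∃ z ∈ IsManifold.maximalAtlas 𝓘(ℂ, Cn n) ω M, p ∈ z.source ∧ z p = 0 ∧
      ∀ q ∈ z.source, π q = π p + ∑ i, (z q i) ^ 2
  crit_values_distinct : InjOn π (crit (n := n) V π)
  stein_fibres : ∃ φ : M → ℝ, CutsOutHorizontalBoundary (n := n) V π φ

/-! ### The symplectic connection and its parallel transport -/

/-- `v` is horizontal at `p` for the connection on `π` induced by `ω_{g(φ)}`: it is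
`ω_{g(φ)}`-orthogonal to `ker dπ`. -/
def IsHorizontal (π : M → ℂ) (φ : M → ℝ) (g : ℝ → ℝ) (p : M) (v : Cn n) : Prop :=
  ∀ w : Cn n, dPi π p w = 0 → omegaForm (fun q => g (φ q)) p v w = 0

/-- `c` is, over the time interval `S`, a horizontal lift of the path `γ` to `V ∖ ∂_h V`, away from
the critical points of `π`. -/
def IsHorizontalLift (V : Set M) (π : M → ℂ) (φ : M → ℝ) (g : ℝ → ℝ) (γ : ℝ → ℂ) (S : Set ℝ)
    (c : ℝ → M) : Prop :=
  ∀ t ∈ S, c t ∈ V \ horizontalBoundary V π ∧ c t ∉ crit (n := n) V π ∧ π (c t) = γ t ∧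
    ∃ v : Cn n, IsHorizontal π φ g (c t) v ∧
      HasMFDerivWithinAt 𝓘(ℝ, ℝ) 𝓘(ℝ, Cn n) c S t
        ((ContinuousLinearMap.toSpanSingleton ℝ v : ℝ →L[ℝ] Cn n))

/-- A smooth path `[0, 1] → D²`. -/
def IsSmoothPath (γ : ℝ → ℂ) : Prop :=
  ContDiffOn ℝ ∞ γ (Icc 0 1) ∧ MapsTo γ (Icc 0 1) (Metric.closedBall 0 1)

/-- The fibre of `π : V ∖ ∂_h V → D²` over `γ 0`, without the points that are critical or whose
horizontal lift along `γ` runs into a critical point of `π` at some time `T ≤ 1`. If `γ` avoids the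
critical values of `π` this is the whole fibre. -/
def transportableFibre (V : Set M) (π : M → ℂ) (φ : M → ℝ) (g : ℝ → ℝ) (γ : ℝ → ℂ) : Set M :=
  {p | p ∈ V \ horizontalBoundary V π ∧ π p = γ 0 ∧ p ∉ crit (n := n) V π ∧
    ∀ (T : ℝ) (c : ℝ → M), 0 < T → T ≤ 1 → c 0 = p →
      IsHorizontalLift (n := n) V π φ g γ (Ico 0 T) c →
        ∀ q ∈ crit (n := n) V π, ¬ Tendsto c (𝓝[<] T) (𝓝 q)}

/-- The symplectic connection on `π : V ∖ ∂_h V → D²` induced by `ω_{g(φ)}` is complete: along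
every smooth path in `D²`, parallel transport is a (well-defined) diffeomorphism from the fibre
over the starting point to the fibre over the end point, away from the critical points of `π`. -/
def ConnectionComplete (V : Set M) (π : M → ℂ) (φ : M → ℝ) (g : ℝ → ℝ) : Prop :=
  ∀ γ : ℝ → ℂ, IsSmoothPath γ → ∃ P : PartialEquiv M M,
    P.source = transportableFibre (n := n) V π φ g γ ∧
    P.target = transportableFibre (n := n) V π φ g (fun t => γ (1 - t)) ∧
    (∀ p ∈ P.source,
      (∃ c : ℝ → M, c 0 = p ∧ IsHorizontalLift (n := n) V π φ g γ (Icc 0 1) c) ∧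
      ∀ c : ℝ → M, c 0 = p → IsHorizontalLift (n := n) V π φ g γ (Icc 0 1) c → c 1 = P p) ∧
    ContMDiffOn 𝓘(ℝ, Cn n) 𝓘(ℝ, Cn n) ∞ P P.source ∧
    ContMDiffOn 𝓘(ℝ, Cn n) 𝓘(ℝ, Cn n) ∞ P.symm P.target

end Geometry

/-! ### The functions `g` -/

/-- `g : ℝ_{<0} → ℝ` is smooth with `g' > 0`, `g'' > 0` and `g(x) → ∞` as `x → 0⁻`. Only the
restriction of `g` to the negative reals matters. -/
structure IsConvexExhaustion (g : ℝ → ℝ) : Prop where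
  smooth : ContDiffOn ℝ ∞ g (Iio 0)
  deriv_pos : ∀ x < 0, 0 < deriv g x
  deriv_deriv_pos : ∀ x < 0, 0 < deriv (deriv g) x
  tendsto : Tendsto g (𝓝[<] 0) atTop

/-- The growth condition `limsup_{x → 0⁻} g'(x) / (|x| g''(x)) < ∞`. -/
def GrowthCondition (g : ℝ → ℝ) : Prop :=
  IsBoundedUnder (· ≤ ·) (𝓝[<] (0 : ℝ)) fun x => deriv g x / (|x| * deriv (deriv g) x)

/-- Extension by zero of a function on the negative reals. -/
def extendZero (g : Iio (0 : ℝ) → ℝ) : ℝ → ℝ :=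
  Function.extend Subtype.val g 0

/-- The space of functions `g : ℝ_{<0} → ℝ` as above that satisfy the growth condition. -/
def CompletingFunction : Type :=
  {g : Iio (0 : ℝ) → ℝ // IsConvexExhaustion (extendZero g) ∧ GrowthCondition (extendZero g)}

/-- The `C^∞` topology: uniform convergence of every derivative on compact subsets of the
negative reals. -/
instance : TopologicalSpace CompletingFunction :=
  TopologicalSpace.induced
    (fun g (k : ℕ) => UniformOnFun.ofFun {K : Set ℝ | IsCompact K ∧ K ⊆ Iio 0}
      (iteratedDeriv k (extendZero g.1)))
    inferInstance

end SteinLefschetz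

end

open SteinLefschetz

noncomputable section

set_option linter.unusedSectionVars false

namespace SteinLefschetz

/-! Contractibility is convexity. When g'' > 0 the growth condition says g' ≤ C |x| g'' near 0. This
is stable under convex combinations, so the straight-line homotopy contracts the space to -log(-x),
for which g' = |x| g''.

Completeness rests on ω_{g(φ)} = g'(φ) ω_φ + g''(φ) σ, where σ is a semipositive form built from dφ
and dφ ∘ J (`levi_real_comp`). Near the horizontal boundary dφ does not vanish along the fibres.
Testing a horizontal vector v against two suitable vertical vectors gives g''(φ) |dφ(v)| ≤ C g'(φ)
|dπ(v)| with C independent of the values of g' and g'' (`horizontal_bound`,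
`exists_horizontal_bound`). The growth condition turns this into |dφ(v)| ≤ C' |φ| |dπ(v)|. So log
|φ| changes at a bounded rate along a lift near the boundary, and φ stays below a negative constant
over any finite time (`IsTransport.exists_le_neg`).

As V is compact, a lift over [0, T) has cluster points, and none of them is on the horizontal
boundary. A flow box around a noncritical cluster point continues the lift to T. If all cluster
points are critical, the lift converges to one of them, the critical set being finite; such starting
points are exactly the ones removed from the fibre. Uniqueness is Picard–Lindelöf. Smooth dependence
on the starting point comes from the implicit function theorem for the integral equation on C([0,1],
E), chained through finitely many flow boxes. The inverse of transport is transport along the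
reversed path.

Two preparations are needed. Since g is controlled only on the negative reals, φ has to be negative
off the horizontal boundary. For n ≥ 2 this is the maximum principle on the fibres
(`neg_of_notMem_horizontalBoundary`); for n ≤ 1 horizontality is an empty condition at noncritical
points and φ can be shifted by a constant. Moreover dφ ≠ 0 on the horizontal boundary has to be
upgraded to dφ ≠ 0 along the fibre (`exists_ker_fderiv_chart_ne_zero`). -/

lemma extendZero_apply (g : Iio (0 : ℝ) → ℝ) {x : ℝ} (hx : x < 0) :
    extendZero g x = g ⟨x, hx⟩ :=
  Subtype.val_injective.extend_apply g 0 (⟨x, hx⟩ : Iio (0 : ℝ))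

lemma extendZero_restrict_eqOn (G : ℝ → ℝ) :
    EqOn (extendZero fun x => G x) G (Iio 0) := fun _ hx => extendZero_apply _ hx

lemma eqOn_deriv_of_eqOn_Iio {f g : ℝ → ℝ} (h : EqOn f g (Iio 0)) :
    EqOn (deriv f) (deriv g) (Iio 0) := fun _ hx =>
  (h.eventuallyEq_of_mem (isOpen_Iio.mem_nhds hx)).deriv_eq

lemma IsConvexExhaustion.congr {f g : ℝ → ℝ} (hf : IsConvexExhaustion f)
    (h : EqOn g f (Iio 0)) : IsConvexExhaustion g where
  smooth := hf.smooth.congr h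
  deriv_pos x hx := by rw [eqOn_deriv_of_eqOn_Iio h hx]; exact hf.deriv_pos x hx
  deriv_deriv_pos x hx := by
    rw [eqOn_deriv_of_eqOn_Iio (eqOn_deriv_of_eqOn_Iio h) hx]; exact hf.deriv_deriv_pos x hx
  tendsto := hf.tendsto.congr' (h.symm.eventuallyEq_of_mem self_mem_nhdsWithin)

lemma GrowthCondition.congr {f g : ℝ → ℝ} (hf : GrowthCondition f)
    (h : EqOn g f (Iio 0)) : GrowthCondition g := by
  obtain ⟨C, hC⟩ := hf
  refine ⟨C, ?_⟩
  rw [eventually_map] at hC ⊢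
  filter_upwards [hC, self_mem_nhdsWithin] with x hx hx0
  rw [eqOn_deriv_of_eqOn_Iio (eqOn_deriv_of_eqOn_Iio h) hx0, eqOn_deriv_of_eqOn_Iio h hx0]
  exact hx

/-- With the denominator cleared the condition is linear in g for each fixed C, which is the form
that survives convex combinations. -/
lemma IsConvexExhaustion.growthCondition_iff {g : ℝ → ℝ} (hg : IsConvexExhaustion g) :
    GrowthCondition g ↔ ∃ C, ∀ᶠ x in 𝓝[<] (0 : ℝ), deriv g x ≤ C * (|x| * deriv (deriv g) x) := by
  refine exists_congr fun C => ?_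
  rw [eventually_map]
  refine eventually_congr ?_
  filter_upwards [self_mem_nhdsWithin] with x hx
  exact div_le_iff₀ (mul_pos (abs_pos.2 (ne_of_lt hx)) (hg.deriv_deriv_pos x hx))

lemma IsConvexExhaustion.contDiffAt {g : ℝ → ℝ} (hg : IsConvexExhaustion g) {x : ℝ} (hx : x < 0) :
    ContDiffAt ℝ ∞ g x :=
  hg.smooth.contDiffAt (isOpen_Iio.mem_nhds hx)

lemma IsConvexExhaustion.differentiableAt {g : ℝ → ℝ} (hg : IsConvexExhaustion g) {x : ℝ}
    (hx : x < 0) : DifferentiableAt ℝ g x :=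
  (hg.contDiffAt hx).differentiableAt (by simp)

lemma IsConvexExhaustion.differentiableAt_deriv {g : ℝ → ℝ} (hg : IsConvexExhaustion g) {x : ℝ}
    (hx : x < 0) : DifferentiableAt ℝ (deriv g) x := by
  have h : ContDiffOn ℝ 1 (deriv g) (Iio 0) :=
    ((contDiffOn_succ_iff_deriv_of_isOpen (n := 1) isOpen_Iio).1
      (hg.smooth.of_le (by norm_cast))).2.2
  exact (h.differentiableOn (by simp)).differentiableAt (isOpen_Iio.mem_nhds hx)

/-! ### Convexity of the conditions on g -/

section Convex

variable {f g : ℝ → ℝ} {s t : ℝ}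

lemma IsConvexExhaustion.eqOn_deriv_combo (hf : IsConvexExhaustion f) (hg : IsConvexExhaustion g) :
    EqOn (deriv fun x => s * f x + t * g x) (fun x => s * deriv f x + t * deriv g x) (Iio 0) :=
  fun _ hx => (((hf.differentiableAt hx).hasDerivAt.const_mul s).add
    ((hg.differentiableAt hx).hasDerivAt.const_mul t)).deriv

lemma IsConvexExhaustion.eqOn_deriv_deriv_combo (hf : IsConvexExhaustion f)
    (hg : IsConvexExhaustion g) :
    EqOn (deriv (deriv fun x => s * f x + t * g x))
      (fun x => s * deriv (deriv f) x + t * deriv (deriv g) x) (Iio 0) := fun x hx => by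
  rw [eqOn_deriv_of_eqOn_Iio (hf.eqOn_deriv_combo hg) hx]
  exact (((hf.differentiableAt_deriv hx).hasDerivAt.const_mul s).add
    ((hg.differentiableAt_deriv hx).hasDerivAt.const_mul t)).deriv

lemma combo_pos {a b : ℝ} (hs : 0 ≤ s) (ht : 0 ≤ t) (hst : s + t = 1) (ha : 0 < a) (hb : 0 < b) :
    0 < s * a + t * b := by
  rcases hs.eq_or_lt with rfl | hs
  · have : t = 1 := by linarith
    subst this; linarith
  · have := mul_pos hs ha
    have := mul_nonneg ht hb.le
    linarith

lemma IsConvexExhaustion.combo (hf : IsConvexExhaustion f) (hg : IsConvexExhaustion g)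
    (hs : 0 ≤ s) (ht : 0 ≤ t) (hst : s + t = 1) :
    IsConvexExhaustion fun x => s * f x + t * g x where
  smooth := (contDiffOn_const.mul hf.smooth).add (contDiffOn_const.mul hg.smooth)
  deriv_pos x hx := by
    rw [hf.eqOn_deriv_combo hg hx]
    exact combo_pos hs ht hst (hf.deriv_pos x hx) (hg.deriv_pos x hx)
  deriv_deriv_pos x hx := by
    rw [hf.eqOn_deriv_deriv_combo hg hx]
    exact combo_pos hs ht hst (hf.deriv_deriv_pos x hx) (hg.deriv_deriv_pos x hx)
  tendsto := by
    rw [tendsto_atTop]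
    intro B
    filter_upwards [hf.tendsto.eventually_ge_atTop B, hg.tendsto.eventually_ge_atTop B]
      with x h1 h2
    calc B = s * B + t * B := by rw [← add_mul, hst, one_mul]
      _ ≤ _ := by gcongr

lemma GrowthCondition.combo (hf : IsConvexExhaustion f) (hg : IsConvexExhaustion g)
    (hs : 0 ≤ s) (ht : 0 ≤ t) (hst : s + t = 1) (hf' : GrowthCondition f)
    (hg' : GrowthCondition g) : GrowthCondition fun x => s * f x + t * g x := by
  obtain ⟨C, hC⟩ := hf.growthCondition_iff.1 hf'
  obtain ⟨D, hD⟩ := hg.growthCondition_iff.1 hg'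
  refine (hf.combo hg hs ht hst).growthCondition_iff.2 ⟨max C D, ?_⟩
  filter_upwards [hC, hD, self_mem_nhdsWithin] with x h1 h2 hx
  rw [hf.eqOn_deriv_deriv_combo hg hx, hf.eqOn_deriv_combo hg hx]
  have a1 := mul_pos (abs_pos.2 (ne_of_lt hx)) (hf.deriv_deriv_pos x hx)
  have a2 := mul_pos (abs_pos.2 (ne_of_lt hx)) (hg.deriv_deriv_pos x hx)
  have e1 : deriv f x ≤ max C D * (|x| * deriv (deriv f) x) :=
    h1.trans (mul_le_mul_of_nonneg_right (le_max_left _ _) a1.le)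
  have e2 : deriv g x ≤ max C D * (|x| * deriv (deriv g) x) :=
    h2.trans (mul_le_mul_of_nonneg_right (le_max_right _ _) a2.le)
  nlinarith [mul_le_mul_of_nonneg_left e1 hs, mul_le_mul_of_nonneg_left e2 ht]

end Convex

/-! ### The model function `-log(-x)` -/

lemma hasDerivAt_neg_log_neg {x : ℝ} (hx : x < 0) :
    HasDerivAt (fun y : ℝ => -Real.log (-y)) (-x)⁻¹ x := by
  convert! ((hasDerivAt_neg x).log (by linarith : -x ≠ 0)).neg using 1
  rw [neg_div, neg_neg, one_div]

lemma hasDerivAt_inv_neg {x : ℝ} (hx : x < 0) :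
    HasDerivAt (fun y : ℝ => (-y)⁻¹) ((-x) ^ 2)⁻¹ x := by
  convert! (hasDerivAt_neg x).inv (by linarith : -x ≠ 0) using 1
  rw [neg_neg, one_div]

lemma eqOn_deriv_neg_log_neg :
    EqOn (deriv fun y : ℝ => -Real.log (-y)) (fun x => (-x)⁻¹) (Iio 0) :=
  fun _ hx => (hasDerivAt_neg_log_neg hx).deriv

lemma eqOn_deriv_deriv_neg_log_neg :
    EqOn (deriv (deriv fun y : ℝ => -Real.log (-y))) (fun x => ((-x) ^ 2)⁻¹) (Iio 0) :=
  fun x hx => by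
    rw [eqOn_deriv_of_eqOn_Iio eqOn_deriv_neg_log_neg hx]; exact (hasDerivAt_inv_neg hx).deriv

lemma isConvexExhaustion_neg_log_neg : IsConvexExhaustion fun y : ℝ => -Real.log (-y) where
  smooth := (ContDiffOn.log contDiffOn_id.neg fun x hx => by
    have : x < 0 := hx
    simp only [id]; linarith).neg
  deriv_pos x hx := by
    rw [eqOn_deriv_neg_log_neg hx]; exact inv_pos.2 (by linarith)
  deriv_deriv_pos x hx := by
    rw [eqOn_deriv_deriv_neg_log_neg hx]
    exact inv_pos.2 (pow_pos (by linarith) 2)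
  tendsto := by
    refine tendsto_neg_atBot_atTop.comp (Real.tendsto_log_nhdsGT_zero.comp ?_)
    have h : Tendsto (fun y : ℝ => -y) (𝓝[<] 0) (𝓝[>] (-0)) := tendsto_neg_nhdsLT
    simpa using h

/-- The quotient g' / (|x| g'') is identically 1 here, which makes this function the centre of the
contraction. -/
lemma growthCondition_neg_log_neg : GrowthCondition fun y : ℝ => -Real.log (-y) := by
  refine isConvexExhaustion_neg_log_neg.growthCondition_iff.2 ⟨1, ?_⟩
  filter_upwards [self_mem_nhdsWithin] with x hx
  have hx' : 0 < -x := by simpa using hx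
  rw [eqOn_deriv_deriv_neg_log_neg hx, eqOn_deriv_neg_log_neg hx, abs_of_neg hx]
  refine le_of_eq ?_
  field_simp

/-! ### Contractibility -/

namespace CompletingFunction

/-- The completing function obtained by restricting a function on the real line. -/
def ofReal (G : ℝ → ℝ) (h : IsConvexExhaustion G) (h' : GrowthCondition G) :
    CompletingFunction :=
  ⟨fun x => G x, h.congr (extendZero_restrict_eqOn G), h'.congr (extendZero_restrict_eqOn G)⟩

/-- The point at time `t` of the segment from `f` to `g`. -/
def segment (t : unitInterval) (f g : CompletingFunction) : CompletingFunction :=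
  ofReal (fun x => (1 - (t : ℝ)) * extendZero f.1 x + t * extendZero g.1 x)
    (f.2.1.combo g.2.1 (unitInterval.one_minus_nonneg t) t.2.1 (by ring))
    (GrowthCondition.combo f.2.1 g.2.1 (unitInterval.one_minus_nonneg t) t.2.1 (by ring) f.2.2 g.2.2)

lemma segment_zero (f g : CompletingFunction) : segment 0 f g = f := by
  refine Subtype.ext (funext fun x => ?_)
  simp [segment, ofReal, extendZero_apply _ x.2]

lemma segment_one (f g : CompletingFunction) : segment 1 f g = g := by
  refine Subtype.ext (funext fun x => ?_)
  simp [segment, ofReal, extendZero_apply _ x.2]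

lemma iteratedDeriv_segment (t : unitInterval) (f g : CompletingFunction) (k : ℕ) :
    EqOn (iteratedDeriv k (extendZero (segment t f g).1))
      (fun x => (1 - (t : ℝ)) * iteratedDeriv k (extendZero f.1) x +
        t * iteratedDeriv k (extendZero g.1) x) (Iio 0) := by
  intro x hx
  have h1 : extendZero (segment t f g).1 =ᶠ[𝓝 x]
      fun x => (1 - (t : ℝ)) * extendZero f.1 x + t * extendZero g.1 x :=
    (extendZero_restrict_eqOn fun x => (1 - (t : ℝ)) * extendZero f.1 x +
      t * extendZero g.1 x).eventuallyEq_of_mem (isOpen_Iio.mem_nhds hx)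
  have h2 := (f.2.1.contDiffAt hx).of_le (m := k) (by exact_mod_cast le_top)
  have h3 := (g.2.1.contDiffAt hx).of_le (m := k) (by exact_mod_cast le_top)
  rw [h1.iteratedDeriv_eq k, iteratedDeriv_fun_add (contDiffAt_const.mul h2)
    (contDiffAt_const.mul h3), iteratedDeriv_const_mul_field, iteratedDeriv_const_mul_field]

lemma continuousOn_iteratedDeriv (f : CompletingFunction) (k : ℕ) :
    ContinuousOn (iteratedDeriv k (extendZero f.1)) (Iio 0) := by
  refine (f.2.1.smooth.continuousOn_iteratedDerivWithin (m := k) (by exact_mod_cast le_top)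
    isOpen_Iio.uniqueDiffOn).congr fun x hx => ?_
  exact (iteratedDerivWithin_of_isOpen isOpen_Iio hx).symm

lemma tendstoUniformlyOn_iteratedDeriv (f : CompletingFunction) (k : ℕ) {K : Set ℝ}
    (hK : IsCompact K) (hK' : K ⊆ Iio 0) :
    TendstoUniformlyOn (fun (g : CompletingFunction) => iteratedDeriv k (extendZero g.1))
      (iteratedDeriv k (extendZero f.1)) (𝓝 f) K := by
  have h := (continuous_pi_iff.1 (continuous_induced_dom (f := fun (g : CompletingFunction) (k : ℕ) =>
    UniformOnFun.ofFun {K : Set ℝ | IsCompact K ∧ K ⊆ Iio 0}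
      (iteratedDeriv k (extendZero g.1)))) k).tendsto f
  exact UniformOnFun.tendsto_iff_tendstoUniformlyOn.1 h K ⟨hK, hK'⟩

lemma continuous_segment (g : CompletingFunction) :
    Continuous fun p : unitInterval × CompletingFunction => segment p.1 p.2 g := by
  refine continuous_induced_rng.2 (continuous_pi fun k => continuous_iff_continuousAt.2 ?_)
  rintro ⟨t₀, f₀⟩
  refine UniformOnFun.tendsto_iff_tendstoUniformlyOn.2 fun K hK => ?_
  change TendstoUniformlyOn (fun p : unitInterval × CompletingFunction =>
    iteratedDeriv k (extendZero (segment p.1 p.2 g).1))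
    (iteratedDeriv k (extendZero (segment t₀ f₀ g).1)) _ K
  obtain ⟨A, hA⟩ := hK.1.exists_bound_of_continuousOn
    ((f₀.continuousOn_iteratedDeriv k).mono hK.2)
  obtain ⟨B, hB⟩ := hK.1.exists_bound_of_continuousOn
    ((g.continuousOn_iteratedDeriv k).mono hK.2)
  rw [Metric.tendstoUniformlyOn_iff]
  intro ε hε
  have h1 := (Metric.tendstoUniformlyOn_iff.1
    (f₀.tendstoUniformlyOn_iteratedDeriv k hK.1 hK.2)) (ε / 2) (half_pos hε)
  have h2 : ∀ᶠ t : unitInterval in 𝓝 t₀, |(t₀ : ℝ) - t| * (|A| + |B|) < ε / 2 := by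
    have : Tendsto (fun t : unitInterval => |(t₀ : ℝ) - t| * (|A| + |B|)) (𝓝 t₀)
        (𝓝 (|(t₀ : ℝ) - t₀| * (|A| + |B|))) := by
      refine Continuous.tendsto ?_ _
      fun_prop
    exact this.eventually_lt_const (by simpa using half_pos hε)
  filter_upwards [h2.prod_nhds h1] with p hp x hx
  obtain ⟨hp1, hp2⟩ := hp
  rw [iteratedDeriv_segment _ _ _ _ (hK.2 hx), iteratedDeriv_segment _ _ _ _ (hK.2 hx)]
  have e1 := hp2 x hx
  have e2 := hA x hx
  have e3 := hB x hx
  rw [Real.dist_eq] at e1 ⊢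
  rw [Real.norm_eq_abs] at e2 e3
  set a := iteratedDeriv k (extendZero f₀.1) x
  set b := iteratedDeriv k (extendZero p.2.1) x
  set c := iteratedDeriv k (extendZero g.1) x
  -- Separates the two sources of change: moving the function, controlled by uniform convergence on
  -- K, and moving the time, controlled by the bounds A and B on K.
  have e4 : (1 - (t₀ : ℝ)) * a + t₀ * c - ((1 - (p.1 : ℝ)) * b + p.1 * c) =
    (1 - (p.1 : ℝ)) * (a - b) + (t₀ - p.1) * (c - a) := by ring
  rw [e4]
  calc _ ≤ |(1 - (p.1 : ℝ)) * (a - b)| + |(t₀ - p.1) * (c - a)| := abs_add_le _ _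
    _ ≤ 1 * |a - b| + |(t₀ : ℝ) - p.1| * (|A| + |B|) := by
        rw [abs_mul, abs_mul]
        gcongr
        · rw [abs_of_nonneg (unitInterval.one_minus_nonneg p.1)]; linarith [p.1.2.1]
        · have := abs_sub c a
          linarith [le_abs_self A, le_abs_self B]
    _ < ε := by linarith

instance contractibleSpace : ContractibleSpace CompletingFunction := by
  rw [contractible_iff_id_nullhomotopic]
  let g₀ := ofReal _ isConvexExhaustion_neg_log_neg growthCondition_neg_log_neg
  exact ⟨g₀, ⟨{ toFun := fun p => segment p.1 p.2 g₀
                continuous_toFun := continuous_segment g₀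
                map_zero_left := fun f => segment_zero f g₀
                map_one_left := fun f => segment_one f g₀ }⟩⟩

end CompletingFunction

/-! ### The Levi form on a complex normed space -/

section Levi

variable {E E' : Type*} [NormedAddCommGroup E] [NormedSpace ℂ E] [NormedSpace ℝ E]
  [IsScalarTower ℝ ℂ E] [NormedAddCommGroup E'] [NormedSpace ℂ E'] [NormedSpace ℝ E']
  [IsScalarTower ℝ ℂ E']

/-- The two-form `i d'd''f` at `x`. -/
def levi (f : E → ℝ) (x v w : E) : ℝ :=
  (fderiv ℝ (fderiv ℝ f) x (Complex.I • v) w - fderiv ℝ (fderiv ℝ f) x v (Complex.I • w)) / 2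

lemma I_smul_I_smul (v : E) : Complex.I • Complex.I • v = -v := by
  rw [smul_smul, Complex.I_mul_I, neg_one_smul]

lemma complex_smul_eq (z : ℂ) (v : E) : z • v = z.re • v + z.im • Complex.I • v := by
  conv_lhs => rw [← Complex.re_add_im z]
  rw [add_smul, mul_smul, ← Complex.coe_algebraMap, algebraMap_smul, algebraMap_smul]

/-- Multiplication by `i`, as a real linear map. -/
def mulI (E : Type*) [NormedAddCommGroup E] [NormedSpace ℂ E] [NormedSpace ℝ E]
    [IsScalarTower ℝ ℂ E] : E →L[ℝ] E :=
  (Complex.I • ContinuousLinearMap.id ℂ E).restrictScalars ℝ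

@[simp] lemma mulI_apply (v : E) : mulI E v = Complex.I • v := rfl

/-- The Levi form as a continuous bilinear map. -/
def leviL (f : E → ℝ) (x : E) : E →L[ℝ] E →L[ℝ] ℝ :=
  (2 : ℝ)⁻¹ • ((fderiv ℝ (fderiv ℝ f) x).comp (mulI E) -
    ((ContinuousLinearMap.compL ℝ E E ℝ).flip (mulI E)).comp (fderiv ℝ (fderiv ℝ f) x))

lemma leviL_apply (f : E → ℝ) (x v w : E) : leviL f x v w = levi f x v w := by
  simp [leviL, levi, div_eq_inv_mul]

lemma levi_congr {f g : E → ℝ} {x : E} (h : f =ᶠ[𝓝 x] g) (v w : E) :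
    levi f x v w = levi g x v w := by
  rw [levi, levi, h.fderiv.fderiv_eq]

/-- A consequence of the antisymmetrised formula alone; symmetry of the second derivative plays no
part. -/
lemma levi_I_smul_I_smul (f : E → ℝ) (x v w : E) :
    levi f x (Complex.I • v) (Complex.I • w) = levi f x v w := by
  simp only [levi, I_smul_I_smul, map_neg, neg_apply]
  ring

lemma contDiffAt_leviL {f : E → ℝ} {x : E} (hf : ContDiffAt ℝ ∞ f x) :
    ContDiffAt ℝ ∞ (leviL f) x := by
  have h1 : ContDiffAt ℝ ∞ (fderiv ℝ (fderiv ℝ f)) x :=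
    (hf.fderiv_right (m := ∞) le_rfl).fderiv_right le_rfl
  have h2 : ContDiffAt ℝ ∞ (fun y => (fderiv ℝ (fderiv ℝ f) y).comp (mulI E)) x :=
    h1.clm_comp contDiffAt_const
  have h3 : ContDiffAt ℝ ∞ (fun y => ((ContinuousLinearMap.compL ℝ E E ℝ).flip (mulI E)).comp
      (fderiv ℝ (fderiv ℝ f) y)) x := contDiffAt_const.clm_comp h1
  exact (h2.sub h3).const_smul (2 : ℝ)⁻¹

lemma fderiv_fderiv_comp_apply {G : E' → E} {f : E → ℝ} {x : E'} (hG : ContDiffAt ℝ 2 G x)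
    (hf : ContDiffAt ℝ 2 f (G x)) (v w : E') :
    fderiv ℝ (fderiv ℝ (f ∘ G)) x v w =
      fderiv ℝ (fderiv ℝ f) (G x) (fderiv ℝ G x v) (fderiv ℝ G x w) +
      fderiv ℝ f (G x) (fderiv ℝ (fderiv ℝ G) x v w) := by
  have e : fderiv ℝ (f ∘ G) =ᶠ[𝓝 x] fun y => (fderiv ℝ f (G y)).comp (fderiv ℝ G y) := by
    filter_upwards [hG.eventually (by simp), hG.continuousAt.eventually (hf.eventually (by simp))]
      with y h1 h2
    exact fderiv_comp y (h2.differentiableAt (by simp)) (h1.differentiableAt (by simp))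
  have h1 : DifferentiableAt ℝ (fderiv ℝ f) (G x) :=
    (hf.fderiv_right (m := 1) le_rfl).differentiableAt (by simp)
  have h2 : DifferentiableAt ℝ (fderiv ℝ G) x :=
    (hG.fderiv_right (m := 1) le_rfl).differentiableAt (by simp)
  have h3 := h1.hasFDerivAt.comp x (hG.differentiableAt (by simp)).hasFDerivAt
  have h4 : fderiv ℝ (fun y => (fderiv ℝ f (G y)).comp (fderiv ℝ G y)) x = _ :=
    (h3.clm_comp h2.hasFDerivAt).fderiv
  rw [e.fderiv_eq, h4]
  simp [add_comm]

lemma fderiv_fderiv_I_smul {G : E' → E} {x : E'} (hG : ContDiffAt ℂ 2 G x) (v w : E') :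
    fderiv ℝ (fderiv ℝ G) x (Complex.I • v) w = fderiv ℝ (fderiv ℝ G) x v (Complex.I • w) := by
  have e : fderiv ℝ G =ᶠ[𝓝 x] fun y => (fderiv ℂ G y).restrictScalars ℝ := by
    filter_upwards [hG.eventually (by simp)] with y h1
    exact (h1.differentiableAt (by simp)).fderiv_restrictScalars ℝ
  have h2 : DifferentiableAt ℂ (fderiv ℂ G) x :=
    (hG.fderiv_right (m := 1) le_rfl).differentiableAt (by simp)
  have h3 := (ContinuousLinearMap.restrictScalarsL ℂ E' E ℝ ℝ).hasFDerivAt.comp x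
    (h2.hasFDerivAt.restrictScalars ℝ)
  have h4 : fderiv ℝ (fun y => (fderiv ℂ G y).restrictScalars ℝ) x = _ := h3.fderiv
  rw [e.fderiv_eq, h4]
  simp

/-- The second derivative of G is complex bilinear, so its contributions at (iv, w) and (v, iw)
cancel. This is what makes the form independent of the holomorphic chart. -/
lemma levi_comp {G : E' → E} {f : E → ℝ} {x : E'} (hG : ContDiffAt ℂ 2 G x)
    (hf : ContDiffAt ℝ 2 f (G x)) (v w : E') :
    levi (f ∘ G) x v w = levi f (G x) (fderiv ℂ G x v) (fderiv ℂ G x w) := by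
  have hG' := hG.restrict_scalars ℝ
  have h1 := (hG.differentiableAt (by simp)).fderiv_restrictScalars ℝ
  simp only [levi, fderiv_fderiv_comp_apply hG' hf, fderiv_fderiv_I_smul hG, h1,
    ContinuousLinearMap.coe_restrictScalars', map_smul]
  ring

/-- At (v, iv) the coefficient of g'' is half of df(v)² + df(iv)², hence nonnegative. So composing
with a convex increasing g keeps f strictly J-convex, and a large g''/g' penalises vectors
transverse to the level sets of f. -/
lemma levi_real_comp {f : E → ℝ} {g : ℝ → ℝ} {x : E} (hf : ContDiffAt ℝ 2 f x)
    (hg : ContDiffAt ℝ 2 g (f x)) (v w : E) :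
    levi (g ∘ f) x v w = deriv g (f x) * levi f x v w + deriv (deriv g) (f x) *
      ((fderiv ℝ f x (Complex.I • v) * fderiv ℝ f x w -
        fderiv ℝ f x v * fderiv ℝ f x (Complex.I • w)) / 2) := by
  have e : fderiv ℝ (g ∘ f) =ᶠ[𝓝 x] fun y => deriv g (f y) • fderiv ℝ f y := by
    filter_upwards [hf.eventually (by simp), hf.continuousAt.eventually (hg.eventually (by simp))]
      with y h1 h2
    exact ((h2.differentiableAt (by simp)).hasDerivAt.comp_hasFDerivAt y
      (h1.differentiableAt (by simp)).hasFDerivAt).fderiv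
  have hg1 : DifferentiableAt ℝ (deriv g) (f x) := by
    have h := (hg.fderiv_right (m := 1) le_rfl).differentiableAt (by simp)
    exact h.clm_apply (differentiableAt_const (1 : ℝ))
  have h1 := hg1.hasDerivAt.comp_hasFDerivAt x (hf.differentiableAt (by simp)).hasFDerivAt
  have h2 : DifferentiableAt ℝ (fderiv ℝ f) x :=
    (hf.fderiv_right (m := 1) le_rfl).differentiableAt (by simp)
  have h3 : ∀ v w, fderiv ℝ (fderiv ℝ (g ∘ f)) x v w = deriv g (f x) *
      fderiv ℝ (fderiv ℝ f) x v w +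
      deriv (deriv g) (f x) * (fderiv ℝ f x v * fderiv ℝ f x w) := by
    intro v w
    have h4 : fderiv ℝ (fun y => deriv g (f y) • fderiv ℝ f y) x = _ :=
      (h1.smul h2.hasFDerivAt).fderiv
    rw [e.fderiv_eq, h4]
    simp
    ring
  simp only [levi, h3]
  ring

/-- The value at (v, iv) is half the sum of the Hessian on v and on iv, and both are nonpositive at
a local maximum. -/
lemma levi_nonpos_of_isLocalMax {f : E → ℝ} {x : E} (hf : ContDiffAt ℝ 2 f x)
    (hmax : IsLocalMax f x) (v : E) : levi f x v (Complex.I • v) ≤ 0 := by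
  have key : ∀ w : E, fderiv ℝ (fderiv ℝ f) x w w ≤ 0 := by
    intro w
    have hl : ∀ t : ℝ, HasDerivAt (fun t : ℝ => x + t • w) w t := fun t => by
      simpa using ((hasDerivAt_id t).smul_const w).const_add x
    have hc : Tendsto (fun t : ℝ => x + t • w) (𝓝 0) (𝓝 x) := by
      simpa using (hl 0).continuousAt.tendsto
    have e1 : deriv (fun t : ℝ => f (x + t • w)) =ᶠ[𝓝 0] fun t => fderiv ℝ f (x + t • w) w := by
      filter_upwards [hc.eventually (hf.eventually (by simp))] with t ht
      exact ((ht.differentiableAt (by simp)).hasFDerivAt.comp_hasDerivAt t (hl t)).deriv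
    have e2 : deriv (deriv fun t : ℝ => f (x + t • w)) 0 = fderiv ℝ (fderiv ℝ f) x w w := by
      have h2 : DifferentiableAt ℝ (fderiv ℝ f) (x + (0 : ℝ) • w) := by
        rw [zero_smul, add_zero]
        exact (hf.fderiv_right (m := 1) le_rfl).differentiableAt (by simp)
      rw [e1.deriv_eq]
      have h3 := ((ContinuousLinearMap.apply ℝ ℝ w).hasFDerivAt.comp_hasDerivAt (0 : ℝ)
        (h2.hasFDerivAt.comp_hasDerivAt (0 : ℝ) (hl 0))).deriv
      rw [zero_smul, add_zero] at h3
      exact h3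
    by_contra! hpos
    rw [← e2] at hpos
    have hmax' : IsLocalMax (fun t : ℝ => f (x + t • w)) 0 := by
      filter_upwards [hc.eventually hmax] with t ht
      rwa [zero_smul, add_zero]
    have hcont : ContinuousAt (fun t : ℝ => f (x + t • w)) 0 := by
      have : ContinuousAt f (x + (0 : ℝ) • w) := by simpa using hf.continuousAt
      exact ContinuousAt.comp (f := fun t : ℝ => x + t • w) this (hl 0).continuousAt
    -- A positive second derivative would make 0 a local minimum as well as a local maximum. The
    -- function is then locally constant and its second derivative is zero.
    have hmin := isLocalMin_of_deriv_deriv_pos hpos hmax'.deriv_eq_zero hcont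
    have e3 : (fun t : ℝ => f (x + t • w)) =ᶠ[𝓝 0] fun _ => f (x + (0 : ℝ) • w) := by
      filter_upwards [hmax', hmin] with t h1 h2 using le_antisymm h1 h2
    have : deriv (deriv fun t : ℝ => f (x + t • w)) 0 = 0 := by
      have e4 : deriv (fun t : ℝ => f (x + t • w)) =ᶠ[𝓝 0] fun _ => 0 := by
        filter_upwards [e3.deriv] with t ht
        rw [ht]; simp
      rw [e4.deriv_eq]; simp
    linarith
  have h1 := key v
  have h2 := key (Complex.I • v)
  simp only [levi, I_smul_I_smul, map_neg]
  linarith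

lemma not_isLocalMax_of_levi_pos {G : ℂ → E} {f : E → ℝ} (hG : ContDiffAt ℂ 2 G 0)
    (hf : ContDiffAt ℝ 2 f (G 0)) (hG' : fderiv ℂ G 0 1 ≠ 0)
    (hpos : ∀ v : E, v ≠ 0 → 0 < levi f (G 0) v (Complex.I • v)) : ¬ IsLocalMax (f ∘ G) 0 := by
  intro h
  have h1 := levi_nonpos_of_isLocalMax (hf.comp (0 : ℂ) (hG.restrict_scalars ℝ)) h 1
  rw [levi_comp hG hf, map_smul] at h1
  exact absurd (hpos _ hG') (not_lt.2 h1)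

end Levi

/-! ### Straightening a submersion -/

/-- The map x ↦ x + R(remainder of G at first order) has derivative the identity at x₀, and G'
carries its displacement from x₀ to G x - G x₀ because G' R = id. Its local inverse σ therefore
makes G affine. The correction lies in the range of R, so σ moves points only in those directions.
The last clause is separate because infinite differentiability at one point does not spread to a
neighbourhood. -/
lemma exists_straightening {𝕜 E F : Type*} [RCLike 𝕜] [NormedAddCommGroup E] [NormedSpace 𝕜 E]
    [CompleteSpace E] [NormedAddCommGroup F] [NormedSpace 𝕜 F] {G : E → F} {G' : E →L[𝕜] F}
    {x₀ : E} {n : WithTop ℕ∞} (hn : n ≠ 0) (hG : ContDiffAt 𝕜 n G x₀) (hG' : HasFDerivAt G G' x₀)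
    (R : F →L[𝕜] E) (hR : ∀ y, G' (R y) = y) :
    ∃ σ : E → E, σ x₀ = x₀ ∧ ContDiffAt 𝕜 n σ x₀ ∧
      HasFDerivAt σ (ContinuousLinearMap.id 𝕜 E) x₀ ∧
      (∀ᶠ y in 𝓝 x₀, σ y + R (G (σ y) - G x₀ - G' (σ y - x₀)) = y) ∧
      (∀ᶠ y in 𝓝 x₀, G (σ y) = G x₀ + G' (y - x₀)) ∧
      ((∀ᶠ x in 𝓝 x₀, ContDiffAt 𝕜 n G x) → ∀ᶠ y in 𝓝 x₀, ContDiffAt 𝕜 n σ y) := by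
  let Ψ : E → E := fun x => x + R (G x - G x₀ - G' (x - x₀))
  have hΨs : ∀ x, ContDiffAt 𝕜 n G x → ContDiffAt 𝕜 n Ψ x := by
    intro x hG
    refine contDiffAt_id.add (R.contDiff.contDiffAt.comp x ?_)
    exact (hG.sub contDiffAt_const).sub
      (G'.contDiff.contDiffAt.comp x (contDiffAt_id.sub contDiffAt_const))
  have hΨ := hΨs x₀ hG
  have hΨ' : HasFDerivAt Ψ ((ContinuousLinearEquiv.refl 𝕜 E : E ≃L[𝕜] E) : E →L[𝕜] E) x₀ := by
    have h1 : HasFDerivAt (fun x => G' (x - x₀)) (G'.comp (ContinuousLinearMap.id 𝕜 E)) x₀ :=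
      G'.hasFDerivAt.comp x₀ ((hasFDerivAt_id x₀).sub_const x₀)
    have h2 : HasFDerivAt Ψ _ x₀ := (hasFDerivAt_id (𝕜 := 𝕜) x₀).add
      (R.hasFDerivAt.comp x₀ ((hG'.sub_const (G x₀)).sub h1))
    refine h2.congr_fderiv ?_
    ext v
    simp
  have hx : Ψ x₀ = x₀ := by simp [Ψ]
  have hs := hΨ.hasStrictFDerivAt' hΨ' hn
  have hr : ∀ᶠ y in 𝓝 x₀, Ψ (hΨ.localInverse hΨ' hn y) = y := by
    have h1 := hs.eventually_right_inverse
    rwa [hx] at h1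
  have hσ : ContDiffAt 𝕜 n (hΨ.localInverse hΨ' hn) x₀ := by
    have := hΨ.to_localInverse hΨ' hn
    rwa [hx] at this
  have hσ0 : hΨ.localInverse hΨ' hn x₀ = x₀ := by
    have := hs.localInverse_apply_image
    rw [hx] at this
    exact this
  refine ⟨hΨ.localInverse hΨ' hn, hσ0, hσ, ?_, hr, ?_, fun hG => ?_⟩
  · have := hs.to_localInverse.hasFDerivAt
    rw [hx] at this
    exact this
  · filter_upwards [hr] with y hy
    set z := hΨ.localInverse hΨ' hn y with hz
    have h2 : G' (Ψ z - x₀) = G z - G x₀ := by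
      simp only [Ψ, map_sub, map_add, hR]
      abel
    rw [← hy, h2]
    abel
  · have hc : Tendsto (hΨ.localInverse hΨ' hn) (𝓝 x₀) (𝓝 x₀) := by
      have := hσ.continuousAt.tendsto
      rwa [hσ0] at this
    have hD : ∀ᶠ x in 𝓝 x₀, fderiv 𝕜 Ψ x ∈ range ((↑) : (E ≃L[𝕜] E) → E →L[𝕜] E) := by
      have h1 : ContinuousAt (fderiv 𝕜 Ψ) x₀ :=
        ((hΨ.of_le (ENat.one_le_iff_ne_zero_withTop.2 hn)).fderiv_right (m := 0)
          (by simp)).continuousAt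
      refine h1.eventually ?_
      rw [hΨ'.fderiv]
      exact ContinuousLinearEquiv.nhds _
    let e := hΨ.toOpenPartialHomeomorph Ψ hΨ' hn
    have hT : ∀ᶠ y in 𝓝 x₀, y ∈ e.target := by
      refine e.open_target.mem_nhds ?_
      have := hΨ.image_mem_toOpenPartialHomeomorph_target hΨ' hn
      rwa [hx] at this
    filter_upwards [hc.eventually hG, hc.eventually hD, hT] with y h1 h2 h3
    obtain ⟨f, hf⟩ := h2
    have h4 := hΨs _ h1
    refine e.contDiffAt_symm (f₀' := f) h3 ?_ h4
    rw [hf]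
    exact (h4.differentiableAt hn).hasFDerivAt

/-! ### The connection determined by a positive two-form -/

section Connection

variable {E : Type*} [NormedAddCommGroup E] [NormedSpace ℂ E] [NormedSpace ℝ E]
  [IsScalarTower ℝ ℂ E]

/-- The horizontal lift of `1 ∈ ℂ`, for the submersion with real differential `D` and the
connection given by the two-form `B`. -/
def unitLift (B : E →L[ℝ] E →L[ℝ] ℝ) (D : E →L[ℝ] ℂ) : E :=
  (D (B.inverse (Complex.reCLM.comp D)))⁻¹ • B.inverse (Complex.reCLM.comp D)

lemma isInvertible_of_pos [FiniteDimensional ℝ E] {B : E →L[ℝ] E →L[ℝ] ℝ}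
    (hpos : ∀ v, v ≠ 0 → 0 < B v (Complex.I • v)) : B.IsInvertible := by
  have hinj : Function.Injective B := by
    rw [injective_iff_map_eq_zero]
    intro v hv
    by_contra h
    have := hpos v h
    rw [hv] at this
    simp at this
  have hfin : Module.finrank ℝ E = Module.finrank ℝ (E →L[ℝ] ℝ) := by
    rw [← (LinearMap.toContinuousLinearMap (𝕜 := ℝ) (E := E) (F' := ℝ)).finrank_eq]
    exact (Subspace.dual_finrank_eq (K := ℝ) (V := E)).symm
  let e : E ≃ₗ[ℝ] (E →L[ℝ] ℝ) :=
    LinearEquiv.ofInjectiveOfFinrankEq (B : E →ₗ[ℝ] E →L[ℝ] ℝ) hinj hfin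
  refine ⟨e.toContinuousLinearEquiv, ?_⟩
  ext v w
  rfl

variable [FiniteDimensional ℝ E] {B : E →L[ℝ] E →L[ℝ] ℝ} {D : E →L[ℂ] ℂ}

/-- The vector `B.inverse (Re D)` is the symplectic gradient of Re D, hence B-orthogonal to the
kernel of D. Invariance of B under i then makes all its complex multiples orthogonal to that kernel
too. -/
lemma inverse_reCLM_spec (hpos : ∀ v, v ≠ 0 → 0 < B v (Complex.I • v)) (w : E) :
    B (B.inverse (Complex.reCLM.comp (D.restrictScalars ℝ))) w = (D w).re := by
  rw [(isInvertible_of_pos hpos).self_apply_inverse]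
  rfl

lemma map_inverse_reCLM_ne_zero (hpos : ∀ v, v ≠ 0 → 0 < B v (Complex.I • v)) (hD : D ≠ 0) :
    D (B.inverse (Complex.reCLM.comp (D.restrictScalars ℝ))) ≠ 0 := by
  intro h0
  set s := B.inverse (Complex.reCLM.comp (D.restrictScalars ℝ)) with hs
  have hs0 : s = 0 := by
    by_contra h
    have := hpos s h
    rw [hs, inverse_reCLM_spec hpos, ← hs, map_smul, h0] at this
    simp at this
  have hre : ∀ w, (D w).re = 0 := fun w => by
    rw [← inverse_reCLM_spec hpos w, ← hs, hs0]; simp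
  refine hD (ContinuousLinearMap.ext fun w => Complex.ext (hre w) ?_)
  have := hre (Complex.I • w)
  simpa using this

lemma map_unitLift (hpos : ∀ v, v ≠ 0 → 0 < B v (Complex.I • v)) (hD : D ≠ 0) :
    D (unitLift B (D.restrictScalars ℝ)) = 1 := by
  rw [unitLift, map_smul, ContinuousLinearMap.coe_restrictScalars', smul_eq_mul,
    inv_mul_cancel₀ (map_inverse_reCLM_ne_zero hpos hD)]

lemma apply_smul_unitLift (hpos : ∀ v, v ≠ 0 → 0 < B v (Complex.I • v))
    (hJ : ∀ v w, B (Complex.I • v) (Complex.I • w) = B v w) (z : ℂ) {w : E} (hw : D w = 0) :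
    B (z • unitLift B (D.restrictScalars ℝ)) w = 0 := by
  have h1 := inverse_reCLM_spec (D := D) hpos w
  have h2 := inverse_reCLM_spec (D := D) hpos (Complex.I • w)
  rw [unitLift, smul_smul, complex_smul_eq]
  set s := B.inverse (Complex.reCLM.comp (D.restrictScalars ℝ))
  have h3 : B (Complex.I • s) w = -B s (Complex.I • w) := by
    rw [← hJ, I_smul_I_smul]; simp
  rw [map_smul D, hw] at h2
  rw [hw] at h1
  simp [h3, h1, h2]

/-- The difference d of the two sides is both horizontal and vertical, and so is i d vertical. Hence
B(d, i d) = 0, against positivity unless d = 0. -/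
lemma eq_smul_unitLift (hpos : ∀ v, v ≠ 0 → 0 < B v (Complex.I • v))
    (hJ : ∀ v w, B (Complex.I • v) (Complex.I • w) = B v w) (hD : D ≠ 0) {v : E}
    (hv : ∀ w, D w = 0 → B v w = 0) : v = D v • unitLift B (D.restrictScalars ℝ) := by
  by_contra h
  have h1 := hpos _ (sub_ne_zero.2 h)
  have h2 : D (v - D v • unitLift B (D.restrictScalars ℝ)) = 0 := by
    rw [map_sub, map_smul, map_unitLift hpos hD]; simp
  have h3 : D (Complex.I • (v - D v • unitLift B (D.restrictScalars ℝ))) = 0 := by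
    rw [map_smul, h2, smul_zero]
  rw [map_sub, sub_apply, hv _ h3, apply_smul_unitLift hpos hJ _ h3] at h1
  simp at h1

lemma contDiffAt_unitLift {X : Type*} [NormedAddCommGroup X] [NormedSpace ℝ X]
    {B : X → E →L[ℝ] E →L[ℝ] ℝ} {D : X → E →L[ℝ] ℂ} {x : X} {n : WithTop ℕ∞}
    (hB : ContDiffAt ℝ n B x)
    (hD : ContDiffAt ℝ n D x) (hinv : (B x).IsInvertible)
    (h0 : D x ((B x).inverse (Complex.reCLM.comp (D x))) ≠ 0) :
    ContDiffAt ℝ n (fun y => unitLift (B y) (D y)) x := by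
  have : CompleteSpace E := FiniteDimensional.complete ℝ E
  obtain ⟨e, he⟩ := hinv
  have h1 : ContDiffAt ℝ n (fun y => (B y).inverse) x := by
    refine ContDiffAt.comp x (g := ContinuousLinearMap.inverse) ?_ hB
    rw [← he]
    exact contDiffAt_map_inverse e
  have h2 : ContDiffAt ℝ n (fun y => (B y).inverse (Complex.reCLM.comp (D y))) x :=
    h1.clm_apply (contDiffAt_const.clm_comp hD)
  exact ((hD.clm_apply h2).inv h0).smul h2

end Connection

/-! ### The basic estimate for horizontal vectors -/

section Estimate

variable {E : Type*} [NormedAddCommGroup E] [NormedSpace ℂ E] [NormedSpace ℝ E]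
  [IsScalarTower ℝ ℂ E]

lemma norm_I_smul (v : E) : ‖Complex.I • v‖ = ‖v‖ := by
  rw [norm_smul, Complex.norm_I, one_mul]

lemma exists_pos_le_apply_I_smul [FiniteDimensional ℝ E] {B : E →L[ℝ] E →L[ℝ] ℝ}
    (hpos : ∀ v, v ≠ 0 → 0 < B v (Complex.I • v)) :
    ∃ m > 0, ∀ v, m * ‖v‖ ^ 2 ≤ B v (Complex.I • v) := by
  have : ProperSpace E := FiniteDimensional.proper ℝ E
  rcases (Metric.sphere (0 : E) 1).eq_empty_or_nonempty with h | h
  · refine ⟨1, one_pos, fun v => ?_⟩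
    have hv : v = 0 := by
      by_contra hv
      have : (‖v‖⁻¹ : ℝ) • v ∈ Metric.sphere (0 : E) 1 := by
        simp [norm_smul, inv_mul_cancel₀ (norm_ne_zero_iff.2 hv)]
      rw [h] at this
      exact this
    simp [hv]
  · have hc : Continuous fun v : E => B v (Complex.I • v) :=
      B.continuous.clm_apply (mulI E).continuous
    obtain ⟨u, hu, hmin⟩ := (isCompact_sphere (0 : E) 1).exists_isMinOn h hc.continuousOn
    have hu0 : u ≠ 0 := by
      rintro rfl
      simp at hu
    refine ⟨_, hpos u hu0, fun v => ?_⟩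
    rcases eq_or_ne v 0 with rfl | hv
    · simp
    have hv' := norm_ne_zero_iff.2 hv
    have h1 : (‖v‖⁻¹ : ℝ) • v ∈ Metric.sphere (0 : E) 1 := by
      simp [norm_smul, inv_mul_cancel₀ hv']
    have h2 : B u (Complex.I • u) ≤ B ((‖v‖⁻¹ : ℝ) • v) (Complex.I • (‖v‖⁻¹ : ℝ) • v) := hmin h1
    have h3 : B ((‖v‖⁻¹ : ℝ) • v) (Complex.I • (‖v‖⁻¹ : ℝ) • v) =
        ‖v‖⁻¹ * (‖v‖⁻¹ * B v (Complex.I • v)) := by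
      rw [smul_comm Complex.I, B.map_smul, ContinuousLinearMap.map_smul (R₁ := ℝ)]
      rfl
    rw [h3] at h2
    calc _ ≤ ‖v‖⁻¹ * (‖v‖⁻¹ * B v (Complex.I • v)) * ‖v‖ ^ 2 := by gcongr
      _ = _ := by field_simp

lemma eventually_le_levi [FiniteDimensional ℝ E] {F : E → ℝ} {x₀ : E}
    (hF : ContDiffAt ℝ ∞ F x₀) (hpos : ∀ v, v ≠ 0 → 0 < levi F x₀ v (Complex.I • v)) :
    ∃ m > 0, ∀ᶠ x in 𝓝 x₀, ∀ v, m * ‖v‖ ^ 2 ≤ levi F x v (Complex.I • v) := by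
  obtain ⟨m, hm, h⟩ := exists_pos_le_apply_I_smul (B := leviL F x₀) (by simpa [leviL_apply])
  refine ⟨m / 2, half_pos hm, ?_⟩
  have hc : Tendsto (leviL F) (𝓝 x₀) (𝓝 (leviL F x₀)) := (contDiffAt_leviL hF).continuousAt
  have hn : Tendsto (fun x => ‖leviL F x - leviL F x₀‖) (𝓝 x₀) (𝓝 0) := by
    have h1 := ((contDiffAt_leviL hF).sub (contDiffAt_const (c := leviL F x₀))).continuousAt
    have h2 := (continuous_norm (E := E →L[ℝ] E →L[ℝ] ℝ)).continuousAt.comp h1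
    have h3 : ‖leviL F x₀ - leviL F x₀‖ = 0 := by
      have h4 : leviL F x₀ - leviL F x₀ = 0 :=
        ContinuousLinearMap.ext fun v => ContinuousLinearMap.ext fun w =>
          sub_self (leviL F x₀ v w)
      rw [h4]; exact norm_zero (E := E →L[ℝ] E →L[ℝ] ℝ)
    rw [ContinuousAt, Function.comp_apply, h3] at h2
    exact h2
  filter_upwards [hn.eventually_lt_const (half_pos hm)] with x hx v
  have h1 : |(leviL F x - leviL F x₀) v (Complex.I • v)| ≤ m / 2 * ‖v‖ ^ 2 := by
    refine ((leviL F x - leviL F x₀).le_opNorm₂ v (Complex.I • v)).trans ?_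
    rw [norm_I_smul, sq, ← mul_assoc]
    gcongr
  rw [sub_apply, sub_apply] at h1
  have h2 := h v
  rw [← leviL_apply]
  linarith [(abs_le.1 h1).1]

/-- Here a and b stand for g'(φ) and g''(φ), L for dφ, and u₁, w₁ for a lift of 1 on which L and L ∘
i vanish and a vertical vector normalised by L. Horizontality is tested twice. Against i(v - (D v)
u₁) the b-term is a nonnegative sum of squares and can be dropped; what remains bounds ‖v‖ by a
multiple of ‖D v‖ regardless of a and b. Against a multiple of w₁ the b-term becomes b/2 times L(v)²
+ L(iv)², which must balance an a-term of size at most a c R ‖v‖ times the square root of that sum.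
-/
lemma horizontal_bound {B : E →L[ℝ] E →L[ℝ] ℝ} {D : E →L[ℂ] ℂ} {L : E →L[ℝ] ℝ} {a b c m R : ℝ}
    (ha : 0 < a) (hb : 0 < b) (hm : 0 < m) (hc : ‖B‖ ≤ c)
    (hB : ∀ v, m * ‖v‖ ^ 2 ≤ B v (Complex.I • v))
    {u₁ w₁ : E} (hu₁ : ‖u₁‖ ≤ R) (hw₁ : ‖w₁‖ ≤ R) (hDu : D u₁ = 1) (hDw : D w₁ = 0)
    (hLu : L u₁ = 0) (hLu' : L (Complex.I • u₁) = 0) (hLw : L w₁ = 1)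
    (hLw' : L (Complex.I • w₁) = 0) {v : E}
    (hv : ∀ w, D w = 0 → a * B v w +
      b * ((L (Complex.I • v) * L w - L v * L (Complex.I • w)) / 2) = 0) :
    b * |L v| ≤ 2 * (c * R) ^ 2 / m * a * ‖D v‖ := by
  have hR : 0 ≤ R := (norm_nonneg _).trans hu₁
  have hc0 : 0 ≤ c := (norm_nonneg B).trans hc
  have hBle : ∀ w, |B v w| ≤ c * ‖v‖ * ‖w‖ := fun w =>
    (B.le_opNorm₂ v w).trans (by gcongr)
  have hLz : ∀ z : ℂ, ∀ w, L (z • w) = z.re * L w + z.im * L (Complex.I • w) := by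
    intro z w
    rw [complex_smul_eq]; simp
  -- the horizontal vector is controlled by its projection
  have hnorm : m * ‖v‖ ≤ c * R * ‖D v‖ := by
    set v₀ := D v • u₁ with hv₀
    have h0 : L v₀ = 0 := by rw [hv₀, hLz, hLu, hLu']; simp
    have h0' : L (Complex.I • v₀) = 0 := by rw [hv₀, smul_smul, hLz, hLu, hLu']; simp
    have hk : D (Complex.I • (v - v₀)) = 0 := by
      rw [map_smul, map_sub, hv₀, map_smul, hDu]; simp
    have h1 := hv _ hk
    rw [smul_sub, map_sub, map_sub, smul_sub, map_sub, h0', I_smul_I_smul, I_smul_I_smul, map_neg,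
      map_neg, h0] at h1
    have h2 : a * B v (Complex.I • v) ≤ a * B v (Complex.I • v₀) := by
      nlinarith [mul_nonneg hb.le (sq_nonneg (L v)),
        mul_nonneg hb.le (sq_nonneg (L (Complex.I • v)))]
    have h3 := le_of_mul_le_mul_left h2 ha
    have h4 := hBle (Complex.I • v₀)
    rw [norm_I_smul, hv₀, norm_smul] at h4
    have h5 : m * ‖v‖ ^ 2 ≤ c * ‖v‖ * (‖D v‖ * R) := by
      calc _ ≤ _ := hB v
        _ ≤ _ := h3
        _ ≤ _ := (le_abs_self _).trans h4
        _ ≤ _ := by gcongr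
    rcases (norm_nonneg v).eq_or_lt with h | h
    · rw [← h, mul_zero]; positivity
    · refine le_of_mul_le_mul_right ?_ h
      calc _ = m * ‖v‖ ^ 2 := by ring
        _ ≤ _ := h5
        _ = _ := by ring
  -- The coefficient is chosen so that i l w₁ has the value L(iv) under L and -L(v) under L ∘ i,
  -- which turns the b-term into a full square.
  set l : ℂ := ⟨L v, -L (Complex.I • v)⟩ with hl
  have hlv : ‖l‖ * ‖l‖ = L (Complex.I • v) ^ 2 + L v ^ 2 := by
    rw [Complex.norm_mul_self_eq_normSq, Complex.normSq_mk]; ring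
  have hk : D (Complex.I • l • w₁) = 0 := by simp [hDw]
  have h1 := hv _ hk
  have e1 : L (Complex.I • l • w₁) = L (Complex.I • v) := by
    rw [smul_smul, hLz, hLw, hLw']; simp [hl]
  have e2 : L (Complex.I • Complex.I • l • w₁) = - L v := by
    rw [I_smul_I_smul, map_neg, hLz, hLw, hLw']; simp [hl]
  rw [e1, e2] at h1
  have h2 := hBle (Complex.I • l • w₁)
  rw [norm_I_smul, norm_smul] at h2
  have h3 : b * (‖l‖ * ‖l‖) ≤ 2 * a * (c * ‖v‖ * R) * ‖l‖ := by
    have : -B v (Complex.I • l • w₁) ≤ c * ‖v‖ * (‖l‖ * R) :=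
      (neg_le_abs _).trans (h2.trans (by gcongr))
    have := mul_le_mul_of_nonneg_left this ha.le
    rw [hlv]
    nlinarith
  have h4 : b * ‖l‖ ≤ 2 * a * (c * ‖v‖ * R) := by
    rcases (norm_nonneg l).eq_or_lt with h | h
    · rw [← h, mul_zero]; positivity
    · refine le_of_mul_le_mul_right ?_ h
      linarith
  have h5 : |L v| ≤ ‖l‖ := Complex.abs_re_le_norm l
  calc b * |L v| ≤ b * ‖l‖ := by gcongr
    _ ≤ 2 * a * (c * R) * (m * ‖v‖) / m := by
        rw [le_div_iff₀ hm]
        calc _ ≤ (2 * a * (c * ‖v‖ * R)) * m := by gcongr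
          _ = _ := by ring
    _ ≤ 2 * a * (c * R) * (c * R * ‖D v‖) / m := by gcongr
    _ = _ := by ring

/-- The vectors required by `horizontal_bound` are built to depend continuously on x, so their
norms, the norm of the form and its lower bound are controlled on one neighbourhood. The order of
quantifiers matters: C and the neighbourhood precede a and b, which later blow up at the boundary.
-/
lemma exists_horizontal_bound [FiniteDimensional ℝ E] {P : E → ℂ} {F : E → ℝ} {x₀ : E}
    (hP : ContDiffAt ℂ 2 P x₀) (hF : ContDiffAt ℝ ∞ F x₀)
    (hpos : ∀ v, v ≠ 0 → 0 < levi F x₀ v (Complex.I • v)) (hD : fderiv ℂ P x₀ ≠ 0) {w₀ : E}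
    (hw₀ : fderiv ℂ P x₀ w₀ = 0) (hL : fderiv ℝ F x₀ w₀ ≠ 0) :
    ∃ C, 0 ≤ C ∧ ∀ᶠ x in 𝓝 x₀, ∀ a b : ℝ, 0 < a → 0 < b → ∀ v,
      (∀ w, fderiv ℂ P x w = 0 → a * levi F x v w + b * ((fderiv ℝ F x (Complex.I • v) *
        fderiv ℝ F x w - fderiv ℝ F x v * fderiv ℝ F x (Complex.I • w)) / 2) = 0) →
      b * |fderiv ℝ F x v| ≤ C * a * ‖fderiv ℂ P x v‖ := by
  obtain ⟨u₀, hu₀⟩ : ∃ u₀, fderiv ℂ P x₀ u₀ ≠ 0 := by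
    by_contra! h
    exact hD (ContinuousLinearMap.ext h)
  obtain ⟨m, hm, hm'⟩ := eventually_le_levi hF hpos
  have cD : ContinuousAt (fderiv ℂ P) x₀ := (hP.fderiv_right (m := 1) le_rfl).continuousAt
  have cL : ContinuousAt (fderiv ℝ F) x₀ := (hF.fderiv_right (m := 1) (by norm_cast)).continuousAt
  have cB : ContinuousAt (leviL F) x₀ := (contDiffAt_leviL hF).continuousAt
  -- the complex linear part of the differential of `F`, twice
  let α : E → E → ℂ := fun x v => (fderiv ℝ F x v : ℂ) - fderiv ℝ F x (Complex.I • v) * Complex.I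
  let u : E → E := fun x => (fderiv ℂ P x u₀)⁻¹ • u₀
  let w : E → E := fun x => w₀ - fderiv ℂ P x w₀ • u x
  have cα : ∀ {y : E → E}, ContinuousAt y x₀ → ContinuousAt (fun x => α x (y x)) x₀ := by
    intro y hy
    have h1 : ContinuousAt (fun x => fderiv ℝ F x (y x)) x₀ := cL.clm_apply hy
    have h2 : ContinuousAt (fun x => fderiv ℝ F x (Complex.I • y x)) x₀ :=
      cL.clm_apply (hy.const_smul Complex.I)
    exact (Complex.continuous_ofReal.continuousAt.comp h1).sub
      ((Complex.continuous_ofReal.continuousAt.comp h2).mul continuousAt_const)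
  have cDu : ContinuousAt (fun x => fderiv ℂ P x u₀) x₀ := cD.clm_apply continuousAt_const
  have cu : ContinuousAt u x₀ := (cDu.inv₀ hu₀).smul continuousAt_const
  have cw : ContinuousAt w x₀ :=
    continuousAt_const.sub ((cD.clm_apply continuousAt_const).smul cu)
  have hw : w x₀ = w₀ := by simp [w, hw₀]
  have hαw : α x₀ (w x₀) ≠ 0 := by
    rw [hw]
    intro h
    have := congrArg Complex.re h
    simp [α] at this
    exact hL this
  -- Normalises the vertical vector to α = 1, so that subtracting a complex multiple of it from u
  -- puts the lift in the kernel of α, that is, of both dF and dF ∘ i.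
  let w₁ : E → E := fun x => (α x (w x))⁻¹ • w x
  let u₁ : E → E := fun x => u x - α x (u x) • w₁ x
  have cw₁ : ContinuousAt w₁ x₀ := ((cα cw).inv₀ hαw).smul cw
  have cu₁ : ContinuousAt u₁ x₀ := cu.sub ((cα cu).smul cw₁)
  set c := ‖leviL F x₀‖ + 1
  set R := max ‖u₁ x₀‖ ‖w₁ x₀‖ + 1
  refine ⟨2 * (c * R) ^ 2 / m, by positivity, ?_⟩
  have E1 : ∀ᶠ x in 𝓝 x₀, ‖leviL F x‖ < c :=
    ((continuous_norm (E := E →L[ℝ] E →L[ℝ] ℝ)).continuousAt.comp cB).eventually_lt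
      continuousAt_const (lt_add_one _)
  have E2 : ∀ᶠ x in 𝓝 x₀, ‖u₁ x‖ < R :=
    cu₁.norm.eventually_lt continuousAt_const (lt_of_le_of_lt (le_max_left _ _) (lt_add_one _))
  have E3 : ∀ᶠ x in 𝓝 x₀, ‖w₁ x‖ < R :=
    cw₁.norm.eventually_lt continuousAt_const (lt_of_le_of_lt (le_max_right _ _) (lt_add_one _))
  filter_upwards [hm', E1, E2, E3, cDu.eventually_ne hu₀, (cα cw).eventually_ne hαw]
    with x h1 h2 h3 h4 h5 h6 a b ha hb v hv
  have αsmul : ∀ z y, α x (z • y) = z * α x y := by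
    intro z y
    have e1 : Complex.I • z • y = z.re • Complex.I • y - z.im • y := by
      rw [smul_comm, complex_smul_eq z (Complex.I • y), I_smul_I_smul, smul_neg, sub_eq_add_neg]
    simp only [α, e1]
    rw [complex_smul_eq z y]
    apply Complex.ext <;> simp
    ring
  have αsub : ∀ y y', α x (y - y') = α x y - α x y' := by
    intro y y'
    simp only [α, smul_sub, map_sub, Complex.ofReal_sub]
    ring
  have αre : ∀ y, fderiv ℝ F x y = (α x y).re := fun y => by simp [α]
  have αim : ∀ y, fderiv ℝ F x (Complex.I • y) = -(α x y).im := fun y => by simp [α]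
  have hw1 : α x (w₁ x) = 1 := by rw [αsmul, inv_mul_cancel₀ h6]
  have hu1 : α x (u₁ x) = 0 := by simp only [u₁, αsub, αsmul (α x (u x)), hw1, mul_one, sub_self]
  have hDu : fderiv ℂ P x (u x) = 1 := by
    rw [map_smul, smul_eq_mul, inv_mul_cancel₀ h5]
  have hDw : fderiv ℂ P x (w x) = 0 := by
    simp only [w, map_sub, map_smul, hDu, smul_eq_mul, mul_one, sub_self]
  have hDw₁ : fderiv ℂ P x (w₁ x) = 0 := by rw [map_smul, hDw, smul_zero]
  refine horizontal_bound (B := leviL F x) (u₁ := u₁ x) (w₁ := w₁ x) ha hb hm h2.le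
    (fun v => by rw [leviL_apply]; exact h1 v) h3.le h4.le ?_ hDw₁ ?_ ?_ ?_ ?_ ?_
  · simp only [u₁, map_sub, hDu, (fderiv ℂ P x).map_smul (α x (u x)), hDw₁, smul_zero, sub_zero]
  · rw [αre, hu1]; simp
  · rw [αim, hu1]; simp
  · rw [αre, hw1]; simp
  · rw [αim, hw1]; simp
  · intro y hy
    rw [leviL_apply]
    exact hv y hy

end Estimate

/-! ### Smoothness of composition operators on spaces of continuous functions -/

section CompositionOperator

universe u

variable {X : Type*} [TopologicalSpace X] [CompactSpace X]

/-- A continuous bilinear map, applied pointwise to continuous functions. -/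
def pointwiseBilin {E₁ E₂ E₃ : Type*} [NormedAddCommGroup E₁] [NormedSpace ℝ E₁]
    [NormedAddCommGroup E₂] [NormedSpace ℝ E₂] [NormedAddCommGroup E₃] [NormedSpace ℝ E₃]
    (β : E₁ →L[ℝ] E₂ →L[ℝ] E₃) : C(X, E₁) →L[ℝ] C(X, E₂) →L[ℝ] C(X, E₃) :=
  LinearMap.mkContinuous₂
    (LinearMap.mk₂ ℝ (fun a b => ⟨fun t => β (a t) (b t),
        (β.continuous.comp a.continuous).clm_apply b.continuous⟩)
      (fun a a' b => by ext t; simp) (fun c a b => by ext t; simp)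
      (fun a b b' => by ext t; simp) (fun c a b => by ext t; simp)) ‖β‖ fun a b => by
    rw [ContinuousMap.norm_le _ (by positivity)]
    intro t
    refine (β.le_opNorm₂ (a t) (b t)).trans ?_
    gcongr
    · exact a.norm_coe_le_norm t
    · exact b.norm_coe_le_norm t

variable {E F : Type u} [NormedAddCommGroup E] [NormedSpace ℝ E] [NormedAddCommGroup F]
  [NormedSpace ℝ F]

lemma hasFDerivAt_comp_continuousMap {h : C(E, F)} {h' : C(E, E →L[ℝ] F)}
    (hh : ∀ x, HasFDerivAt h (h' x) x) (u : C(X, E)) :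
    HasFDerivAt (fun u : C(X, E) => h.comp u)
      (pointwiseBilin (ContinuousLinearMap.id ℝ (E →L[ℝ] F)) (h'.comp u)) u := by
  rw [hasFDerivAt_iff_isLittleO_nhds_zero, Asymptotics.isLittleO_iff]
  intro ε hε
  -- The range of u is compact, so one δ works at all of its points; the mean value inequality then
  -- bounds the remainder uniformly in t.
  have huc := (isCompact_range u.continuous).uniformContinuousAt_of_continuousAt h'
    (fun x _ => h'.continuous.continuousAt) (Metric.dist_mem_uniformity hε)
  obtain ⟨δ, hδ, H⟩ := Metric.mem_uniformity_dist.1 huc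
  filter_upwards [Metric.ball_mem_nhds (0 : C(X, E)) hδ] with v hv
  rw [mem_ball_zero_iff] at hv
  rw [ContinuousMap.norm_le _ (by positivity)]
  intro t
  have hvt : ‖v t‖ < δ := (v.norm_coe_le_norm t).trans_lt hv
  have key := (convex_ball (u t) δ).norm_image_sub_le_of_norm_hasFDerivWithin_le' (f := h)
    (f' := h') (φ := h' (u t)) (C := ε) (x := u t) (y := u t + v t)
    (fun y _ => (hh y).hasFDerivWithinAt) (fun y hy => ?_) (Metric.mem_ball_self hδ)
    (by simpa using hvt)
  · simp only [add_sub_cancel_left] at key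
    refine le_trans (le_of_eq ?_) (key.trans ?_)
    · rfl
    · gcongr
      exact v.norm_coe_le_norm t
  · have := H (a := u t) (b := y) (by rw [dist_comm]; exact hy) (mem_range_self t)
    rw [← dist_eq_norm, dist_comm]
    exact le_of_lt this

/-- The derivative of composition with h is pointwise application of composition with h', so the
order drops by one when F is replaced by E →L[ℝ] F. This is why F is quantified inside the induction
and shares a universe with E. -/
lemma contDiff_comp_continuousMap (n : ℕ) : ∀ {F : Type u} [NormedAddCommGroup F]
    [NormedSpace ℝ F] (h : C(E, F)), ContDiff ℝ n h →
      ContDiff ℝ n (fun u : C(X, E) => h.comp u) := by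
  induction n with
  | zero =>
    intro F _ _ h _
    exact contDiff_zero.2 (ContinuousMap.continuous_postcomp h)
  | succ n ih =>
    intro F _ _ h hh
    have h1 : ContDiff ℝ n (fderiv ℝ h) := hh.fderiv_right (by norm_cast)
    let h' : C(E, E →L[ℝ] F) := ⟨fderiv ℝ h, h1.continuous⟩
    have h2 := ih h' h1
    have h3 : ContDiff ℝ (n + 1 : ℕ) (fun u : C(X, E) => h.comp u) := by
      push_cast
      rw [contDiff_succ_iff_hasFDerivAt]
      refine ⟨fun u => pointwiseBilin (ContinuousLinearMap.id ℝ (E →L[ℝ] F)) (h'.comp u),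
        (pointwiseBilin (X := X) (ContinuousLinearMap.id ℝ (E →L[ℝ] F))).contDiff.comp h2,
        fun u => hasFDerivAt_comp_continuousMap (fun x => ?_) u⟩
      exact (hh.differentiable (by simp) x).hasFDerivAt
    exact h3

end CompositionOperator

/-! ### The primitive of a continuous function on the unit interval -/

section Primitive

variable {E : Type*} [NormedAddCommGroup E] [NormedSpace ℝ E] [CompleteSpace E]

/-- The continuous extension to the real line of a continuous function on the unit interval. -/
abbrev iccExt (w : C(unitInterval, E)) : ℝ → E := IccExtend (zero_le_one' ℝ) w

lemma continuous_iccExt (w : C(unitInterval, E)) : Continuous (iccExt w) :=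
  w.continuous.Icc_extend'

lemma norm_iccExt_le (w : C(unitInterval, E)) (t : ℝ) : ‖iccExt w t‖ ≤ ‖w‖ :=
  w.norm_coe_le_norm _

lemma hasDerivAt_primitive_iccExt (w : C(unitInterval, E)) (t : ℝ) :
    HasDerivAt (fun t => ∫ s in (0 : ℝ)..t, iccExt w s) (iccExt w t) t :=
  intervalIntegral.integral_hasDerivAt_right ((continuous_iccExt w).intervalIntegrable _ _)
    ((continuous_iccExt w).stronglyMeasurableAtFilter _ _) (continuous_iccExt w).continuousAt

variable (E) in
/-- The primitive vanishing at `0`, as a continuous linear map. -/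
def primitiveL : C(unitInterval, E) →L[ℝ] C(unitInterval, E) :=
  LinearMap.mkContinuous
    { toFun := fun w => ⟨fun t => ∫ s in (0 : ℝ)..t, iccExt w s,
        (continuous_iff_continuousAt.2 fun t =>
          (hasDerivAt_primitive_iccExt w t).continuousAt).comp continuous_subtype_val⟩
      map_add' := fun w w' => by
        ext t
        exact intervalIntegral.integral_add ((continuous_iccExt w).intervalIntegrable _ _)
          ((continuous_iccExt w').intervalIntegrable _ _)
      map_smul' := fun c w => by
        ext t
        exact intervalIntegral.integral_smul c _ } 1 fun w => by
    rw [ContinuousMap.norm_le _ (by positivity)]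
    intro t
    refine (intervalIntegral.norm_integral_le_of_norm_le_const (C := ‖w‖)
      fun s _ => norm_iccExt_le w s).trans ?_
    rw [one_mul, sub_zero, abs_of_nonneg t.2.1]
    exact mul_le_of_le_one_right (norm_nonneg _) t.2.2

end Primitive

/-! ### Flow boxes with smooth dependence on the initial value -/

section Flow

variable {E : Type} [NormedAddCommGroup E] [NormedSpace ℂ E] [NormedSpace ℝ E]
  [IsScalarTower ℝ ℂ E] [CompleteSpace E]

/-- The integral equation is the vanishing of a smooth map G of (b, x, u) on a Banach space. At b =
0 its partial derivative in u is the identity, so the implicit function theorem applies. A small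
coefficient b plays the role of short time, and u depends smoothly on x because G is smooth. -/
lemma exists_smooth_integral_solution {h : E → E} (hh : ContDiff ℝ ∞ h) (x₀ : E) {W : Set E}
    (hW : W ∈ 𝓝 x₀) :
    ∃ U : C(unitInterval, ℂ) → E → C(unitInterval, E),
      ∀ᶠ p : C(unitInterval, ℂ) × E in 𝓝 (0, x₀),
        ContDiffAt ℝ ∞ (U p.1) p.2 ∧ (∀ t, U p.1 p.2 t ∈ W) ∧
        ∀ t : unitInterval, U p.1 p.2 t = p.2 + ∫ s in (0 : ℝ)..t,
          iccExt p.1 s • h (iccExt (U p.1 p.2) s) := by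
  let hc : C(E, E) := ⟨h, hh.continuous⟩
  let sm : C(unitInterval, ℂ) →L[ℝ] C(unitInterval, E) →L[ℝ] C(unitInterval, E) :=
    pointwiseBilin (ContinuousLinearMap.lsmul ℝ ℂ)
  let cst : E →L[ℝ] C(unitInterval, E) := ContinuousLinearMap.const ℝ unitInterval
  let Z := (C(unitInterval, ℂ) × E) × C(unitInterval, E)
  let N : C(unitInterval, E) → C(unitInterval, E) := fun u => hc.comp u
  have hN : ContDiff ℝ ∞ N := contDiff_infty.2 fun n =>
    contDiff_comp_continuousMap n hc (hh.of_le (by exact_mod_cast le_top))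
  let G : Z → C(unitInterval, E) := fun z =>
    z.2 - cst z.1.2 - primitiveL E (sm z.1.1 (N z.2))
  let z₀ : Z := ((0, x₀), cst x₀)
  have hsm : ContDiff ℝ ∞ fun z : Z => sm z.1.1 (N z.2) :=
    (sm.contDiff.comp (contDiff_fst.fst)).clm_apply (hN.comp contDiff_snd)
  have hG : ContDiff ℝ ∞ G :=
    (contDiff_snd.sub (cst.contDiff.comp contDiff_fst.snd)).sub
      ((primitiveL E).contDiff.comp hsm)
  let p₁ : Z →L[ℝ] C(unitInterval, ℂ) :=
    (ContinuousLinearMap.fst ℝ _ _).comp (ContinuousLinearMap.fst ℝ _ _)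
  let p₂ : Z →L[ℝ] E := (ContinuousLinearMap.snd ℝ _ _).comp (ContinuousLinearMap.fst ℝ _ _)
  let p₃ : Z →L[ℝ] C(unitInterval, E) := ContinuousLinearMap.snd ℝ _ _
  -- Variations of u inside h do not contribute, being multiplied by the coefficient b = 0.
  let G' : Z →L[ℝ] C(unitInterval, E) :=
    p₃ - cst.comp p₂ - (primitiveL E).comp ((sm.flip (cst (h x₀))).comp p₁)
  have hN0 : N (cst x₀) = cst (h x₀) := rfl
  have hG' : HasFDerivAt G G' z₀ := by
    have h1 : HasFDerivAt (fun z : Z => N z.2) _ z₀ :=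
      ((hN.differentiable (by simp)) z₀.2).hasFDerivAt.comp z₀ p₃.hasFDerivAt
    have h2 : HasFDerivAt (fun z : Z => sm z.1.1 (N z.2)) _ z₀ :=
      (sm.hasFDerivAt.comp z₀ p₁.hasFDerivAt).clm_apply h1
    have h3 : HasFDerivAt G _ z₀ :=
      (p₃.hasFDerivAt.sub (cst.hasFDerivAt.comp z₀ p₂.hasFDerivAt)).sub
        ((primitiveL E).hasFDerivAt.comp z₀ h2)
    refine h3.congr_fderiv (ContinuousLinearMap.ext fun z => ?_)
    have e : sm z₀.1.1 = 0 := map_zero sm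
    simp [G', e, z₀, hN0, p₁]
  let R : C(unitInterval, E) →L[ℝ] Z := ContinuousLinearMap.inr ℝ _ _
  have hR : ∀ y, G' (R y) = y := fun y => by
    change y - cst 0 - primitiveL E (sm 0 (cst (h x₀))) = y
    simp
  have hG0 : G z₀ = 0 := by simp [G, z₀]
  obtain ⟨σ, hσ0, hσ, -, hσ1, hσ2, hσ3⟩ := exists_straightening (n := ∞) (by simp)
    hG.contDiffAt hG' R hR
  -- The point over (b, x) of the affine tangent space z₀ + ker G'. Straightening along R changes
  -- only the third coordinate, so its image is a zero of G over the same (b, x).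
  let q : C(unitInterval, ℂ) → E → Z := fun b x =>
    ((b, x), cst x + primitiveL E (sm b (cst (h x₀))))
  have hq : Continuous fun p : C(unitInterval, ℂ) × E => q p.1 p.2 := by
    refine continuous_id.prodMk ((cst.continuous.comp continuous_snd).add
      ((primitiveL E).continuous.comp ((sm.continuous.comp continuous_fst).clm_apply
        continuous_const)))
  have hqs : ∀ b, ContDiff ℝ ∞ (q b) := fun b =>
    (contDiff_const.prodMk contDiff_id).prodMk (cst.contDiff.add contDiff_const)
  have hq0 : q 0 x₀ = z₀ := by simp [q, z₀]
  have hqt : Tendsto (fun p : C(unitInterval, ℂ) × E => q p.1 p.2) (𝓝 (0, x₀)) (𝓝 z₀) := by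
    have := hq.tendsto (0, x₀)
    rwa [hq0] at this
  have hqG : ∀ b x, G' (q b x - z₀) = 0 := by
    intro b x
    change (cst x + primitiveL E (sm b (cst (h x₀))) - cst x₀) - cst (x - x₀) -
      primitiveL E (sm (b - 0) (cst (h x₀))) = 0
    rw [map_sub, sub_zero]
    abel
  obtain ⟨r, hr, hrW⟩ := Metric.mem_nhds_iff.1 hW
  have hclose : ∀ᶠ z in 𝓝 z₀, dist (σ z).2 (cst x₀) < r := by
    have h1 : Tendsto (fun z => (σ z).2) (𝓝 z₀) (𝓝 (cst x₀)) := by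
      have h2 := (continuous_snd.tendsto (σ z₀)).comp hσ.continuousAt.tendsto
      rw [hσ0] at h2
      exact h2
    exact Metric.tendsto_nhds.1 h1 r hr
  refine ⟨fun b x => (σ (q b x)).2, ?_⟩
  filter_upwards [hqt.eventually hσ1, hqt.eventually hσ2, hqt.eventually hclose,
    hqt.eventually (hσ3 (Eventually.of_forall fun _ => hG.contDiffAt))] with p h1 h2 h3 h4
  rw [hqG, hG0, add_zero] at h2
  have h5 : (σ (q p.1 p.2)).1 = (p.1, p.2) := by
    have h6 : (σ (q p.1 p.2)).1 + 0 = (p.1, p.2) := congrArg Prod.fst h1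
    rwa [add_zero] at h6
  refine ⟨?_, fun t => hrW ?_, fun t => ?_⟩
  · exact contDiffAt_snd.comp p.2 (ContDiffAt.comp p.2 h4 (hqs p.1).contDiffAt)
  · exact lt_of_le_of_lt (ContinuousMap.dist_apply_le_dist t) h3
  · have h6 : (σ (q p.1 p.2)).2 t - p.2 - primitiveL E (sm p.1 (N (σ (q p.1 p.2)).2)) t = 0 := by
      have := congrArg (fun f : C(unitInterval, E) => f t) h2
      simpa [G, h5, cst] using this
    rw [sub_sub, sub_eq_zero] at h6
    exact h6

/-- Rescaling [t₀, t₁] to the unit interval multiplies the coefficient a by t₁ - t₀. A short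
interval thus gives a small coefficient, and ε and N depend on a only through the bound A. -/
lemma exists_flow_box {h : E → E} (hh : ContDiff ℝ ∞ h) (x₀ : E) {W : Set E}
    (hW : W ∈ 𝓝 x₀) (A : ℝ) :
    ∃ ε > 0, ∃ N ∈ 𝓝 x₀, ∀ (a : ℝ → ℂ) (t₀ t₁ : ℝ), t₀ < t₁ → t₁ - t₀ ≤ ε →
      ContinuousOn a (Icc t₀ t₁) → (∀ t ∈ Icc t₀ t₁, ‖a t‖ ≤ A) →
      ∃ v : E → ℝ → E, ∀ x ∈ N, ContDiffAt ℝ ∞ (fun x => v x t₁) x ∧ v x t₀ = x ∧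
        ∀ t ∈ Icc t₀ t₁, v x t ∈ W ∧
          HasDerivWithinAt (v x) (a t • h (v x t)) (Icc t₀ t₁) t := by
  obtain ⟨U, hU⟩ := exists_smooth_integral_solution hh x₀ hW
  rw [nhds_prod_eq, eventually_prod_iff] at hU
  obtain ⟨pa, hpa, pb, hpb, hU⟩ := hU
  obtain ⟨δ, hδ, hball⟩ := Metric.eventually_nhds_iff.1 hpa
  -- This length makes the rescaled coefficient have norm below δ; the 1 covers A = 0.
  refine ⟨δ / (2 * (|A| + 1)), by positivity, {x | pb x}, hpb, ?_⟩
  intro a t₀ t₁ ht htε hac haA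
  have hΔ : 0 < t₁ - t₀ := sub_pos.2 ht
  let τ : ℝ → ℝ := fun t => (t - t₀) / (t₁ - t₀)
  have hmem : ∀ s : unitInterval, t₀ + s * (t₁ - t₀) ∈ Icc t₀ t₁ := fun s =>
    ⟨by nlinarith [s.2.1], by nlinarith [s.2.2]⟩
  let b : C(unitInterval, ℂ) := ⟨fun s => (t₁ - t₀) • a (t₀ + s * (t₁ - t₀)), by
    have h1 : Continuous fun s : unitInterval => a (t₀ + s * (t₁ - t₀)) :=
      hac.comp_continuous (by fun_prop) hmem
    exact h1.const_smul (t₁ - t₀)⟩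
  have hb : pa b := by
    refine hball ?_
    rw [dist_zero_right]
    have h1 : ‖b‖ ≤ (t₁ - t₀) * |A| := by
      rw [ContinuousMap.norm_le _ (by positivity)]
      intro s
      change ‖(t₁ - t₀) • a (t₀ + s * (t₁ - t₀))‖ ≤ _
      rw [norm_smul, Real.norm_of_nonneg hΔ.le]
      gcongr
      exact (haA _ (hmem s)).trans (le_abs_self A)
    rw [le_div_iff₀ (by positivity)] at htε
    nlinarith [abs_nonneg A]
  let v : E → ℝ → E := fun x t => iccExt (U b x) (τ t)
  have hτ : ∀ t ∈ Icc t₀ t₁, τ t ∈ Icc (0 : ℝ) 1 := fun t ht' =>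
    ⟨div_nonneg (sub_nonneg.2 ht'.1) hΔ.le, (div_le_one hΔ).2 (by linarith [ht'.2])⟩
  refine ⟨v, fun x hx => ?_⟩
  obtain ⟨h1, h2, h3⟩ := hU hb hx
  have hv : ∀ t (ht : t ∈ Icc t₀ t₁), v x t = U b x ⟨τ t, hτ t ht⟩ := fun t ht =>
    IccExtend_of_mem _ _ (hτ t ht)
  refine ⟨?_, ?_, fun t ht' => ⟨?_, ?_⟩⟩
  · have := (ContinuousMap.evalCLM (M := E) ℝ (projIcc (0 : ℝ) 1 zero_le_one (τ t₁))).contDiff.contDiffAt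
      (x := U b x) (n := ∞)
    exact this.comp x h1
  · rw [hv t₀ (left_mem_Icc.2 ht.le), h3]
    simp [τ]
  · rw [hv t ht']; exact h2 _
  · let w : C(unitInterval, E) := ⟨fun s => b s • h (U b x s),
      b.continuous.smul (hh.continuous.comp (U b x).continuous)⟩
    have hτ' : HasDerivAt τ (t₁ - t₀)⁻¹ t := by
      simpa [τ, div_eq_mul_inv] using ((hasDerivAt_id t).sub_const t₀).mul_const (t₁ - t₀)⁻¹
    have h4 := ((hasDerivAt_primitive_iccExt w (τ t)).scomp t hτ').const_add x
    have h5 : (t₁ - t₀)⁻¹ • iccExt w (τ t) = a t • h (v x t) := by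
      have e1 : iccExt w (τ t) = b ⟨τ t, hτ t ht'⟩ • h (U b x ⟨τ t, hτ t ht'⟩) :=
        IccExtend_of_mem _ _ (hτ t ht')
      have e2 : b ⟨τ t, hτ t ht'⟩ = (t₁ - t₀) • a t := by
        change (t₁ - t₀) • a (t₀ + (t - t₀) / (t₁ - t₀) * (t₁ - t₀)) = _
        rw [div_mul_cancel₀ _ hΔ.ne', add_sub_cancel]
      rw [e1, e2, hv t ht', smul_assoc, inv_smul_smul₀ hΔ.ne']
    rw [h5] at h4
    refine h4.hasDerivWithinAt.congr (fun s hs => ?_) ?_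
    · rw [hv s hs, h3]; rfl
    · rw [hv t ht', h3]; rfl

end Flow

/-! ### The intrinsic objects in charts -/

section Charts

variable {n : ℕ} {M : Type*} [TopologicalSpace M] [ChartedSpace (Cn n) M]
  [IsManifold 𝓘(ℂ, Cn n) ω M]

instance isManifold_real : IsManifold 𝓘(ℝ, Cn n) ∞ M := by
  refine isManifold_of_contDiffOn _ _ _ fun e e' he he' => ?_
  have h := (contDiffGroupoid ω 𝓘(ℂ, Cn n)).compatible he he'
  rw [contDiffGroupoid, mem_groupoid_of_pregroupoid] at h
  have h1 : ContDiffOn ℂ ω (e.symm ≫ₕ e') (e.symm ≫ₕ e').source := by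
    simpa [contDiffPregroupoid] using h.1
  simpa using (h1.restrict_scalars ℝ).of_le (m := ∞) le_top

lemma contDiffAt_comp_chart_symm {f : M → ℂ} {q p : M} (hp : p ∈ (chartAt (Cn n) q).source)
    (hf : ContMDiffAt 𝓘(ℂ, Cn n) 𝓘(ℂ, ℂ) ω f p) :
    ContDiffAt ℂ ω (f ∘ (chartAt (Cn n) q).symm) (chartAt (Cn n) q p) := by
  have h1 : ContMDiffAt 𝓘(ℂ, Cn n) 𝓘(ℂ, ℂ) ω f
      ((chartAt (Cn n) q).symm (chartAt (Cn n) q p)) := by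
    rwa [(chartAt (Cn n) q).left_inv hp]
  exact (h1.comp _ (contMDiffAt_symm_of_mem_maximalAtlas (IsManifold.chart_mem_maximalAtlas q)
    ((chartAt (Cn n) q).map_source hp))).contDiffAt

lemma contDiffAt_real_comp_chart_symm {F : Type*} [NormedAddCommGroup F] [NormedSpace ℝ F]
    {f : M → F} {q p : M} (hp : p ∈ (chartAt (Cn n) q).source)
    (hf : ContMDiffAt 𝓘(ℝ, Cn n) 𝓘(ℝ, F) ∞ f p) :
    ContDiffAt ℝ ∞ (f ∘ (chartAt (Cn n) q).symm) (chartAt (Cn n) q p) := by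
  have h1 : ContMDiffAt 𝓘(ℝ, Cn n) 𝓘(ℝ, F) ∞ f
      ((chartAt (Cn n) q).symm (chartAt (Cn n) q p)) := by
    rwa [(chartAt (Cn n) q).left_inv hp]
  exact (h1.comp _ (contMDiffAt_symm_of_mem_maximalAtlas (IsManifold.chart_mem_maximalAtlas q)
    ((chartAt (Cn n) q).map_source hp))).contDiffAt

/-- The coordinate change from the preferred chart at `p` to the preferred chart at `q`. -/
def coordChange (q p : M) : Cn n → Cn n := chartAt (Cn n) q ∘ (chartAt (Cn n) p).symm

/-- The derivative at `p` of the coordinate change to the preferred chart at `q`. -/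
def coordDeriv (q p : M) : Cn n →L[ℂ] Cn n :=
  fderiv ℂ (coordChange (n := n) q p) (chartAt (Cn n) p p)

lemma coordChange_self {q p : M} :
    coordChange (n := n) q p (chartAt (Cn n) p p) = chartAt (Cn n) q p := by
  rw [coordChange, Function.comp_apply, (chartAt (Cn n) p).left_inv (mem_chart_source _ p)]

lemma contDiffAt_coordChange {q p r : M} (hp : r ∈ (chartAt (Cn n) p).source)
    (hq : r ∈ (chartAt (Cn n) q).source) :
    ContDiffAt ℂ ω (coordChange (n := n) q p) (chartAt (Cn n) p r) := by
  have h1 : ContMDiffAt 𝓘(ℂ, Cn n) 𝓘(ℂ, Cn n) ω (chartAt (Cn n) q)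
      ((chartAt (Cn n) p).symm (chartAt (Cn n) p r)) := by
    rw [(chartAt (Cn n) p).left_inv hp]
    exact contMDiffAt_of_mem_maximalAtlas (IsManifold.chart_mem_maximalAtlas q) hq
  exact (h1.comp _ (contMDiffAt_symm_of_mem_maximalAtlas (IsManifold.chart_mem_maximalAtlas p)
    ((chartAt (Cn n) p).map_source hp))).contDiffAt

lemma hasFDerivAt_coordChange {q p : M} (hp : p ∈ (chartAt (Cn n) q).source) :
    HasFDerivAt (coordChange (n := n) q p) (coordDeriv (n := n) q p) (chartAt (Cn n) p p) :=
  ((contDiffAt_coordChange (mem_chart_source _ p) hp).differentiableAt (by simp)).hasFDerivAt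

lemma comp_chart_symm_eventuallyEq {α : Type*} (f : M → α) {q p : M}
    (hp : p ∈ (chartAt (Cn n) q).source) :
    f ∘ (chartAt (Cn n) p).symm =ᶠ[𝓝 (chartAt (Cn n) p p)]
      (f ∘ (chartAt (Cn n) q).symm) ∘ coordChange (n := n) q p := by
  have hc : ContinuousAt (chartAt (Cn n) p).symm (chartAt (Cn n) p p) :=
    (chartAt (Cn n) p).continuousAt_symm (mem_chart_target _ p)
  have h1 : (chartAt (Cn n) q).source ∈ 𝓝 ((chartAt (Cn n) p).symm (chartAt (Cn n) p p)) := by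
    rw [(chartAt (Cn n) p).left_inv (mem_chart_source _ p)]
    exact (chartAt (Cn n) q).open_source.mem_nhds hp
  filter_upwards [hc h1] with x hx
  simp only [coordChange, Function.comp_apply]
  rw [(chartAt (Cn n) q).left_inv hx]

lemma bijective_coordDeriv {q p : M} (hp : p ∈ (chartAt (Cn n) q).source) :
    Function.Bijective (coordDeriv (n := n) q p) := by
  have hp' := mem_chart_source (Cn n) p
  have hinj : Function.Injective (coordDeriv (n := n) q p) := by
    have h1 := ((contDiffAt_coordChange (q := p) (p := q) hp hp').differentiableAt
      (by simp)).hasFDerivAt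
    rw [← coordChange_self] at h1
    have h2 := h1.comp _ (hasFDerivAt_coordChange hp)
    have h3 : coordChange (n := n) p q ∘ coordChange (n := n) q p
        =ᶠ[𝓝 (chartAt (Cn n) p p)] id := by
      filter_upwards [comp_chart_symm_eventuallyEq (chartAt (Cn n) p) hp,
        (chartAt (Cn n) p).open_target.mem_nhds (mem_chart_target _ p)] with x hx hx'
      have h4 : coordChange (n := n) p q (coordChange (n := n) q p x) =
        chartAt (Cn n) p ((chartAt (Cn n) p).symm x) := hx.symm
      rw [Function.comp_apply, h4, (chartAt (Cn n) p).right_inv hx', id]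
    have h4 := (h2.congr_of_eventuallyEq h3.symm).unique (hasFDerivAt_id _)
    exact Function.LeftInverse.injective fun v => congrArg (fun L => L v) h4
  exact ⟨hinj, LinearMap.surjective_of_injective (f := (coordDeriv (n := n) q p : Cn n →ₗ[ℂ] Cn n))
    hinj⟩

/-- The intrinsic definition uses a different chart at every point. Continuity and ODE arguments
need one fixed chart around q, which invariance under holomorphic coordinate change allows. -/
lemma omegaForm_eq_levi_chart {ψ : M → ℝ} {q p : M} (hp : p ∈ (chartAt (Cn n) q).source)
    (hψ : ContDiffAt ℝ 2 (ψ ∘ (chartAt (Cn n) q).symm) (chartAt (Cn n) q p)) (v w : Cn n) :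
    omegaForm ψ p v w = levi (ψ ∘ (chartAt (Cn n) q).symm) (chartAt (Cn n) q p)
      (coordDeriv q p v) (coordDeriv q p w) := by
  have h1 : omegaForm ψ p v w =
    levi (ψ ∘ (chartAt (Cn n) p).symm) (chartAt (Cn n) p p) v w := rfl
  rw [h1, levi_congr (comp_chart_symm_eventuallyEq ψ hp), levi_comp, coordChange_self]
  · rfl
  · exact (contDiffAt_coordChange (mem_chart_source _ p) hp).of_le le_top
  · rwa [coordChange_self]

lemma dPi_eq_fderiv_chart {π : M → ℂ} {q p : M} (hp : p ∈ (chartAt (Cn n) q).source)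
    (hπ : ContMDiffAt 𝓘(ℂ, Cn n) 𝓘(ℂ, ℂ) ω π p) (v : Cn n) :
    dPi π p v = fderiv ℂ (π ∘ (chartAt (Cn n) q).symm) (chartAt (Cn n) q p)
      (coordDeriv q p v) := by
  have h1 : dPi (n := n) π p =
      fderiv ℂ (π ∘ (chartAt (Cn n) p).symm) (chartAt (Cn n) p p) := by
    have h : MDifferentiableAt 𝓘(ℂ, Cn n) 𝓘(ℂ, ℂ) π p := hπ.mdifferentiableAt (by simp)
    have h3 : fderivWithin ℂ (π ∘ (chartAt (Cn n) p).symm) (range id) (chartAt (Cn n) p p) =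
        fderiv ℂ (π ∘ (chartAt (Cn n) p).symm) (chartAt (Cn n) p p) := by
      rw [range_id, fderivWithin_univ]
    exact h.mfderiv.trans h3
  have h2 := ((contDiffAt_comp_chart_symm hp hπ).differentiableAt (by simp)).hasFDerivAt
  rw [← coordChange_self] at h2
  rw [h1, (comp_chart_symm_eventuallyEq π hp).fderiv_eq,
    (h2.comp _ (hasFDerivAt_coordChange hp)).fderiv, coordChange_self]
  rfl

lemma dReal_eq_fderiv_chart {ψ : M → ℝ} {q p : M} (hp : p ∈ (chartAt (Cn n) q).source)
    (hψ : ContMDiffAt 𝓘(ℝ, Cn n) 𝓘(ℝ, ℝ) ∞ ψ p) (v : Cn n) :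
    dReal ψ p v = fderiv ℝ (ψ ∘ (chartAt (Cn n) q).symm) (chartAt (Cn n) q p)
      (coordDeriv q p v) := by
  have h1 : dReal (n := n) ψ p =
      fderiv ℝ (ψ ∘ (chartAt (Cn n) p).symm) (chartAt (Cn n) p p) := by
    have h : MDifferentiableAt 𝓘(ℝ, Cn n) 𝓘(ℝ, ℝ) ψ p := hψ.mdifferentiableAt (by simp)
    have h3 : fderivWithin ℝ (ψ ∘ (chartAt (Cn n) p).symm) (range id) (chartAt (Cn n) p p) =
        fderiv ℝ (ψ ∘ (chartAt (Cn n) p).symm) (chartAt (Cn n) p p) := by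
      rw [range_id, fderivWithin_univ]
    exact h.mfderiv.trans h3
  have h2 := ((contDiffAt_real_comp_chart_symm hp hψ).differentiableAt (by simp)).hasFDerivAt
  rw [← coordChange_self] at h2
  rw [h1, (comp_chart_symm_eventuallyEq ψ hp).fderiv_eq,
    (h2.comp _ ((hasFDerivAt_coordChange hp).restrictScalars ℝ)).fderiv, coordChange_self]
  rfl

/-- Reads the velocity in one fixed chart instead of the preferred chart at each c t, so that a
whole arc of a lift solves a single ODE. -/
lemma hasMFDerivWithinAt_toSpanSingleton_iff {c : ℝ → M} {S : Set ℝ} {t : ℝ} {v : Cn n} {q : M}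
    (hq : c t ∈ (chartAt (Cn n) q).source) :
    HasMFDerivWithinAt 𝓘(ℝ, ℝ) 𝓘(ℝ, Cn n) c S t
        (ContinuousLinearMap.toSpanSingleton ℝ v : ℝ →L[ℝ] Cn n) ↔
      ContinuousWithinAt c S t ∧
        HasDerivWithinAt (chartAt (Cn n) q ∘ c) (coordDeriv q (c t) v) S t := by
  have h0 : HasMFDerivWithinAt 𝓘(ℝ, ℝ) 𝓘(ℝ, Cn n) c S t
        (ContinuousLinearMap.toSpanSingleton ℝ v : ℝ →L[ℝ] Cn n) ↔
      ContinuousWithinAt c S t ∧ HasDerivWithinAt (chartAt (Cn n) (c t) ∘ c) v S t := by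
    have : (extChartAt 𝓘(ℝ, ℝ) t).symm ⁻¹' S ∩ range 𝓘(ℝ, ℝ) = S := by
      simp [chartAt_self_eq]
    refine and_congr_right fun _ => ?_
    rw [this]
    rfl
  rw [h0]
  refine and_congr_right fun hc => ?_
  have key : ∀ {r s : M} {w : Cn n}, c t ∈ (chartAt (Cn n) r).source →
      c t ∈ (chartAt (Cn n) s).source → HasDerivWithinAt (chartAt (Cn n) r ∘ c) w S t →
      HasDerivWithinAt (chartAt (Cn n) s ∘ c)
        (fderiv ℂ (coordChange (n := n) s r) (chartAt (Cn n) r (c t)) w) S t := by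
    intro r s w hr hs h
    have h1 := (((contDiffAt_coordChange (q := s) (p := r) hr hs).differentiableAt
      (by simp)).hasFDerivAt.restrictScalars ℝ)
    have h2 := h1.comp_hasDerivWithinAt t h
    have e : ∀ x ∈ (chartAt (Cn n) r).source,
        coordChange (n := n) s r (chartAt (Cn n) r x) = chartAt (Cn n) s x := fun x hx => by
      rw [coordChange, Function.comp_apply, (chartAt (Cn n) r).left_inv hx]
    refine h2.congr_of_eventuallyEq ?_ (e _ hr).symm
    filter_upwards [hc ((chartAt (Cn n) r).open_source.mem_nhds hr)] with x hx
    exact (e _ hx).symm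
  refine ⟨fun h => key (mem_chart_source _ _) hq h, fun h => ?_⟩
  obtain h1 := key hq (mem_chart_source _ _) h
  have hinv : fderiv ℂ (coordChange (n := n) (c t) q) (chartAt (Cn n) q (c t))
      (coordDeriv q (c t) v) = v := by
    have h2 := ((contDiffAt_coordChange (q := c t) (p := q) hq (mem_chart_source _ _)).differentiableAt
      (by simp)).hasFDerivAt
    rw [← coordChange_self] at h2
    have h3 := h2.comp _ (hasFDerivAt_coordChange hq)
    have h4 : coordChange (n := n) (c t) q ∘ coordChange (n := n) q (c t)
        =ᶠ[𝓝 (chartAt (Cn n) (c t) (c t))] id := by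
      filter_upwards [comp_chart_symm_eventuallyEq (chartAt (Cn n) (c t)) hq,
        (chartAt (Cn n) (c t)).open_target.mem_nhds (mem_chart_target _ _)] with x hx hx'
      have h4 : coordChange (n := n) (c t) q (coordChange (n := n) q (c t) x) =
        chartAt (Cn n) (c t) ((chartAt (Cn n) (c t)).symm x) := hx.symm
      rw [Function.comp_apply, h4, (chartAt (Cn n) (c t)).right_inv hx', id]
    have h5 := (h3.congr_of_eventuallyEq h4.symm).unique (hasFDerivAt_id _)
    rw [coordChange_self] at h5
    exact congrArg (fun L => L v) h5
  rwa [hinv] at h1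

end Charts

/-! ### The connection in a chart -/

section LocalConnection

variable {E : Type*} [NormedAddCommGroup E] [NormedSpace ℂ E] [NormedSpace ℝ E]
  [IsScalarTower ℝ ℂ E]

/-- `P` is a holomorphic submersion and `F` is a smooth negative `J`-convex function at `x`. -/
structure RegularAt (P : E → ℂ) (F : E → ℝ) (x : E) : Prop where
  holomorphic : ContDiffAt ℂ ω P x
  smooth : ContDiffAt ℝ ∞ F x
  levi_pos : ∀ v, v ≠ 0 → 0 < levi F x v (Complex.I • v)
  submersion : fderiv ℂ P x ≠ 0
  neg : F x < 0

/-- The horizontal lift of `1 ∈ ℂ` at `x`, for the connection on `P` induced by `ω_{g(F)}`. -/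
def connField (P : E → ℂ) (F : E → ℝ) (g : ℝ → ℝ) (x : E) : E :=
  unitLift (leviL (g ∘ F) x) (fderiv ℝ P x)

variable {P : E → ℂ} {F : E → ℝ} {g : ℝ → ℝ} {x : E}

lemma IsConvexExhaustion.levi_comp_eq (hg : IsConvexExhaustion g) (hF : ContDiffAt ℝ ∞ F x)
    (hx : F x < 0) (v w : E) :
    levi (g ∘ F) x v w = deriv g (F x) * levi F x v w + deriv (deriv g) (F x) *
      ((fderiv ℝ F x (Complex.I • v) * fderiv ℝ F x w -
        fderiv ℝ F x v * fderiv ℝ F x (Complex.I • w)) / 2) :=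
  levi_real_comp (hF.of_le (by norm_cast)) ((hg.contDiffAt hx).of_le (by norm_cast)) v w

lemma RegularAt.levi_comp_pos (h : RegularAt P F x) (hg : IsConvexExhaustion g) (v : E)
    (hv : v ≠ 0) : 0 < leviL (g ∘ F) x v (Complex.I • v) := by
  rw [leviL_apply, hg.levi_comp_eq h.smooth h.neg, I_smul_I_smul, map_neg]
  have h1 := mul_pos (hg.deriv_pos _ h.neg) (h.levi_pos v hv)
  have h2 := hg.deriv_deriv_pos _ h.neg
  have h3 : 0 ≤ deriv (deriv g) (F x) *
      ((fderiv ℝ F x (Complex.I • v) * fderiv ℝ F x (Complex.I • v) -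
        fderiv ℝ F x v * -fderiv ℝ F x v) / 2) := by
    refine mul_nonneg h2.le ?_
    nlinarith [mul_self_nonneg (fderiv ℝ F x (Complex.I • v)), mul_self_nonneg (fderiv ℝ F x v)]
  linarith

lemma RegularAt.fderiv_real (h : RegularAt P F x) :
    fderiv ℝ P x = (fderiv ℂ P x).restrictScalars ℝ :=
  (h.holomorphic.differentiableAt (by simp)).fderiv_restrictScalars ℝ

variable [FiniteDimensional ℝ E]

lemma RegularAt.fderiv_connField (h : RegularAt P F x) (hg : IsConvexExhaustion g) :
    fderiv ℂ P x (connField P F g x) = 1 := by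
  rw [connField, h.fderiv_real]
  exact map_unitLift (h.levi_comp_pos hg) h.submersion

/-- Turns the horizontality condition into the explicit ODE velocity ζ times `connField`. -/
lemma RegularAt.horizontal_iff (h : RegularAt P F x) (hg : IsConvexExhaustion g) (v : E) (ζ : ℂ) :
    ((∀ w, fderiv ℂ P x w = 0 → levi (g ∘ F) x v w = 0) ∧ fderiv ℂ P x v = ζ) ↔
      v = ζ • connField P F g x := by
  have hJ : ∀ v w, leviL (g ∘ F) x (Complex.I • v) (Complex.I • w) = leviL (g ∘ F) x v w := by
    intro v w
    rw [leviL_apply, leviL_apply, levi_I_smul_I_smul]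
  constructor
  · rintro ⟨h1, rfl⟩
    rw [connField, h.fderiv_real]
    exact eq_smul_unitLift (h.levi_comp_pos hg) hJ h.submersion
      fun w hw => by rw [leviL_apply]; exact h1 w hw
  · rintro rfl
    refine ⟨fun w hw => ?_, ?_⟩
    · rw [← leviL_apply, connField, h.fderiv_real]
      exact apply_smul_unitLift (h.levi_comp_pos hg) hJ ζ hw
    · rw [map_smul, h.fderiv_connField hg, smul_eq_mul, mul_one]

lemma RegularAt.contDiffAt_connField (h : RegularAt P F x) (hg : IsConvexExhaustion g) :
    ContDiffAt ℝ ∞ (connField P F g) x := by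
  have h1 : ContDiffAt ℝ ∞ (g ∘ F) x := (hg.contDiffAt h.neg).comp x h.smooth
  refine contDiffAt_unitLift (contDiffAt_leviL h1)
    (((h.holomorphic.restrict_scalars ℝ).of_le (m := ∞) le_top).fderiv_right le_rfl)
    (isInvertible_of_pos (h.levi_comp_pos hg)) ?_
  rw [h.fderiv_real]
  exact map_inverse_reCLM_ne_zero (h.levi_comp_pos hg) h.submersion

end LocalConnection

/-! ### Hypersurfaces transverse to the fibres -/

section Transverse

variable {E : Type*} [NormedAddCommGroup E] [NormedSpace ℂ E] [NormedSpace ℝ E]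
  [IsScalarTower ℝ ℂ E]

lemma exists_rightInverse_prod {D : E →L[ℂ] ℂ} {L : E →L[ℝ] ℝ} (hD : D ≠ 0) {v : E}
    (hv : D v = 0) (hL : L v ≠ 0) :
    ∃ R : ℂ × ℝ →L[ℝ] E, ∀ y, ((D.restrictScalars ℝ).prod L) (R y) = y := by
  obtain ⟨u, hu⟩ : ∃ u, D u ≠ 0 := by
    by_contra! h
    exact hD (ContinuousLinearMap.ext h)
  let A : ℂ →L[ℝ] E := (ContinuousLinearMap.toSpanSingleton ℂ ((D u)⁻¹ • u)).restrictScalars ℝ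
  let B : ℝ →L[ℝ] E := ContinuousLinearMap.toSpanSingleton ℝ ((L v)⁻¹ • v)
  have hA : ∀ z, D (A z) = z := fun z => by simp [A, hu]
  have hB : ∀ r, D (B r) = 0 := fun r => by
    have h1 := (D.restrictScalars ℝ).map_smul (r * (L v)⁻¹) v
    have h2 : B r = (r * (L v)⁻¹) • v := by simp [B, smul_smul]
    rwa [ContinuousLinearMap.coe_restrictScalars', hv, smul_zero, ← h2] at h1
  have hB' : ∀ r, L (B r) = r := fun r => by simp [B, hL]
  refine ⟨A.comp (ContinuousLinearMap.fst ℝ ℂ ℝ) + B.comp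
    (ContinuousLinearMap.snd ℝ ℂ ℝ - L.comp (A.comp (ContinuousLinearMap.fst ℝ ℂ ℝ))),
    fun y => Prod.ext ?_ ?_⟩
  · change D (A y.1 + B (y.2 - L (A y.1))) = y.1
    rw [map_add, hA, hB, add_zero]
  · change L (A y.1 + B (y.2 - L (A y.1))) = y.2
    rw [map_add, hB']
    ring

variable [CompleteSpace E] {P : E → ℂ} {r : E → ℝ} {x₀ v : E}

lemma exists_straightening_pair (hP : ContDiffAt ℂ 1 P x₀) (hr : ContDiffAt ℝ 1 r x₀)
    (hD : fderiv ℂ P x₀ ≠ 0) (hv : fderiv ℂ P x₀ v = 0) (hL : fderiv ℝ r x₀ v ≠ 0) :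
    ∃ σ : E → E, σ x₀ = x₀ ∧ HasFDerivAt σ (ContinuousLinearMap.id ℝ E) x₀ ∧
      ∀ᶠ y in 𝓝 x₀, P (σ y) = P x₀ + fderiv ℂ P x₀ (y - x₀) ∧
        r (σ y) = r x₀ + fderiv ℝ r x₀ (y - x₀) := by
  obtain ⟨R, hR⟩ := exists_rightInverse_prod hD hv hL
  obtain ⟨σ, h0, -, h1, -, h2, -⟩ := exists_straightening (n := 1) (by simp)
    ((hP.restrict_scalars ℝ).prodMk hr)
    (((hP.differentiableAt (by simp)).hasFDerivAt.restrictScalars ℝ).prodMk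
      (hr.differentiableAt (by simp)).hasFDerivAt) R hR
  refine ⟨σ, h0, h1, h2.mono fun y hy => ?_⟩
  exact ⟨congrArg Prod.fst hy, congrArg Prod.snd hy⟩

/-- In straightened coordinates a half-line in the kernel of dP stays in the fibre and crosses to
the side r > r x₀. -/
lemma frequently_gt_of_transverse (hP : ContDiffAt ℂ 1 P x₀) (hr : ContDiffAt ℝ 1 r x₀)
    (hD : fderiv ℂ P x₀ ≠ 0) (hv : fderiv ℂ P x₀ v = 0) (hL : fderiv ℝ r x₀ v ≠ 0) :
    ∃ᶠ y in 𝓝 x₀, P y = P x₀ ∧ r x₀ < r y := by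
  obtain ⟨σ, h0, h1, h2⟩ := exists_straightening_pair hP hr hD hv hL
  -- Scaling v by its own value fixes the sign: dr(w) is a square.
  set w := (fderiv ℝ r x₀ v) • v with hw
  have hDw : fderiv ℂ P x₀ w = 0 := by
    have := ((fderiv ℂ P x₀).restrictScalars ℝ).map_smul (fderiv ℝ r x₀ v) v
    rwa [ContinuousLinearMap.coe_restrictScalars', hv, smul_zero] at this
  have hLw : 0 < fderiv ℝ r x₀ w := by
    rw [hw, map_smul, smul_eq_mul]; exact mul_self_pos.2 hL
  have hl : Tendsto (fun s : ℝ => x₀ + s • w) (𝓝[>] 0) (𝓝 x₀) := by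
    have : Continuous fun s : ℝ => x₀ + s • w := by fun_prop
    have h := this.tendsto 0
    rw [zero_smul, add_zero] at h
    exact h.mono_left nhdsWithin_le_nhds
  have hσ : Tendsto σ (𝓝 x₀) (𝓝 x₀) := by
    have := h1.continuousAt.tendsto
    rwa [h0] at this
  refine (hσ.comp hl).frequently (Eventually.frequently ?_)
  filter_upwards [hl.eventually h2, self_mem_nhdsWithin] with s hs hs0
  rw [add_sub_cancel_left] at hs
  refine ⟨?_, ?_⟩
  · have h3 := ((fderiv ℂ P x₀).restrictScalars ℝ).map_smul s w
    rw [ContinuousLinearMap.coe_restrictScalars', hDw, smul_zero] at h3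
    rw [Function.comp_apply, hs.1, h3, add_zero]
  · rw [Function.comp_apply, hs.2, map_smul, smul_eq_mul]
    have : 0 < s * fderiv ℝ r x₀ w := mul_pos hs0 hLw
    linarith

lemma eventually_exists_transverse (hP : ContDiffAt ℂ 2 P x₀) (hr : ContDiffAt ℝ 2 r x₀)
    (hD : fderiv ℂ P x₀ ≠ 0) (hv : fderiv ℂ P x₀ v = 0) (hL : fderiv ℝ r x₀ v ≠ 0) :
    ∀ᶠ x in 𝓝 x₀, ∃ w, fderiv ℂ P x w = 0 ∧ fderiv ℝ r x w ≠ 0 := by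
  obtain ⟨u, hu⟩ : ∃ u, fderiv ℂ P x₀ u ≠ 0 := by
    by_contra! h
    exact hD (ContinuousLinearMap.ext h)
  have cD : ContinuousAt (fderiv ℂ P) x₀ := (hP.fderiv_right (m := 1) le_rfl).continuousAt
  have cL : ContinuousAt (fderiv ℝ r) x₀ := (hr.fderiv_right (m := 1) le_rfl).continuousAt
  have cu : ContinuousAt (fun x => fderiv ℂ P x u) x₀ := cD.clm_apply continuousAt_const
  have cv : ContinuousAt (fun x => fderiv ℂ P x v) x₀ := cD.clm_apply continuousAt_const
  let w : E → E := fun x => v - (fderiv ℂ P x v / fderiv ℂ P x u) • u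
  have cw : ContinuousAt w x₀ :=
    continuousAt_const.sub ((cv.div cu hu).smul continuousAt_const)
  have cLw : ContinuousAt (fun x => fderiv ℝ r x (w x)) x₀ := cL.clm_apply cw
  have h0 : fderiv ℝ r x₀ (w x₀) ≠ 0 := by simpa [w, hv] using hL
  filter_upwards [cu.eventually_ne hu, cLw.eventually_ne h0] with x h1 h2
  refine ⟨w x, ?_, h2⟩
  simp only [w, map_sub, map_smul, smul_eq_mul]
  rw [div_mul_cancel₀ _ h1, sub_self]

/-- The zero set of F contains the part of {r = r x₀} over the disk, and the directions tangent to
it map onto ℂ under dP. If dF also vanished on the kernel of dP, it would vanish altogether. -/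
lemma exists_ker_fderiv_ne_zero {F : E → ℝ} (hP : ContDiffAt ℂ 1 P x₀) (hr : ContDiffAt ℝ 1 r x₀)
    (hF : DifferentiableAt ℝ F x₀) (hD : fderiv ℂ P x₀ ≠ 0) (hv : fderiv ℂ P x₀ v = 0)
    (hL : fderiv ℝ r x₀ v ≠ 0) (hx : ‖P x₀‖ ≤ 1)
    (hzero : ∀ᶠ y in 𝓝 x₀, ‖P y‖ ≤ 1 → r y = r x₀ → F y = 0) (hF0 : fderiv ℝ F x₀ ≠ 0) :
    ∃ w, fderiv ℂ P x₀ w = 0 ∧ fderiv ℝ F x₀ w ≠ 0 := by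
  obtain ⟨R, hR⟩ := exists_rightInverse_prod hD hv hL
  obtain ⟨σ, h0, h1, h2⟩ := exists_straightening_pair hP hr hD hv hL
  by_contra! hker
  have hσ : Tendsto σ (𝓝 x₀) (𝓝 x₀) := by
    have := h1.continuousAt.tendsto
    rwa [h0] at this
  have hFx : F x₀ = 0 := hzero.self_of_nhds hx rfl
  -- P x₀ may lie on the unit circle, so only the segment from P x₀ to a point ζ of the disk is
  -- available, and only a one-sided derivative at 0 is taken.
  have key : ∀ ζ : ℂ, ‖ζ‖ ≤ 1 → fderiv ℝ F x₀ (R (ζ - P x₀, 0)) = 0 := by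
    intro ζ hζ
    set d := R (ζ - P x₀, 0) with hd
    have hd1 : fderiv ℂ P x₀ d = ζ - P x₀ := congrArg Prod.fst (hR (ζ - P x₀, 0))
    have hd2 : fderiv ℝ r x₀ d = 0 := congrArg Prod.snd (hR (ζ - P x₀, 0))
    have hl : HasDerivAt (fun s : ℝ => x₀ + s • d) d 0 := by
      simpa using ((hasDerivAt_id (0 : ℝ)).smul_const d).const_add x₀
    have hlt : Tendsto (fun s : ℝ => x₀ + s • d) (𝓝[≥] 0) (𝓝 x₀) := by
      have h := hl.continuousAt.tendsto
      rw [zero_smul, add_zero] at h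
      exact h.mono_left nhdsWithin_le_nhds
    have hc : HasDerivAt (fun s : ℝ => F (σ (x₀ + s • d))) (fderiv ℝ F x₀ d) 0 := by
      have e1 : HasFDerivAt σ (ContinuousLinearMap.id ℝ E) (x₀ + (0 : ℝ) • d) := by
        rwa [zero_smul, add_zero]
      have e2 : HasFDerivAt F (fderiv ℝ F x₀) (σ (x₀ + (0 : ℝ) • d)) := by
        rw [zero_smul, add_zero, h0]; exact hF.hasFDerivAt
      have e3 : HasDerivAt (fun s : ℝ => σ (x₀ + s • d)) d 0 := by
        have := e1.comp_hasDerivAt (0 : ℝ) hl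
        exact this
      exact e2.comp_hasDerivAt (0 : ℝ) e3
    have hz : (fun s : ℝ => F (σ (x₀ + s • d))) =ᶠ[𝓝[≥] 0] fun _ => 0 := by
      have hs1 : ∀ᶠ s : ℝ in 𝓝[≥] 0, s ≤ 1 :=
        mem_nhdsWithin_of_mem_nhds (Iic_mem_nhds one_pos)
      filter_upwards [hlt.eventually h2, hlt.eventually (hσ.eventually hzero), hs1,
        self_mem_nhdsWithin] with s e1 e2 e3 e4
      rw [add_sub_cancel_left] at e1
      refine e2 ?_ ?_
      · have h3 := ((fderiv ℂ P x₀).restrictScalars ℝ).map_smul s d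
        rw [ContinuousLinearMap.coe_restrictScalars', hd1] at h3
        have h4 : P (σ (x₀ + s • d)) = (1 - s) • P x₀ + s • ζ := by
          rw [e1.1, h3, smul_sub, sub_smul, one_smul]; ring
        rw [h4]
        have h5 : (0 : ℝ) ≤ s := e4
        calc _ ≤ ‖(1 - s) • P x₀‖ + ‖s • ζ‖ := norm_add_le _ _
          _ ≤ (1 - s) * 1 + s * 1 := by
            rw [norm_smul, norm_smul, Real.norm_of_nonneg h5, Real.norm_of_nonneg (by linarith)]
            have : 0 ≤ 1 - s := by linarith
            gcongr
          _ = 1 := by ring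
      · rw [e1.2, map_smul, hd2, smul_zero, add_zero]
    have h3 := hc.hasDerivWithinAt (s := Ici 0)
    have h4 : HasDerivWithinAt (fun s : ℝ => F (σ (x₀ + s • d))) 0 (Ici 0) 0 :=
      (hasDerivWithinAt_const (0 : ℝ) (Ici 0) (0 : ℝ)).congr_of_eventuallyEq hz
        (by simp [h0, hFx])
    exact (uniqueDiffWithinAt_Ici (0 : ℝ)).eq_deriv _ h3 h4
  have key2 : ∀ ζ : ℂ, ‖ζ‖ ≤ 1 → fderiv ℝ F x₀ (R (ζ, 0)) = 0 := by
    intro ζ hζ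
    -- Differences of the inward directions, here those towards ζ and towards 0, give all small
    -- directions.
    have e : ((ζ, 0) : ℂ × ℝ) = (ζ - P x₀, 0) - (0 - P x₀, 0) := by simp
    rw [e, map_sub, map_sub, key ζ hζ, key 0 (by simp), sub_zero]
  have key3 : ∀ ζ : ℂ, fderiv ℝ F x₀ (R (ζ, 0)) = 0 := by
    intro ζ
    have h3 := key2 ((‖ζ‖ + 1)⁻¹ • ζ) (by
      rw [norm_smul, norm_inv, Real.norm_of_nonneg (by positivity : 0 ≤ ‖ζ‖ + 1),
        inv_mul_le_iff₀ (by positivity)]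
      linarith)
    have e : (((‖ζ‖ + 1)⁻¹ • ζ, 0) : ℂ × ℝ) = (‖ζ‖ + 1)⁻¹ • (ζ, 0) := by simp
    rw [e, map_smul, map_smul, smul_eq_mul] at h3
    exact (mul_eq_zero.1 h3).resolve_left (by positivity)
  refine hF0 (ContinuousLinearMap.ext fun y => ?_)
  have h3 : fderiv ℂ P x₀ (y - R (fderiv ℂ P x₀ y, 0)) = 0 := by
    have : fderiv ℂ P x₀ (R (fderiv ℂ P x₀ y, 0)) = fderiv ℂ P x₀ y :=
      congrArg Prod.fst (hR (fderiv ℂ P x₀ y, 0))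
    rw [map_sub, this, sub_self]
  have h4 := hker _ h3
  rw [map_sub, key3, sub_zero] at h4
  exact h4

end Transverse

/-! ### Regular points and horizontal velocities on the manifold -/

section Regular

variable {n : ℕ} {M : Type*} [TopologicalSpace M] [ChartedSpace (Cn n) M]
  [IsManifold 𝓘(ℂ, Cn n) ω M] {π : M → ℂ} {φ : M → ℝ} {g : ℝ → ℝ}

/-- Near `p`, `π` is a holomorphic submersion and `φ` is smooth, and at `p`, `φ` is negative and
`J`-convex. -/
structure RegularPoint (π : M → ℂ) (φ : M → ℝ) (p : M) : Prop where
  holomorphic : ∀ᶠ q in 𝓝 p, ContMDiffAt 𝓘(ℂ, Cn n) 𝓘(ℂ, ℂ) ω π q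
  smooth : ∀ᶠ q in 𝓝 p, ContMDiffAt 𝓘(ℝ, Cn n) 𝓘(ℝ, ℝ) ∞ φ q
  jConvex : JConvexAt (n := n) φ p
  submersion : dPi (n := n) π p ≠ 0
  neg : φ p < 0

lemma JConvexAt.levi_pos {q p : M} (h : JConvexAt (n := n) φ p)
    (hs : ContMDiffAt 𝓘(ℝ, Cn n) 𝓘(ℝ, ℝ) ∞ φ p) (hp : p ∈ (chartAt (Cn n) q).source) (v : Cn n)
    (hv : v ≠ 0) :
    0 < levi (φ ∘ (chartAt (Cn n) q).symm) (chartAt (Cn n) q p) v (Complex.I • v) := by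
  obtain ⟨u, rfl⟩ := (bijective_coordDeriv hp).2 v
  have h1 := h u (by rintro rfl; exact hv (map_zero _))
  rwa [omegaForm_eq_levi_chart hp ((contDiffAt_real_comp_chart_symm hp hs).of_le (by norm_cast)),
    map_smul] at h1

lemma fderiv_chart_ne_zero {q p : M} (hs : ContMDiffAt 𝓘(ℂ, Cn n) 𝓘(ℂ, ℂ) ω π p)
    (hp : p ∈ (chartAt (Cn n) q).source) (h : dPi (n := n) π p ≠ 0) :
    fderiv ℂ (π ∘ (chartAt (Cn n) q).symm) (chartAt (Cn n) q p) ≠ 0 := by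
  intro h0
  refine h (ContinuousLinearMap.ext fun v => ?_)
  have := dPi_eq_fderiv_chart hp hs v
  rw [h0] at this
  exact this

lemma dPi_ne_zero_of_chart {q p : M} (hs : ContMDiffAt 𝓘(ℂ, Cn n) 𝓘(ℂ, ℂ) ω π p)
    (hp : p ∈ (chartAt (Cn n) q).source)
    (h : fderiv ℂ (π ∘ (chartAt (Cn n) q).symm) (chartAt (Cn n) q p) ≠ 0) :
    dPi (n := n) π p ≠ 0 := by
  intro h0
  refine h (ContinuousLinearMap.ext fun v => ?_)
  obtain ⟨u, rfl⟩ := (bijective_coordDeriv hp).2 v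
  have := dPi_eq_fderiv_chart hp hs u
  rw [h0] at this
  exact this.symm

lemma RegularPoint.regularAt {q p : M} (h : RegularPoint (n := n) π φ p)
    (hp : p ∈ (chartAt (Cn n) q).source) :
    RegularAt (π ∘ (chartAt (Cn n) q).symm) (φ ∘ (chartAt (Cn n) q).symm)
      (chartAt (Cn n) q p) where
  holomorphic := contDiffAt_comp_chart_symm hp h.holomorphic.self_of_nhds
  smooth := contDiffAt_real_comp_chart_symm hp h.smooth.self_of_nhds
  levi_pos := h.jConvex.levi_pos h.smooth.self_of_nhds hp
  submersion := fderiv_chart_ne_zero h.holomorphic.self_of_nhds hp h.submersion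
  neg := by
    rw [Function.comp_apply, (chartAt (Cn n) q).left_inv hp]; exact h.neg

lemma tendsto_chart_symm {q p : M} (hp : p ∈ (chartAt (Cn n) q).source) :
    Tendsto (chartAt (Cn n) q).symm (𝓝 (chartAt (Cn n) q p)) (𝓝 p) := by
  have h := (chartAt (Cn n) q).continuousAt_symm ((chartAt (Cn n) q).map_source hp)
  rwa [ContinuousAt, (chartAt (Cn n) q).left_inv hp] at h

lemma eventually_contDiffAt_chart {q p : M} (hp : p ∈ (chartAt (Cn n) q).source)
    (h : ∀ᶠ r in 𝓝 p, ContMDiffAt 𝓘(ℝ, Cn n) 𝓘(ℝ, ℝ) ∞ φ r) :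
    ∀ᶠ x in 𝓝 (chartAt (Cn n) q p), ContDiffAt ℝ ∞ (φ ∘ (chartAt (Cn n) q).symm) x := by
  filter_upwards [(tendsto_chart_symm hp).eventually h,
    (tendsto_chart_symm hp).eventually ((chartAt (Cn n) q).open_source.mem_nhds hp),
    (chartAt (Cn n) q).open_target.mem_nhds ((chartAt (Cn n) q).map_source hp)] with x h1 h2 h3
  have := contDiffAt_real_comp_chart_symm h2 h1
  rwa [(chartAt (Cn n) q).right_inv h3] at this

lemma eventually_holomorphic_chart {q p : M} (hp : p ∈ (chartAt (Cn n) q).source)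
    (h : ∀ᶠ r in 𝓝 p, ContMDiffAt 𝓘(ℂ, Cn n) 𝓘(ℂ, ℂ) ω π r) :
    ∀ᶠ x in 𝓝 (chartAt (Cn n) q p), ContDiffAt ℂ ω (π ∘ (chartAt (Cn n) q).symm) x := by
  filter_upwards [(tendsto_chart_symm hp).eventually h,
    (tendsto_chart_symm hp).eventually ((chartAt (Cn n) q).open_source.mem_nhds hp),
    (chartAt (Cn n) q).open_target.mem_nhds ((chartAt (Cn n) q).map_source hp)] with x h1 h2 h3
  have := contDiffAt_comp_chart_symm h2 h1
  rwa [(chartAt (Cn n) q).right_inv h3] at this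

lemma eventually_fderiv_ne_zero {E : Type*} [NormedAddCommGroup E] [NormedSpace ℂ E] {P : E → ℂ}
    {x : E} (hP : ContDiffAt ℂ 2 P x) (h : fderiv ℂ P x ≠ 0) :
    ∀ᶠ y in 𝓝 x, fderiv ℂ P y ≠ 0 := by
  have cD : ContinuousAt (fderiv ℂ P) x := (hP.fderiv_right (m := 1) le_rfl).continuousAt
  exact cD.eventually_ne h

lemma RegularPoint.eventually_regularAt {q p : M} (h : RegularPoint (n := n) π φ p)
    (hp : p ∈ (chartAt (Cn n) q).source) :
    ∀ᶠ x in 𝓝 (chartAt (Cn n) q p),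
      RegularAt (π ∘ (chartAt (Cn n) q).symm) (φ ∘ (chartAt (Cn n) q).symm) x := by
  have h0 := h.regularAt hp
  obtain ⟨m, hm, hm'⟩ := eventually_le_levi h0.smooth h0.levi_pos
  filter_upwards [eventually_holomorphic_chart hp h.holomorphic,
    eventually_contDiffAt_chart hp h.smooth, hm',
    eventually_fderiv_ne_zero (h0.holomorphic.of_le le_top) h0.submersion,
    h0.smooth.continuousAt.eventually_lt continuousAt_const h0.neg] with x h1 h2 h3 h4 h5
  refine ⟨h1, h2, fun v hv => lt_of_lt_of_le ?_ (h3 v), h4, h5⟩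
  have := norm_pos_iff.2 hv
  positivity

lemma isHorizontal_iff_chart {q p : M} (hg : IsConvexExhaustion g)
    (h : RegularPoint (n := n) π φ p)
    (hp : p ∈ (chartAt (Cn n) q).source) (v : Cn n) (ζ : ℂ) :
    (IsHorizontal π φ g p v ∧ dPi π p v = ζ) ↔
      coordDeriv q p v = ζ • connField (π ∘ (chartAt (Cn n) q).symm)
        (φ ∘ (chartAt (Cn n) q).symm) g (chartAt (Cn n) q p) := by
  have h0 := h.regularAt hp
  have hgs : ContDiffAt ℝ 2 ((fun r => g (φ r)) ∘ (chartAt (Cn n) q).symm)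
      (chartAt (Cn n) q p) :=
    ((hg.contDiffAt h0.neg).comp _ h0.smooth).of_le (by norm_cast)
  rw [← h0.horizontal_iff hg, dPi_eq_fderiv_chart hp h.holomorphic.self_of_nhds]
  refine and_congr_left fun _ => ?_
  constructor
  · intro H w hw
    obtain ⟨u, rfl⟩ := (bijective_coordDeriv hp).2 w
    have h1 := H u (by rw [dPi_eq_fderiv_chart hp h.holomorphic.self_of_nhds]; exact hw)
    rwa [omegaForm_eq_levi_chart hp hgs] at h1
  · intro H w hw
    rw [omegaForm_eq_levi_chart hp hgs]
    exact H _ (by rw [← dPi_eq_fderiv_chart hp h.holomorphic.self_of_nhds]; exact hw)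

/-- At time `t`, the curve `c` has a horizontal velocity that projects to `ζ`. -/
def HasHorizontalVelocity (π : M → ℂ) (φ : M → ℝ) (g : ℝ → ℝ) (c : ℝ → M) (S : Set ℝ) (t : ℝ)
    (ζ : ℂ) : Prop :=
  ∃ v : Cn n, (IsHorizontal π φ g (c t) v ∧ dPi π (c t) v = ζ) ∧
    HasMFDerivWithinAt 𝓘(ℝ, ℝ) 𝓘(ℝ, Cn n) c S t
      ((ContinuousLinearMap.toSpanSingleton ℝ v : ℝ →L[ℝ] Cn n))

lemma hasHorizontalVelocity_iff {c : ℝ → M} {S : Set ℝ} {t : ℝ} {ζ : ℂ} {q : M}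
    (hg : IsConvexExhaustion g) (h : RegularPoint (n := n) π φ (c t))
    (hq : c t ∈ (chartAt (Cn n) q).source) :
    HasHorizontalVelocity (n := n) π φ g c S t ζ ↔ ContinuousWithinAt c S t ∧
      HasDerivWithinAt (chartAt (Cn n) q ∘ c)
        (ζ • connField (π ∘ (chartAt (Cn n) q).symm) (φ ∘ (chartAt (Cn n) q).symm) g
          (chartAt (Cn n) q (c t))) S t := by
  constructor
  · rintro ⟨v, hv, hc⟩
    rw [isHorizontal_iff_chart hg h hq] at hv
    rw [hasMFDerivWithinAt_toSpanSingleton_iff hq, hv] at hc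
    exact hc
  · intro hc
    obtain ⟨v, hv⟩ := (bijective_coordDeriv hq).2 (ζ • connField
      (π ∘ (chartAt (Cn n) q).symm) (φ ∘ (chartAt (Cn n) q).symm) g (chartAt (Cn n) q (c t)))
    refine ⟨v, (isHorizontal_iff_chart hg h hq v ζ).2 hv, ?_⟩
    rw [hasMFDerivWithinAt_toSpanSingleton_iff hq, hv]
    exact hc

end Regular

/-! ### Geometry of a Stein Lefschetz fibration -/

section Fibration

variable {n : ℕ} {M : Type*} [TopologicalSpace M] [ChartedSpace (Cn n) M]
  [IsManifold 𝓘(ℂ, Cn n) ω M] {V : Set M} {π : M → ℂ} {φ : M → ℝ} {g : ℝ → ℝ}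

lemma IsSteinLefschetzFibration.eventually_holomorphic
    (hV : IsSteinLefschetzFibration (n := n) V π) {p : M} (hp : p ∈ V) :
    ∀ᶠ q in 𝓝 p, ContMDiffAt 𝓘(ℂ, Cn n) 𝓘(ℂ, ℂ) ω π q := by
  obtain ⟨W, hW, hVW, h⟩ := hV.holomorphic
  filter_upwards [hW.mem_nhds (hVW hp)] with q hq using h.contMDiffAt (hW.mem_nhds hq)

lemma CutsOutHorizontalBoundary.eventually_smooth
    (hφ : CutsOutHorizontalBoundary (n := n) V π φ) {p : M} (hp : p ∈ V) :
    ∀ᶠ q in 𝓝 p, ContMDiffAt 𝓘(ℝ, Cn n) 𝓘(ℝ, ℝ) ∞ φ q := by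
  obtain ⟨W, hW, hVW, h⟩ := hφ.smooth
  filter_upwards [hW.mem_nhds (hVW hp)] with q hq using h.contMDiffAt (hW.mem_nhds hq)

lemma dPi_ne_zero_of_notMem_crit {p : M} (hp : p ∈ V) (hc : p ∉ crit (n := n) V π) :
    dPi (n := n) π p ≠ 0 := fun h => hc ⟨hp, h⟩

lemma IsSteinLefschetzFibration.notMem_horizontalBoundary_of_mem_crit
    (hV : IsSteinLefschetzFibration (n := n) V π) {p : M} (hp : p ∈ crit (n := n) V π) :
    p ∉ horizontalBoundary V π := by
  rintro ⟨-, h⟩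
  refine h ?_
  filter_upwards [mem_interior_iff_mem_nhds.1 (hV.crit_interior hp)] with q hq h
  exact h.2 hq

lemma eventually_mem_diff_of_neg {p : M} {U : Set M} {ρ : M → ℝ}
    (hU : IsOpen U) (hpU : p ∈ U) (hρ : ContMDiffOn 𝓘(ℝ, Cn n) 𝓘(ℝ, ℝ) ∞ ρ U)
    (hVU : V ∩ U = {q ∈ U | ‖π q‖ ≤ 1 ∧ ρ q ≤ 0}) (h : ρ p < 0) :
    ∀ᶠ q in 𝓝 p, ‖π q‖ ≤ 1 → q ∈ V \ horizontalBoundary V π := by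
  have h0 : ∀ᶠ q in 𝓝 p, q ∈ U := hU.mem_nhds hpU
  have h1 : ∀ᶠ q in 𝓝 p, q ∈ U ∧ ρ q < 0 :=
    h0.and ((hρ.contMDiffAt (hU.mem_nhds hpU)).continuousAt.eventually_lt continuousAt_const h)
  have key : ∀ q, q ∈ U ∧ ρ q < 0 → ‖π q‖ ≤ 1 → q ∈ V := fun q hq hq' => by
    have : q ∈ V ∩ U := by rw [hVU]; exact ⟨hq.1, hq', hq.2.le⟩
    exact this.1
  filter_upwards [h1.eventually_nhds] with q hq hq'
  refine ⟨key q hq.self_of_nhds hq', fun hB => hB.2 ?_⟩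
  filter_upwards [hq] with r hr hr'
  exact hr'.2 (key r hr (by rw [hr'.1]; exact hq'))

lemma mem_horizontalBoundary_of_transverse {p q : M} (hp : p ∈ V) {U : Set M} {ρ : M → ℝ}
    (hπ : ContMDiffAt 𝓘(ℂ, Cn n) 𝓘(ℂ, ℂ) ω π p)
    (hU : IsOpen U) (hpU : p ∈ U) (hρ : ContMDiffOn 𝓘(ℝ, Cn n) 𝓘(ℝ, ℝ) ∞ ρ U)
    (hVU : V ∩ U = {q ∈ U | ‖π q‖ ≤ 1 ∧ ρ q ≤ 0}) (h : ρ p = 0)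
    (hq : p ∈ (chartAt (Cn n) q).source)
    (hD : fderiv ℂ (π ∘ (chartAt (Cn n) q).symm) (chartAt (Cn n) q p) ≠ 0) {w : Cn n}
    (hw : fderiv ℂ (π ∘ (chartAt (Cn n) q).symm) (chartAt (Cn n) q p) w = 0)
    (hL : fderiv ℝ (ρ ∘ (chartAt (Cn n) q).symm) (chartAt (Cn n) q p) w ≠ 0) :
    p ∈ horizontalBoundary V π := by
  have h1 := frequently_gt_of_transverse
    ((contDiffAt_comp_chart_symm hq hπ).of_le le_top)
    ((contDiffAt_real_comp_chart_symm hq (hρ.contMDiffAt (hU.mem_nhds hpU))).of_le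
      (by norm_cast)) hD hw hL
  have h2 : ∃ᶠ r in 𝓝 p, π r = π p ∧ 0 < ρ r := by
    refine (tendsto_chart_symm hq).frequently (h1.mono fun x hx => ?_)
    simpa [(chartAt (Cn n) q).left_inv hq, h] using hx
  refine ⟨hp, (h2.and_eventually (hU.mem_nhds hpU)).mono fun r hr => ⟨hr.1.1, fun hrV => ?_⟩⟩
  have h3 : r ∈ V ∩ U := ⟨hrV, hr.2⟩
  rw [hVU] at h3
  exact absurd hr.1.2 (not_lt.2 h3.2.2)

lemma IsSteinLefschetzFibration.exists_local_equation
    (hV : IsSteinLefschetzFibration (n := n) V π) {p : M} (hp : p ∈ V)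
    (hc : p ∉ crit (n := n) V π) : ∃ (U : Set M) (ρ : M → ℝ),
    IsOpen U ∧ p ∈ U ∧ ContMDiffOn 𝓘(ℝ, Cn n) 𝓘(ℝ, ℝ) ∞ ρ U ∧
    V ∩ U = {q ∈ U | ‖π q‖ ≤ 1 ∧ ρ q ≤ 0} ∧
    (ρ p = 0 → ∃ w, fderiv ℂ (π ∘ (chartAt (Cn n) p).symm) (chartAt (Cn n) p p) w = 0 ∧
      fderiv ℝ (ρ ∘ (chartAt (Cn n) p).symm) (chartAt (Cn n) p p) w ≠ 0) := by
  obtain ⟨U, ρ, hU, hpU, hρ, hVU, h⟩ := hV.fibration p hp hc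
  refine ⟨U, ρ, hU, hpU, hρ, hVU, fun h0 => ?_⟩
  obtain ⟨v, hv1, hv2⟩ := h h0
  have hs := mem_chart_source (Cn n) p
  rw [dPi_eq_fderiv_chart hs (hV.eventually_holomorphic hp).self_of_nhds] at hv1
  rw [dReal_eq_fderiv_chart hs (hρ.contMDiffAt (hU.mem_nhds hpU))] at hv2
  exact ⟨_, hv1, hv2⟩

/-- At a noncritical point off the horizontal boundary the local equation satisfies ρ < 0, since ρ =
0 with a transverse fibre direction would put the point on that boundary. So a nearby curve can
leave V only by leaving the disk, which a lift of a path in the disk does not do. -/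
lemma IsSteinLefschetzFibration.eventually_mem_diff
    (hV : IsSteinLefschetzFibration (n := n) V π) {p : M} (hp : p ∈ V \ horizontalBoundary V π)
    (hc : p ∉ crit (n := n) V π) :
    ∀ᶠ q in 𝓝 p, ‖π q‖ ≤ 1 → q ∈ V \ horizontalBoundary V π := by
  obtain ⟨U, ρ, hU, hpU, hρ, hVU, h⟩ := hV.exists_local_equation hp.1 hc
  have h1 : p ∈ V ∩ U := ⟨hp.1, hpU⟩
  rw [hVU] at h1
  refine eventually_mem_diff_of_neg hU hpU hρ hVU (lt_of_le_of_ne h1.2.2 fun h0 => ?_)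
  obtain ⟨w, hw1, hw2⟩ := h h0
  have hs := mem_chart_source (Cn n) p
  have hπ := (hV.eventually_holomorphic hp.1).self_of_nhds
  exact hp.2 (mem_horizontalBoundary_of_transverse hp.1 hπ hU hpU hρ hVU h0 hs
    (fderiv_chart_ne_zero hπ hs (dPi_ne_zero_of_notMem_crit hp.1 hc)) hw1 hw2)

lemma exists_ker_fderiv_chart_ne_zero (hV : IsSteinLefschetzFibration (n := n) V π)
    (hφ : CutsOutHorizontalBoundary (n := n) V π φ) {p : M} (hp : p ∈ horizontalBoundary V π) :
    ∃ w, fderiv ℂ (π ∘ (chartAt (Cn n) p).symm) (chartAt (Cn n) p p) w = 0 ∧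
      fderiv ℝ (φ ∘ (chartAt (Cn n) p).symm) (chartAt (Cn n) p p) w ≠ 0 := by
  have hc : p ∉ crit (n := n) V π :=
    fun h => hV.notMem_horizontalBoundary_of_mem_crit h hp
  obtain ⟨U, ρ, hU, hpU, hρ, hVU, h⟩ := hV.exists_local_equation hp.1 hc
  have h1 : p ∈ V ∩ U := ⟨hp.1, hpU⟩
  rw [hVU] at h1
  have h0 : ρ p = 0 := by
    refine le_antisymm h1.2.2 (not_lt.1 fun h0 => ?_)
    exact ((eventually_mem_diff_of_neg hU hpU hρ hVU h0).self_of_nhds h1.2.1).2 hp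
  obtain ⟨w, hw1, hw2⟩ := h h0
  have hs := mem_chart_source (Cn n) p
  have hπ := hV.eventually_holomorphic hp.1
  have hD := fderiv_chart_ne_zero hπ.self_of_nhds hs (dPi_ne_zero_of_notMem_crit hp.1 hc)
  have hρp := hρ.contMDiffAt (hU.mem_nhds hpU)
  have hPs : ContDiffAt ℂ ω (π ∘ (chartAt (Cn n) p).symm) (chartAt (Cn n) p p) :=
    contDiffAt_comp_chart_symm hs hπ.self_of_nhds
  have hrs : ContDiffAt ℝ ∞ (ρ ∘ (chartAt (Cn n) p).symm) (chartAt (Cn n) p p) :=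
    contDiffAt_real_comp_chart_symm hs hρp
  have hFs := contDiffAt_real_comp_chart_symm hs (hφ.eventually_smooth hp.1).self_of_nhds
  have hpp : (chartAt (Cn n) p).symm (chartAt (Cn n) p p) = p := (chartAt (Cn n) p).left_inv hs
  refine exists_ker_fderiv_ne_zero (hPs.of_le le_top) (hrs.of_le (by norm_cast))
    (hFs.differentiableAt (by simp)) hD hw1 hw2 (by simpa [hpp] using h1.2.1) ?_ ?_
  -- Near p, the points over the disk with ρ = 0 still have a fibre direction transverse to ρ, hence
  -- lie on the horizontal boundary, where φ = 0.
  · have ht := tendsto_chart_symm hs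
    filter_upwards [ht.eventually (hU.mem_nhds hpU), ht.eventually hπ,
      ht.eventually ((chartAt (Cn n) p).open_source.mem_nhds hs),
      (chartAt (Cn n) p).open_target.mem_nhds (mem_chart_target (Cn n) p),
      eventually_fderiv_ne_zero (hPs.of_le le_top) hD,
      eventually_exists_transverse (hPs.of_le le_top) (hrs.of_le (by norm_cast)) hD hw1 hw2]
      with y e1 e2 e3 e4 e5 e6 n1 n2
    simp only [Function.comp_apply, hpp, h0] at n1 n2 ⊢
    have hyV : (chartAt (Cn n) p).symm y ∈ V ∩ U := by rw [hVU]; exact ⟨e1, n1, n2.le⟩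
    obtain ⟨w', hw'1, hw'2⟩ := e6
    refine (hφ.zero_iff _ hyV.1).2 (mem_horizontalBoundary_of_transverse (q := p) (w := w')
      hyV.1 e2 hU e1 hρ hVU n2 e3 ?_ ?_ ?_) <;>
    rwa [(chartAt (Cn n) p).right_inv e4]
  · intro h2
    refine hφ.regular p hp (ContinuousLinearMap.ext fun v => ?_)
    have h3 := dReal_eq_fderiv_chart hs (hφ.eventually_smooth hp.1).self_of_nhds v
    rw [h2] at h3
    exact h3

end Fibration

section Estimates

variable {n : ℕ} {M : Type*} [TopologicalSpace M] [ChartedSpace (Cn n) M]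
  [IsManifold 𝓘(ℂ, Cn n) ω M] {V : Set M} {π : M → ℂ} {φ : M → ℝ} {g : ℝ → ℝ}

/-! ### The maximum principle on the fibres -/

lemma exists_holomorphic_disc_of_submersion {E : Type*} [NormedAddCommGroup E] [NormedSpace ℂ E]
    [FiniteDimensional ℂ E] {P : E → ℂ} {x₀ : E} (hP : ContDiffAt ℂ 2 P x₀)
    (hD : fderiv ℂ P x₀ ≠ 0) (hdim : 2 ≤ Module.finrank ℂ E) :
    ∃ G : ℂ → E, G 0 = x₀ ∧ ContDiffAt ℂ 2 G 0 ∧ fderiv ℂ G 0 1 ≠ 0 ∧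
      ∀ᶠ t in 𝓝 0, P (G t) = P x₀ := by
  have : CompleteSpace E := FiniteDimensional.complete ℂ E
  obtain ⟨u, hu⟩ : ∃ u, fderiv ℂ P x₀ u ≠ 0 := by
    by_contra! h
    exact hD (ContinuousLinearMap.ext h)
  obtain ⟨σ, h0, h1, h2, -, h3, -⟩ := exists_straightening (n := 2) (by simp) hP
    (hP.differentiableAt (by simp)).hasFDerivAt
    (ContinuousLinearMap.toSpanSingleton ℂ ((fderiv ℂ P x₀ u)⁻¹ • u)) (fun y => by simp [hu])
  have hker : (LinearMap.ker (fderiv ℂ P x₀ : E →ₗ[ℂ] ℂ)) ≠ ⊥ :=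
    LinearMap.ker_ne_bot_of_finrank_lt (by rw [Module.finrank_self]; omega)
  obtain ⟨k, hk, hk0⟩ := Submodule.exists_mem_ne_zero_of_ne_bot hker
  have hk' : fderiv ℂ P x₀ k = 0 := hk
  have hl : HasFDerivAt (fun t : ℂ => x₀ + t • k) (ContinuousLinearMap.toSpanSingleton ℂ k) 0 :=
    (ContinuousLinearMap.toSpanSingleton ℂ k).hasFDerivAt.const_add x₀
  have hlt : Tendsto (fun t : ℂ => x₀ + t • k) (𝓝 0) (𝓝 x₀) := by
    have := hl.continuousAt.tendsto
    rwa [zero_smul, add_zero] at this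
  have hσ : ContDiffAt ℂ 2 σ (x₀ + (0 : ℂ) • k) := by rwa [zero_smul, add_zero]
  have hσ' : HasFDerivAt σ (ContinuousLinearMap.id ℂ E) (x₀ + (0 : ℂ) • k) := by
    rwa [zero_smul, add_zero]
  refine ⟨fun t => σ (x₀ + t • k), by simp [h0], ?_, ?_, ?_⟩
  · exact ContDiffAt.comp (0 : ℂ) hσ (contDiffAt_const.add (contDiffAt_id.smul contDiffAt_const))
  · have h4 : fderiv ℂ (fun t : ℂ => σ (x₀ + t • k)) 0 = _ := (hσ'.comp (0 : ℂ) hl).fderiv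
    rw [h4]
    simpa using hk0
  · filter_upwards [hlt.eventually h3] with t ht
    rw [ht, add_sub_cancel_left, map_smul, hk', smul_zero, add_zero]

/-- The vector (1, i, 0, …) is isotropic for ∑ zᵢ², so the complex line it spans lies in the
singular fibre. This needs two coordinates. -/
lemma exists_holomorphic_disc_of_crit (hV : IsSteinLefschetzFibration (n := n) V π)
    (hn : 2 ≤ n) {p : M} (hp : p ∈ crit (n := n) V π) :
    ∃ G : ℂ → Cn n, G 0 = chartAt (Cn n) p p ∧ ContDiffAt ℂ 2 G 0 ∧ fderiv ℂ G 0 1 ≠ 0 ∧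
      ∀ᶠ t in 𝓝 0, π ((chartAt (Cn n) p).symm (G t)) = π p := by
  obtain ⟨z, hz, hpz, hzp, hπ⟩ := hV.crit_nondegenerate p hp
  set e := chartAt (Cn n) p
  have hs : p ∈ e.source := mem_chart_source (Cn n) p
  let i₀ : Fin n := ⟨0, by omega⟩
  let i₁ : Fin n := ⟨1, by omega⟩
  have hi : i₀ ≠ i₁ := by simp [i₀, i₁]
  let k : Cn n := EuclideanSpace.single i₀ 1 + EuclideanSpace.single i₁ Complex.I
  have hk0 : k i₀ = 1 := by simp [k, hi]
  have hk : k ≠ 0 := by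
    intro h
    rw [h] at hk0
    simp at hk0
  have hsq : ∑ i, (k i) ^ 2 = 0 := by
    rw [Fintype.sum_eq_add i₀ i₁ hi]
    · simp [k, hi, hi.symm]
    · rintro i ⟨h0, h1⟩
      simp [k, h0, h1]
  have h0t : (0 : Cn n) ∈ z.target := by rw [← hzp]; exact z.map_source hpz
  have hz0 : z.symm 0 = p := by rw [← hzp]; exact z.left_inv hpz
  have hA : ContDiffAt ℂ ω (e ∘ z.symm) (0 : Cn n) := by
    have h1 : ContMDiffAt 𝓘(ℂ, Cn n) 𝓘(ℂ, Cn n) ω e (z.symm 0) := by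
      rw [hz0]
      exact contMDiffAt_of_mem_maximalAtlas (IsManifold.chart_mem_maximalAtlas p) hs
    exact (h1.comp _ (contMDiffAt_symm_of_mem_maximalAtlas hz h0t)).contDiffAt
  have hB : ContDiffAt ℂ ω (z ∘ e.symm) (e p) := by
    have h1 : ContMDiffAt 𝓘(ℂ, Cn n) 𝓘(ℂ, Cn n) ω z (e.symm (e p)) := by
      rw [e.left_inv hs]
      exact contMDiffAt_of_mem_maximalAtlas hz hpz
    exact (h1.comp _ (contMDiffAt_symm_of_mem_maximalAtlas (IsManifold.chart_mem_maximalAtlas p)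
      (e.map_source hs))).contDiffAt
  have hl : ContDiff ℂ ω (fun t : ℂ => t • k) := contDiff_id.smul contDiff_const
  have hlt : Tendsto (fun t : ℂ => t • k) (𝓝 0) (𝓝 (0 : Cn n)) := by
    have := hl.continuous.tendsto 0
    rwa [zero_smul] at this
  have hzt : Tendsto z.symm (𝓝 0) (𝓝 p) := by
    have := z.continuousAt_symm h0t
    rwa [ContinuousAt, hz0] at this
  have hG : ContDiffAt ℂ ω (fun t : ℂ => e (z.symm (t • k))) 0 := by
    have hA' : ContDiffAt ℂ ω (e ∘ z.symm) ((0 : ℂ) • k) := by rwa [zero_smul]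
    exact ContDiffAt.comp (g := e ∘ z.symm) (f := fun t : ℂ => t • k) (0 : ℂ) hA' hl.contDiffAt
  have hsrc : ∀ᶠ t : ℂ in 𝓝 0, z.symm (t • k) ∈ e.source :=
    (hzt.comp hlt).eventually (e.open_source.mem_nhds hs)
  have htgt : ∀ᶠ t : ℂ in 𝓝 0, t • k ∈ z.target :=
    hlt.eventually (z.open_target.mem_nhds h0t)
  refine ⟨fun t => e (z.symm (t • k)), ?_, hG.of_le le_top, ?_, ?_⟩
  · simp only [zero_smul, hz0]
  · intro hG0
    have e1 : (fun t : ℂ => (z ∘ e.symm) (e (z.symm (t • k)))) =ᶠ[𝓝 0] fun t => t • k := by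
      filter_upwards [hsrc, htgt] with t h1 h2
      rw [Function.comp_apply, e.left_inv h1, z.right_inv h2]
    have hB' : HasFDerivAt (z ∘ e.symm) (fderiv ℂ (z ∘ e.symm) (e p))
        (e (z.symm ((0 : ℂ) • k))) := by
      rw [zero_smul, hz0]; exact (hB.differentiableAt (by simp)).hasFDerivAt
    have h1 := hB'.comp (0 : ℂ) (hG.differentiableAt (by simp)).hasFDerivAt
    have h2 := (h1.congr_of_eventuallyEq e1.symm).unique
      (ContinuousLinearMap.toSpanSingleton ℂ k).hasFDerivAt
    have h3 := congrArg (fun L => L (1 : ℂ)) h2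
    simp only [ContinuousLinearMap.comp_apply, hG0, map_zero,
      ContinuousLinearMap.toSpanSingleton_apply, one_smul] at h3
    exact hk h3.symm
  · filter_upwards [hsrc, htgt] with t h1 h2
    rw [e.left_inv h1, hπ _ (z.map_target h2), z.right_inv h2]
    have : ∀ i, ((t • k : Cn n) i) ^ 2 = t ^ 2 * (k i) ^ 2 := fun i => by
      rw [PiLp.smul_apply, smul_eq_mul, mul_pow]
    simp only [this]
    rw [← Finset.mul_sum, hsq, mul_zero, add_zero]

/-- On the compact fibre φ attains its maximum. Off the horizontal boundary the ambient fibre stays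
in V, and the maximum point carries a holomorphic disc inside the fibre, along which strict
J-convexity forbids a local maximum. So the maximum is on the horizontal boundary and equals 0. -/
lemma neg_of_notMem_horizontalBoundary (hV : IsSteinLefschetzFibration (n := n) V π)
    (hφ : CutsOutHorizontalBoundary (n := n) V π φ) (hn : 2 ≤ n) {p : M}
    (hp : p ∈ V \ horizontalBoundary V π) : φ p < 0 := by
  have hcπ : ContinuousOn π V := fun q hq =>
    (hV.eventually_holomorphic hq).self_of_nhds.continuousAt.continuousWithinAt
  have hcφ : ContinuousOn φ V := fun q hq =>
    (hφ.eventually_smooth hq).self_of_nhds.continuousAt.continuousWithinAt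
  have hK : IsCompact (V ∩ π ⁻¹' {π p}) := by
    obtain ⟨C, hC, hC'⟩ := continuousOn_iff_isClosed.1 hcπ {π p} isClosed_singleton
    rw [inter_comm, hC', inter_comm]
    exact hV.compact.inter_right hC
  obtain ⟨m, ⟨hmV, hmπ⟩, hmax⟩ :=
    hK.exists_isMaxOn ⟨p, hp.1, rfl⟩ (hcφ.mono inter_subset_left)
  have hmB : m ∈ horizontalBoundary V π := by
    by_contra hmB
    have h1 : ∀ᶠ q in 𝓝 m, π q = π m → q ∈ V := by
      by_contra h
      refine hmB ⟨hmV, (not_eventually.1 h).mono fun q hq => ?_⟩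
      simpa using hq
    have h2 : ∀ᶠ q in 𝓝 m, π q = π m → φ q ≤ φ m := by
      filter_upwards [h1] with q hq hq'
      exact hmax ⟨hq hq', hq'.trans hmπ⟩
    have hs := mem_chart_source (Cn n) m
    have hmm : (chartAt (Cn n) m).symm (chartAt (Cn n) m m) = m := (chartAt (Cn n) m).left_inv hs
    obtain ⟨G, hG0, hG, hG', hGπ⟩ : ∃ G : ℂ → Cn n, G 0 = chartAt (Cn n) m m ∧
        ContDiffAt ℂ 2 G 0 ∧ fderiv ℂ G 0 1 ≠ 0 ∧
        ∀ᶠ t in 𝓝 0, π ((chartAt (Cn n) m).symm (G t)) = π m := by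
      by_cases hc : m ∈ crit (n := n) V π
      · exact exists_holomorphic_disc_of_crit hV hn hc
      · have hπ := (hV.eventually_holomorphic hmV).self_of_nhds
        have := exists_holomorphic_disc_of_submersion
          ((contDiffAt_comp_chart_symm hs hπ).of_le le_top)
          (fderiv_chart_ne_zero hπ hs (dPi_ne_zero_of_notMem_crit hmV hc)) (by simpa using hn)
        simpa [hmm] using this
    have hφs := (hφ.eventually_smooth hmV).self_of_nhds
    refine not_isLocalMax_of_levi_pos (f := φ ∘ (chartAt (Cn n) m).symm) hG ?_ hG' ?_ ?_
    · rw [hG0]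
      exact (contDiffAt_real_comp_chart_symm hs hφs).of_le (by norm_cast)
    · rw [hG0]
      exact (hφ.jConvex m hmV).levi_pos hφs hs
    · have h3 : Tendsto (fun t => (chartAt (Cn n) m).symm (G t)) (𝓝 0) (𝓝 m) := by
        have := hG.continuousAt.tendsto
        rw [hG0] at this
        exact (tendsto_chart_symm hs).comp this
      filter_upwards [h3.eventually h2, hGπ] with t e1 e2
      simp only [Function.comp_apply, hG0, hmm]
      exact e1 e2
  have h1 : φ p ≤ φ m := hmax ⟨hp.1, rfl⟩
  rw [(hφ.zero_iff m hmV).2 hmB] at h1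
  exact lt_of_le_of_ne h1 fun h => hp.2 ((hφ.zero_iff p hp.1).1 h)

/-! ### The growth of `φ` along horizontal vectors -/

lemma regularPoint_of_neg (hV : IsSteinLefschetzFibration (n := n) V π)
    (hφ : CutsOutHorizontalBoundary (n := n) V π φ) {p : M} (hp : p ∈ V)
    (hc : p ∉ crit (n := n) V π) (hneg : φ p < 0) : RegularPoint (n := n) π φ p where
  holomorphic := hV.eventually_holomorphic hp
  smooth := hφ.eventually_smooth hp
  jConvex := hφ.jConvex p hp
  submersion := dPi_ne_zero_of_notMem_crit hp hc
  neg := hneg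

/-- Combines g'' |dφ(v)| ≤ C g' |dπ(v)| with g' ≤ |D| |φ| g'' and cancels g''. In the completeness
argument the growth condition enters only here. -/
lemma eventually_horizontal_bound (hV : IsSteinLefschetzFibration (n := n) V π)
    (hφ : CutsOutHorizontalBoundary (n := n) V π φ) (hg : IsConvexExhaustion g)
    (hg' : GrowthCondition g) {q : M} (hq : q ∈ horizontalBoundary V π) :
    ∃ C, 0 ≤ C ∧ ∀ᶠ p in 𝓝 q, p ∈ V → φ p < 0 → ∀ v : Cn n, IsHorizontal π φ g p v →
      |dReal φ p v| ≤ C * |φ p| * ‖dPi π p v‖ := by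
  have hs := mem_chart_source (Cn n) q
  have hc : q ∉ crit (n := n) V π := fun h => hV.notMem_horizontalBoundary_of_mem_crit h hq
  have hπ := hV.eventually_holomorphic hq.1
  have hφs := hφ.eventually_smooth hq.1
  obtain ⟨w, hw1, hw2⟩ := exists_ker_fderiv_chart_ne_zero hV hφ hq
  obtain ⟨C, hC0, hC⟩ := exists_horizontal_bound
    ((contDiffAt_comp_chart_symm hs hπ.self_of_nhds).of_le le_top)
    (contDiffAt_real_comp_chart_symm hs hφs.self_of_nhds)
    ((hφ.jConvex q hq.1).levi_pos hφs.self_of_nhds hs)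
    (fderiv_chart_ne_zero hπ.self_of_nhds hs (dPi_ne_zero_of_notMem_crit hq.1 hc)) hw1 hw2
  obtain ⟨D, hD⟩ := hg.growthCondition_iff.1 hg'
  rw [eventually_nhdsWithin_iff] at hD
  have hφq : Tendsto φ (𝓝 q) (𝓝 0) := by
    have := hφs.self_of_nhds.continuousAt.tendsto
    rwa [(hφ.zero_iff q hq.1).2 hq] at this
  refine ⟨C * |D|, by positivity, ?_⟩
  have hsrc : ∀ᶠ p in 𝓝 q, p ∈ (chartAt (Cn n) q).source :=
    (chartAt (Cn n) q).open_source.mem_nhds hs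
  filter_upwards [hφq.eventually hD, ((chartAt (Cn n) q).continuousAt hs).eventually hC,
    hsrc, hπ, hφs] with p h1 h2 h3 h4 h5 hpV hneg v hv
  have hFs := contDiffAt_real_comp_chart_symm h3 h5
  have hpp : (φ ∘ (chartAt (Cn n) q).symm) (chartAt (Cn n) q p) = φ p := by
    rw [Function.comp_apply, (chartAt (Cn n) q).left_inv h3]
  have hneg' : (φ ∘ (chartAt (Cn n) q).symm) (chartAt (Cn n) q p) < 0 := by rwa [hpp]
  have ha := hg.deriv_pos _ hneg
  have hb := hg.deriv_deriv_pos _ hneg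
  have hgs : ContDiffAt ℝ 2 ((fun r => g (φ r)) ∘ (chartAt (Cn n) q).symm)
      (chartAt (Cn n) q p) :=
    ((hg.contDiffAt hneg').comp _ hFs).of_le (by norm_cast)
  have h6 := h2 _ _ ha hb (coordDeriv q p v) (by
    intro u hu
    obtain ⟨u, rfl⟩ := (bijective_coordDeriv h3).2 u
    have h7 := hv u (by rw [dPi_eq_fderiv_chart h3 h4]; exact hu)
    rw [omegaForm_eq_levi_chart h3 hgs] at h7
    have h8 := hg.levi_comp_eq hFs hneg' (coordDeriv q p v) (coordDeriv q p u)
    rw [hpp] at h8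
    rw [← h8]
    exact h7)
  rw [← dReal_eq_fderiv_chart h3 h5, ← dPi_eq_fderiv_chart h3 h4] at h6
  refine le_of_mul_le_mul_left ?_ hb
  have h9 : deriv g (φ p) ≤ |D| * (|φ p| * deriv (deriv g) (φ p)) :=
    (h1 hneg).trans (mul_le_mul_of_nonneg_right (le_abs_self D) (by positivity))
  calc _ ≤ _ := h6
    _ ≤ C * (|D| * (|φ p| * deriv (deriv g) (φ p))) * ‖dPi π p v‖ := by gcongr
    _ = _ := by ring

lemma exists_uniform_horizontal_bound (hV : IsSteinLefschetzFibration (n := n) V π)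
    (hφ : CutsOutHorizontalBoundary (n := n) V π φ) (hg : IsConvexExhaustion g)
    (hg' : GrowthCondition g) (hneg : ∀ p ∈ V \ horizontalBoundary V π, φ p < 0) :
    ∃ ε > 0, ∃ C, 0 ≤ C ∧ ∀ p ∈ V, -ε < φ p → φ p < 0 → ∀ v : Cn n, IsHorizontal π φ g p v →
      |dReal φ p v| ≤ C * |φ p| * ‖dPi π p v‖ := by
  let Q : Set M → Prop := fun S => ∃ ε > 0, ∃ C, 0 ≤ C ∧ ∀ p ∈ S, p ∈ V → -ε < φ p → φ p < 0 →
    ∀ v : Cn n, IsHorizontal π φ g p v → |dReal φ p v| ≤ C * |φ p| * ‖dPi π p v‖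
  have hQ : Q V := by
    refine hV.compact.induction_on (p := Q) ⟨1, one_pos, 0, le_rfl, fun p hp => absurd hp (by simp)⟩
      ?_ ?_ ?_
    · rintro S T hST ⟨ε, hε, C, hC, h⟩
      exact ⟨ε, hε, C, hC, fun p hp => h p (hST hp)⟩
    · rintro S T ⟨ε, hε, C, hC, h⟩ ⟨ε', hε', C', hC', h'⟩
      refine ⟨min ε ε', lt_min hε hε', max C C', le_max_of_le_left hC, ?_⟩
      rintro p (hp | hp) hpV h1 h2 v hv
      · refine (h p hp hpV (by linarith [min_le_left ε ε']) h2 v hv).trans ?_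
        gcongr
        exact le_max_left _ _
      · refine (h' p hp hpV (by linarith [min_le_right ε ε']) h2 v hv).trans ?_
        gcongr
        exact le_max_right _ _
    · intro q hq
      by_cases hqB : q ∈ horizontalBoundary V π
      · obtain ⟨C, hC, h⟩ := eventually_horizontal_bound hV hφ hg hg' hqB
        exact ⟨_, mem_nhdsWithin_of_mem_nhds h, 1, one_pos, C, hC,
          fun p hp hpV _ h2 v hv => hp hpV h2 v hv⟩
      · have h1 := hneg q ⟨hq, hqB⟩
        have h2 : ∀ᶠ p in 𝓝 q, φ p < φ q / 2 :=
          (hφ.eventually_smooth hq).self_of_nhds.continuousAt.eventually_lt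
            continuousAt_const (by linarith)
        -- Away from the horizontal boundary the claim is made vacuous: φ < φ q / 2 = -ε nearby.
        exact ⟨_, mem_nhdsWithin_of_mem_nhds h2, -(φ q / 2), by linarith, 0, le_rfl,
          fun p hp hpV h3 => by
            have : φ p < φ q / 2 := hp
            linarith⟩
  obtain ⟨ε, hε, C, hC, h⟩ := hQ
  exact ⟨ε, hε, C, hC, fun p hp => h p hp hp⟩

end Estimates

/-- The flow box is stated for a field that is smooth on the whole space, while the connection is
smooth only near a regular point; a bump function bridges the two. -/
lemma exists_contDiff_eventuallyEq {E F : Type*} [NormedAddCommGroup E] [NormedSpace ℝ E]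
    [FiniteDimensional ℝ E] [NormedAddCommGroup F] [NormedSpace ℝ F] {h : E → F} {x₀ : E}
    (hh : ∀ᶠ x in 𝓝 x₀, ContDiffAt ℝ ∞ h x) :
    ∃ h' : E → F, ContDiff ℝ ∞ h' ∧ h' =ᶠ[𝓝 x₀] h := by
  obtain ⟨r, hr, H⟩ := Metric.eventually_nhds_iff_ball.1 hh
  let χ : ContDiffBump x₀ := ⟨r / 4, r / 2, by positivity, by linarith⟩
  refine ⟨fun x => χ x • h x, contDiff_iff_contDiffAt.2 fun x => ?_, ?_⟩
  · by_cases hx : x ∈ Metric.ball x₀ r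
    · exact χ.contDiff.contDiffAt.smul (H x hx)
    · have h1 : x ∉ tsupport χ := by
        rw [χ.tsupport_eq]
        intro h2
        refine hx (Metric.mem_ball.2 (lt_of_le_of_lt (Metric.mem_closedBall.1 h2) ?_))
        change r / 2 < r
        linarith
      have h2 : (fun x => χ x • h x) =ᶠ[𝓝 x] fun _ => 0 := by
        filter_upwards [notMem_tsupport_iff_eventuallyEq.1 h1] with y hy
        rw [hy]; simp
      exact contDiffAt_const.congr_of_eventuallyEq h2
  · filter_upwards [χ.eventuallyEq_one] with x hx
    rw [hx]; simp

/-! ### Parallel transport as an ODE: local existence, gluing, uniqueness -/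

section Transport

variable {n : ℕ} {M : Type*} [TopologicalSpace M] [ChartedSpace (Cn n) M]
  {V : Set M} {π : M → ℂ} {φ : M → ℝ} {g : ℝ → ℝ} {γ : ℝ → ℂ} {c c' : ℝ → M} {S T : Set ℝ}
  {t t₀ t₁ t₂ : ℝ}

lemma IsSmoothPath.differentiableOn (hγ : IsSmoothPath γ) : DifferentiableOn ℝ γ (Icc 0 1) :=
  hγ.1.differentiableOn (by simp)

lemma IsSmoothPath.norm_le (hγ : IsSmoothPath γ) (ht : t ∈ Icc (0 : ℝ) 1) : ‖γ t‖ ≤ 1 := by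
  simpa using hγ.2 ht

lemma IsSmoothPath.hasDerivWithinAt (hγ : IsSmoothPath γ) (ht : t ∈ Icc (0 : ℝ) 1) :
    HasDerivWithinAt γ (derivWithin γ (Icc 0 1) t) (Icc 0 1) t :=
  (hγ.differentiableOn t ht).hasDerivWithinAt

lemma IsSmoothPath.continuousOn_derivWithin (hγ : IsSmoothPath γ) :
    ContinuousOn (derivWithin γ (Icc 0 1)) (Icc 0 1) :=
  hγ.1.continuousOn_derivWithin (uniqueDiffOn_Icc one_pos) (by simp)

lemma IsSmoothPath.exists_bound (hγ : IsSmoothPath γ) :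
    ∃ A, 0 ≤ A ∧ ∀ t ∈ Icc (0 : ℝ) 1, ‖derivWithin γ (Icc 0 1) t‖ ≤ A := by
  obtain ⟨A, hA⟩ := isCompact_Icc.exists_bound_of_continuousOn hγ.continuousOn_derivWithin
  exact ⟨|A|, abs_nonneg A, fun t ht => (hA t ht).trans (le_abs_self A)⟩

/-- `c` is a horizontal lift of `γ` over `S`, with the velocity that `γ` prescribes. -/
def IsTransport (V : Set M) (π : M → ℂ) (φ : M → ℝ) (g : ℝ → ℝ) (γ : ℝ → ℂ) (S : Set ℝ)
    (c : ℝ → M) : Prop :=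
  ∀ t ∈ S, c t ∈ V \ horizontalBoundary V π ∧ c t ∉ crit (n := n) V π ∧ π (c t) = γ t ∧
    HasHorizontalVelocity (n := n) π φ g c S t (derivWithin γ (Icc 0 1) t)

lemma IsTransport.isHorizontalLift (h : IsTransport (n := n) V π φ g γ S c) :
    IsHorizontalLift (n := n) V π φ g γ S c := by
  intro t ht
  obtain ⟨h1, h2, h3, v, hv, hc⟩ := h t ht
  exact ⟨h1, h2, h3, v, hv.1, hc⟩

lemma IsTransport.continuousOn (h : IsTransport (n := n) V π φ g γ S c) : ContinuousOn c S := by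
  intro t ht
  obtain ⟨-, -, -, v, -, hc⟩ := h t ht
  exact hc.1

lemma IsTransport.mono (h : IsTransport (n := n) V π φ g γ S c) (hT : T ⊆ S) :
    IsTransport (n := n) V π φ g γ T c := by
  intro t ht
  obtain ⟨h1, h2, h3, v, hv, hc⟩ := h t (hT ht)
  exact ⟨h1, h2, h3, v, hv, hc.mono hT⟩

variable [IsManifold 𝓘(ℂ, Cn n) ω M]

/-- Differentiating π ∘ c = γ gives the projected velocity; unique differentiability of S identifies
it with the derivative of γ. -/
lemma IsHorizontalLift.isTransport (hV : IsSteinLefschetzFibration (n := n) V π)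
    (hγ : IsSmoothPath γ) (hS : UniqueDiffOn ℝ S) (hS1 : S ⊆ Icc 0 1)
    (h : IsHorizontalLift (n := n) V π φ g γ S c) : IsTransport (n := n) V π φ g γ S c := by
  intro t ht
  obtain ⟨h1, h2, h3, v, hv, hc⟩ := h t ht
  refine ⟨h1, h2, h3, v, ⟨hv, ?_⟩, hc⟩
  have hs := mem_chart_source (Cn n) (c t)
  have hπ := (hV.eventually_holomorphic h1.1).self_of_nhds
  rw [dPi_eq_fderiv_chart hs hπ]
  rw [hasMFDerivWithinAt_toSpanSingleton_iff hs] at hc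
  have hP := ((contDiffAt_comp_chart_symm hs hπ).differentiableAt (by simp)).hasFDerivAt
  have h4 := (hP.restrictScalars ℝ).comp_hasDerivWithinAt t hc.2
  have h5 : HasDerivWithinAt γ (fderiv ℂ (π ∘ (chartAt (Cn n) (c t)).symm)
      (chartAt (Cn n) (c t) (c t)) (coordDeriv (c t) (c t) v)) S t := by
    refine h4.congr_of_eventuallyEq ?_ ?_
    · filter_upwards [hc.1 ((chartAt (Cn n) (c t)).open_source.mem_nhds hs),
        self_mem_nhdsWithin] with s hs1 hs2
      have hs1' : c s ∈ (chartAt (Cn n) (c t)).source := hs1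
      simp only [Function.comp_apply, (chartAt (Cn n) (c t)).left_inv hs1']
      exact (h s hs2).2.2.1.symm
    · simp only [Function.comp_apply, (chartAt (Cn n) (c t)).left_inv hs]
      exact h3.symm
  exact (hS t ht).eq_deriv _ h5 ((hγ.hasDerivWithinAt (hS1 ht)).mono hS1)

lemma HasHorizontalVelocity.congr_mono {ζ : ℂ} (hg : IsConvexExhaustion g)
    (hr : RegularPoint (n := n) π φ (c t)) (h : HasHorizontalVelocity (n := n) π φ g c S t ζ)
    (heq : EqOn c' c S) (ht : t ∈ S) (hT : S ∈ 𝓝[T] t) :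
    HasHorizontalVelocity (n := n) π φ g c' T t ζ := by
  have hs := mem_chart_source (Cn n) (c t)
  have hr' : RegularPoint (n := n) π φ (c' t) := by rwa [heq ht]
  have hs' : c' t ∈ (chartAt (Cn n) (c t)).source := by rwa [heq ht]
  rw [hasHorizontalVelocity_iff hg hr hs] at h
  rw [hasHorizontalVelocity_iff hg hr' hs', heq ht]
  refine ⟨(h.1.congr heq (heq ht)).mono_of_mem_nhdsWithin hT, ?_⟩
  have h1 := h.2.congr (f₁ := chartAt (Cn n) (c t) ∘ c')
    (fun s hs => congrArg (chartAt (Cn n) (c t)) (heq hs))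
    (congrArg (chartAt (Cn n) (c t)) (heq ht))
  exact h1.mono_of_mem_nhdsWithin hT

lemma HasHorizontalVelocity.union {ζ : ℂ} (hg : IsConvexExhaustion g)
    (hr : RegularPoint (n := n) π φ (c t)) (h : HasHorizontalVelocity (n := n) π φ g c S t ζ)
    (h' : HasHorizontalVelocity (n := n) π φ g c T t ζ) :
    HasHorizontalVelocity (n := n) π φ g c (S ∪ T) t ζ := by
  have hs := mem_chart_source (Cn n) (c t)
  rw [hasHorizontalVelocity_iff hg hr hs] at h h' ⊢
  exact ⟨h.1.union h'.1, h.2.union h'.2⟩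

/-- What the completeness argument uses of the fibration, the function `g` and the path `γ`. -/
structure TransportSetting (V : Set M) (π : M → ℂ) (φ : M → ℝ) (g : ℝ → ℝ) (γ : ℝ → ℂ) :
    Prop where
  fibration : IsSteinLefschetzFibration (n := n) V π
  continuousAt : ∀ p ∈ V, ContinuousAt φ p
  zero : ∀ p ∈ horizontalBoundary V π, φ p = 0
  regular : ∀ p ∈ V \ horizontalBoundary V π, p ∉ crit (n := n) V π →
    RegularPoint (n := n) π φ p
  convex : IsConvexExhaustion g
  bound : ∃ ε > 0, ∃ C, 0 ≤ C ∧ ∀ p ∈ V, -ε < φ p → φ p < 0 → ∀ v : Cn n,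
    IsHorizontal π φ g p v → |dReal φ p v| ≤ C * |φ p| * ‖dPi π p v‖
  path : IsSmoothPath γ

lemma IsTransport.regularPoint (H : TransportSetting (n := n) V π φ g γ)
    (h : IsTransport (n := n) V π φ g γ S c) (ht : t ∈ S) : RegularPoint (n := n) π φ (c t) :=
  H.regular _ (h t ht).1 (h t ht).2.1

lemma IsTransport.congr_mono (H : TransportSetting (n := n) V π φ g γ)
    (h : IsTransport (n := n) V π φ g γ S c) (heq : EqOn c' c S) (hT : T ⊆ S) :
    IsTransport (n := n) V π φ g γ T c' := by
  intro t ht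
  obtain ⟨h1, h2, h3, h4⟩ := h t (hT ht)
  rw [heq (hT ht)]
  exact ⟨h1, h2, h3, h4.congr_mono H.convex (h.regularPoint H (hT ht)) heq (hT ht)
    (mem_of_superset self_mem_nhdsWithin hT)⟩

/-- There is no corner at t₁: both one-sided velocities are the horizontal lift, at the common
point, of the derivative of γ at t₁. -/
lemma IsTransport.glue (H : TransportSetting (n := n) V π φ g γ) (h01 : t₀ ≤ t₁) (h12 : t₁ ≤ t₂)
    (h : IsTransport (n := n) V π φ g γ (Icc t₀ t₁) c)
    (h' : IsTransport (n := n) V π φ g γ (Icc t₁ t₂) c') (heq : c t₁ = c' t₁) :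
    IsTransport (n := n) V π φ g γ (Icc t₀ t₂) (fun t => if t ≤ t₁ then c t else c' t) := by
  have e1 : EqOn (fun t => if t ≤ t₁ then c t else c' t) c (Icc t₀ t₁) := fun t ht => by
    simp [ht.2]
  have e2 : EqOn (fun t => if t ≤ t₁ then c t else c' t) c' (Icc t₁ t₂) := fun t ht => by
    rcases eq_or_lt_of_le ht.1 with rfl | h
    · simp [heq]
    · simp [not_le.2 h]
  have f1 := h.congr_mono H e1 Subset.rfl
  have f2 := h'.congr_mono H e2 Subset.rfl
  intro t ht
  rcases lt_trichotomy t t₁ with hlt | rfl | hlt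
  · obtain ⟨a1, a2, a3, a4⟩ := f1 t ⟨ht.1, hlt.le⟩
    refine ⟨a1, a2, a3, a4.congr_mono H.convex (H.regular _ a1 a2) (fun _ _ => rfl)
      ⟨ht.1, hlt.le⟩ ?_⟩
    filter_upwards [self_mem_nhdsWithin, mem_nhdsWithin_of_mem_nhds (Iio_mem_nhds hlt)] with s h1 h2
    exact ⟨h1.1, le_of_lt h2⟩
  · obtain ⟨a1, a2, a3, a4⟩ := f1 t ⟨h01, le_rfl⟩
    refine ⟨a1, a2, a3, ?_⟩
    rw [← Icc_union_Icc_eq_Icc h01 h12]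
    exact a4.union H.convex (H.regular _ a1 a2) (f2 t ⟨le_rfl, h12⟩).2.2.2
  · obtain ⟨a1, a2, a3, a4⟩ := f2 t ⟨hlt.le, ht.2⟩
    refine ⟨a1, a2, a3, a4.congr_mono H.convex (H.regular _ a1 a2) (fun _ _ => rfl)
      ⟨hlt.le, ht.2⟩ ?_⟩
    filter_upwards [self_mem_nhdsWithin, mem_nhdsWithin_of_mem_nhds (Ioi_mem_nhds hlt)] with s h1 h2
    exact ⟨le_of_lt h2, h1.2⟩

/-- Short-time parallel transport near a regular point exists and is smooth. -/
lemma exists_transport_box (H : TransportSetting (n := n) V π φ g γ) {q : M}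
    (hq : q ∈ V \ horizontalBoundary V π) (hc : q ∉ crit (n := n) V π) :
    ∃ N ∈ 𝓝 q, ∃ ε > 0, ∀ t₀ t₁ : ℝ, 0 ≤ t₀ → t₀ < t₁ → t₁ ≤ 1 → t₁ - t₀ ≤ ε → ∃ Φ : M → M,
      ∀ p ∈ N, ContMDiffAt 𝓘(ℝ, Cn n) 𝓘(ℝ, Cn n) ∞ Φ p ∧ (π p = γ t₀ → ∃ c : ℝ → M, c t₀ = p ∧
        c t₁ = Φ p ∧ IsTransport (n := n) V π φ g γ (Icc t₀ t₁) c) := by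
  set e := chartAt (Cn n) q with he
  have hs : q ∈ e.source := mem_chart_source (Cn n) q
  set h0 := connField (π ∘ e.symm) (φ ∘ e.symm) g with hh0
  have hreg := (H.regular q hq hc).eventually_regularAt hs
  obtain ⟨h', hh', heq⟩ := exists_contDiff_eventuallyEq
    (hreg.mono fun x hx => hx.contDiffAt_connField H.convex)
  obtain ⟨A, hA0, hA⟩ := H.path.exists_bound
  have hW : {x | h' x = h0 x ∧ RegularAt (π ∘ e.symm) (φ ∘ e.symm) x ∧ x ∈ e.target ∧
      (‖π (e.symm x)‖ ≤ 1 → e.symm x ∈ V \ horizontalBoundary V π) ∧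
      ContMDiffAt 𝓘(ℂ, Cn n) 𝓘(ℂ, ℂ) ω π (e.symm x)} ∈ 𝓝 (e q) := by
    filter_upwards [heq, hreg, e.open_target.mem_nhds (e.map_source hs),
      (tendsto_chart_symm hs).eventually (H.fibration.eventually_mem_diff hq hc),
      (tendsto_chart_symm hs).eventually (H.fibration.eventually_holomorphic hq.1)]
      with x h1 h2 h3 h4 h5 using ⟨h1, h2, h3, h4, h5⟩
  obtain ⟨ε, hε, N, hN, hbox⟩ := exists_flow_box hh' (e q) hW A
  refine ⟨e.source ∩ e ⁻¹' N, inter_mem (e.open_source.mem_nhds hs)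
    ((e.continuousAt hs).preimage_mem_nhds hN), ε, hε, fun t₀ t₁ h0t h01 h1t hle => ?_⟩
  have hsub : Icc t₀ t₁ ⊆ Icc 0 1 := Icc_subset_Icc h0t h1t
  obtain ⟨v, hv⟩ := hbox (derivWithin γ (Icc 0 1)) t₀ t₁ h01 hle
    (H.path.continuousOn_derivWithin.mono hsub) fun t ht => hA t (hsub ht)
  refine ⟨fun p => e.symm (v (e p) t₁), fun p hp => ⟨?_, fun hp0 => ?_⟩⟩
  · obtain ⟨v1, -, v3⟩ := hv (e p) hp.2
    have k1 : ContMDiffAt 𝓘(ℝ, Cn n) 𝓘(ℝ, Cn n) ∞ e p :=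
      (contMDiffOn_chart (x := q)).contMDiffAt (e.open_source.mem_nhds hp.1)
    have k2 : ContMDiffAt 𝓘(ℝ, Cn n) 𝓘(ℝ, Cn n) ∞ (fun x => v x t₁) (e p) := v1.contMDiffAt
    have k3 : ContMDiffAt 𝓘(ℝ, Cn n) 𝓘(ℝ, Cn n) ∞ e.symm (v (e p) t₁) :=
      (contMDiffOn_chart_symm (x := q)).contMDiffAt
        (e.open_target.mem_nhds (v3 t₁ ⟨h01.le, le_rfl⟩).1.2.2.1)
    exact ContMDiffAt.comp p (g := e.symm) (f := fun p => v (e p) t₁) k3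
      (ContMDiffAt.comp p (g := fun x => v x t₁) k2 k1)
  · obtain ⟨-, v2, v3⟩ := hv (e p) hp.2
    have hct₀ : e.symm (v (e p) t₀) = p := by rw [v2, e.left_inv hp.1]
    -- The connection field projects to 1, so π along the integral curve has the derivative of γ and
    -- the same initial value. In particular |π| ≤ 1, which keeps the curve in V.
    have hπ : ∀ t ∈ Icc t₀ t₁, π (e.symm (v (e p) t)) = γ t := by
      have hd : ∀ t ∈ Icc t₀ t₁, HasDerivWithinAt (fun t => π (e.symm (v (e p) t)))
          (derivWithin γ (Icc 0 1) t) (Icc t₀ t₁) t := fun t ht => by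
        obtain ⟨⟨w1, w2, -⟩, w6⟩ := v3 t ht
        have h1 : HasDerivWithinAt (fun t => π (e.symm (v (e p) t)))
            (fderiv ℂ (π ∘ e.symm) (v (e p) t) (derivWithin γ (Icc 0 1) t • h' (v (e p) t)))
            (Icc t₀ t₁) t :=
          ((w2.holomorphic.differentiableAt (by simp)).hasFDerivAt.restrictScalars
            ℝ).comp_hasDerivWithinAt t w6
        rwa [w1, map_smul, hh0, w2.fderiv_connField H.convex, smul_eq_mul, mul_one] at h1
      have hd' : ∀ t ∈ Icc t₀ t₁, HasDerivWithinAt γ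
          (derivWithin γ (Icc 0 1) t) (Icc t₀ t₁) t := fun t ht =>
        (H.path.hasDerivWithinAt (hsub ht)).mono hsub
      refine eq_of_derivWithin_eq (fun t ht => (hd t ht).differentiableWithinAt)
        (fun t ht => (hd' t ht).differentiableWithinAt) (fun t ht => ?_) (by rw [hct₀, hp0])
      have hu := uniqueDiffOn_Icc h01 t (Ico_subset_Icc_self ht)
      rw [(hd t (Ico_subset_Icc_self ht)).derivWithin hu,
        (hd' t (Ico_subset_Icc_self ht)).derivWithin hu]
    refine ⟨fun t => e.symm (v (e p) t), hct₀, rfl, fun t ht => ?_⟩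
    obtain ⟨⟨w1, w2, w3, w4, w5⟩, w6⟩ := v3 t ht
    have m1 := w4 (by rw [hπ t ht]; exact H.path.norm_le (hsub ht))
    have hse : e.symm (v (e p) t) ∈ e.source := e.map_target w3
    have m2 : e.symm (v (e p) t) ∉ crit (n := n) V π := fun hcr =>
      dPi_ne_zero_of_chart w5 hse (by rw [← he, e.right_inv w3]; exact w2.submersion) hcr.2
    refine ⟨m1, m2, hπ t ht, (hasHorizontalVelocity_iff (q := q) H.convex
      (H.regular _ m1 m2) hse).2 ⟨?_, ?_⟩⟩
    · exact (e.continuousAt_symm w3).comp_continuousWithinAt w6.continuousWithinAt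
    · rw [← he, e.right_inv w3, ← hh0, ← w1]
      refine w6.congr (fun s hs => ?_) ?_
      · exact e.right_inv (v3 s hs).1.2.2.1
      · exact e.right_inv w3

variable [T2Space M]

/-- The agreement set is closed, by continuity and the Hausdorff property. It extends to the right
of each of its points because in a chart both curves solve the same ODE with a locally Lipschitz
field. -/
lemma IsTransport.eqOn_Icc (H : TransportSetting (n := n) V π φ g γ)
    (hsub : Icc t₀ t₁ ⊆ Icc 0 1) (h : IsTransport (n := n) V π φ g γ (Icc t₀ t₁) c)
    (h' : IsTransport (n := n) V π φ g γ (Icc t₀ t₁) c') (heq : c t₀ = c' t₀) :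
    EqOn c c' (Icc t₀ t₁) := by
  have hcl := isClosed_Icc.isClosed_eq h.continuousOn h'.continuousOn
  have hset : {t | c t = c' t} ∩ Icc t₀ t₁ = {t ∈ Icc t₀ t₁ | c t = c' t} := by
    ext; simp [and_comm]
  rw [← hset] at hcl
  refine hcl.Icc_subset_of_forall_mem_nhdsWithin heq ?_
  rintro x ⟨hx : c x = c' x, hx1⟩
  have hx2 := Ico_subset_Icc_self hx1
  set e := chartAt (Cn n) (c x) with he
  have hs : c x ∈ e.source := mem_chart_source (Cn n) (c x)
  set h0 := connField (π ∘ e.symm) (φ ∘ e.symm) g with hh0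
  have hsm : ContDiffAt ℝ 1 h0 (e (c x)) :=
    (((h.regularPoint H hx2).regularAt hs).contDiffAt_connField H.convex).of_le (by norm_cast)
  obtain ⟨K, s, hsn, hK⟩ := hsm.exists_lipschitzOnWith
  obtain ⟨A, hA0, hA⟩ := H.path.exists_bound
  have hnear : ∀ {d : ℝ → M}, IsTransport (n := n) V π φ g γ (Icc t₀ t₁) d → d x = c x →
      ∀ᶠ t in 𝓝[Icc t₀ t₁] x, d t ∈ e.source ∧ e (d t) ∈ s := fun {d} hd hdx => by
    have hd1 : Tendsto d (𝓝[Icc t₀ t₁] x) (𝓝 (c x)) := hdx ▸ hd.continuousOn x hx2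
    exact (hd1.eventually_mem (e.open_source.mem_nhds hs)).and
      (hd1.eventually ((e.continuousAt hs).eventually_mem hsn))
  have hev := (hnear h rfl).and (hnear h' hx.symm)
  rw [eventually_nhdsWithin_iff, Metric.eventually_nhds_iff] at hev
  obtain ⟨r, hr, hr'⟩ := hev
  set b := min t₁ (x + r / 2) with hb
  have hxb : x < b := lt_min hx1.2 (by linarith)
  have hmem : ∀ t ∈ Icc x b, t ∈ Icc t₀ t₁ ∧ (c t ∈ e.source ∧ e (c t) ∈ s) ∧
      (c' t ∈ e.source ∧ e (c' t) ∈ s) := fun t ht => by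
    have ht1 : t ∈ Icc t₀ t₁ := ⟨hx1.1.trans ht.1, ht.2.trans (min_le_left _ _)⟩
    refine ⟨ht1, hr' ?_ ht1⟩
    have := ht.2.trans (min_le_right _ _)
    rw [Real.dist_eq, abs_lt]
    constructor <;> linarith [ht.1]
  have hsol : ∀ {d : ℝ → M}, IsTransport (n := n) V π φ g γ (Icc t₀ t₁) d →
      (∀ t ∈ Icc x b, d t ∈ e.source) → ContinuousOn (e ∘ d) (Icc x b) ∧ ∀ t ∈ Ico x b,
        HasDerivWithinAt (e ∘ d) (derivWithin γ (Icc 0 1) t • h0 ((e ∘ d) t)) (Ici t) t :=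
    fun {d} hd hds => by
      have key : ∀ t ∈ Icc x b, HasDerivWithinAt (e ∘ d)
          (derivWithin γ (Icc 0 1) t • h0 ((e ∘ d) t)) (Icc t₀ t₁) t := fun t ht =>
        ((hasHorizontalVelocity_iff H.convex (hd.regularPoint H (hmem t ht).1)
          (hds t ht)).1 (hd t (hmem t ht).1).2.2.2).2
      refine ⟨fun t ht => ((key t ht).continuousWithinAt).mono fun s hs => (hmem s hs).1,
        fun t ht => (key t (Ico_subset_Icc_self ht)).mono_of_mem_nhdsWithin ?_⟩
      exact Icc_mem_nhdsGE_of_mem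
        ⟨(hmem t (Ico_subset_Icc_self ht)).1.1, ht.2.trans_le (min_le_left _ _)⟩
  obtain ⟨s1, s2⟩ := hsol h fun t ht => (hmem t ht).2.1.1
  obtain ⟨s3, s4⟩ := hsol h' fun t ht => (hmem t ht).2.2.1
  have huniq := ODE_solution_unique_of_mem_Icc_right
    (v := fun t y => derivWithin γ (Icc 0 1) t • h0 y) (s := fun _ => s) (K := A.toNNReal * K)
    (fun t ht => ?_) s1 s2 (fun t ht => (hmem t (Ico_subset_Icc_self ht)).2.1.2) s3 s4
    (fun t ht => (hmem t (Ico_subset_Icc_self ht)).2.2.2) (by simp [hx])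
  · filter_upwards [Ioc_mem_nhdsGT hxb] with t ht
    have ht' := hmem t (Ioc_subset_Icc_self ht)
    exact e.injOn ht'.2.1.1 ht'.2.2.1 (huniq (Ioc_subset_Icc_self ht))
  · refine LipschitzOnWith.of_dist_le_mul fun y hy z hz => ?_
    rw [dist_smul₀]
    have h1 := hA t (hsub (hmem t (Ico_subset_Icc_self ht)).1)
    have h2 := hK.dist_le_mul y hy z hz
    rw [NNReal.coe_mul, Real.coe_toNNReal A hA0, mul_assoc]
    exact mul_le_mul h1 h2 dist_nonneg hA0

end Transport

/-! ### Staying away from the boundary and transport over the whole path -/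

section Completeness

variable {n : ℕ} {M : Type*} [TopologicalSpace M] [ChartedSpace (Cn n) M]
  {V : Set M} {π : M → ℂ} {φ : M → ℝ} {g : ℝ → ℝ} {γ : ℝ → ℂ} {c c' : ℝ → M} {S : Set ℝ}
  {p : M} {t T : ℝ} [IsManifold 𝓘(ℂ, Cn n) ω M]

lemma IsTransport.hasDerivWithinAt (H : TransportSetting (n := n) V π φ g γ)
    (h : IsTransport (n := n) V π φ g γ S c) (ht : t ∈ S) : ∃ v : Cn n,
    IsHorizontal π φ g (c t) v ∧ dPi π (c t) v = derivWithin γ (Icc 0 1) t ∧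
      HasDerivWithinAt (φ ∘ c) (dReal φ (c t) v) S t := by
  obtain ⟨h1, h2, h3, v, hv, hc⟩ := h t ht
  refine ⟨v, hv.1, hv.2, ?_⟩
  have hs := mem_chart_source (Cn n) (c t)
  have hφ := (h.regularPoint H ht).smooth.self_of_nhds
  rw [hasMFDerivWithinAt_toSpanSingleton_iff hs] at hc
  rw [dReal_eq_fderiv_chart hs hφ]
  have hF := ((contDiffAt_real_comp_chart_symm hs hφ).differentiableAt (by simp)).hasFDerivAt
  refine (hF.comp_hasDerivWithinAt t hc.2).congr_of_eventuallyEq ?_ ?_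
  · filter_upwards [hc.1.eventually_mem ((chartAt (Cn n) (c t)).open_source.mem_nhds hs)]
      with s hs1
    simp only [Function.comp_apply, (chartAt (Cn n) (c t)).left_inv hs1]
  · simp only [Function.comp_apply, (chartAt (Cn n) (c t)).left_inv hs]

/-- Parallel transport stays away from the horizontal boundary. -/
lemma IsTransport.exists_le_neg (H : TransportSetting (n := n) V π φ g γ) (hT0 : 0 < T)
    (hT : T ≤ 1) (h : IsTransport (n := n) V π φ g γ (Ico 0 T) c) :
    ∃ δ > 0, ∀ t ∈ Ico 0 T, φ (c t) ≤ -δ := by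
  obtain ⟨ε, hε, C, hC0, hC⟩ := H.bound
  obtain ⟨A, hA0, hA⟩ := H.path.exists_bound
  have h0 : φ (c 0) < 0 := (h.regularPoint H ⟨le_rfl, hT0⟩).neg
  -- The barrier is -m exp(-k t). The first bound keeps it inside the collar -ε < φ where the
  -- estimate holds, the second starts it at or above φ (c 0).
  set m := min (ε / 2) (-φ (c 0)) with hm
  have hm0 : 0 < m := lt_min (by positivity) (by linarith)
  -- On contact the derivative of φ ∘ c is at most C A |φ|; the extra 1 makes the barrier rise
  -- strictly faster.
  set k := C * A + 1 with hk
  have hk0 : 0 < k := by positivity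
  refine ⟨m * Real.exp (-k), by positivity, fun s hs => ?_⟩
  choose! v hv1 hv2 hv3 using fun t (ht : t ∈ Ico 0 T) => h.hasDerivWithinAt H ht
  have hsub : Icc 0 s ⊆ Ico 0 T := fun t ht => ⟨ht.1, ht.2.trans_lt hs.2⟩
  have key : φ (c s) ≤ -m * Real.exp (-(k * s)) := by
    refine image_le_of_deriv_right_lt_deriv_boundary (f := φ ∘ c)
      (f' := fun t => dReal φ (c t) (v t)) (a := 0) (b := s)
      (B := fun t => -m * Real.exp (-(k * t))) (B' := fun t => k * (m * Real.exp (-(k * t))))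
      (fun t ht => ((hv3 t (hsub ht)).continuousWithinAt).mono hsub)
      (fun t ht => (hv3 t (hsub (Ico_subset_Icc_self ht))).mono_of_mem_nhdsWithin
        (Ico_mem_nhdsGE_of_mem (hsub (Ico_subset_Icc_self ht)))) ?_ (fun t => ?_)
      (fun t ht heq => ?_) ⟨hs.1, le_rfl⟩
    · simp only [Function.comp_apply, mul_zero, neg_zero, Real.exp_zero, mul_one]
      linarith [min_le_right (ε / 2) (-φ (c 0))]
    · have h1 : HasDerivAt (fun t => -(k * t)) (-k) t := by
        simpa using (hasDerivAt_const_mul k).fun_neg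
      exact (h1.exp.const_mul (-m)).congr_deriv (by ring)
    · have ht' := hsub (Ico_subset_Icc_self ht)
      simp only [Function.comp_apply] at heq
      have he1 : Real.exp (-(k * t)) ≤ 1 := Real.exp_le_one_iff.2 (by nlinarith [ht.1])
      have he0 : 0 < m * Real.exp (-(k * t)) := by positivity
      have hle : m * Real.exp (-(k * t)) ≤ m := by nlinarith
      have h1 : -ε < φ (c t) := by
        rw [heq]; linarith [min_le_left (ε / 2) (-φ (c 0))]
      have h2 : φ (c t) < 0 := by rw [heq]; linarith
      have h3 := hC (c t) (h t ht').1.1 h1 h2 (v t) (hv1 t ht')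
      have h4 : |φ (c t)| = m * Real.exp (-(k * t)) := by
        rw [heq, neg_mul, abs_neg, abs_of_pos he0]
      rw [hv2 t ht', h4] at h3
      have h5 := hA t ⟨ht'.1, ht'.2.le.trans hT⟩
      have h6 := mul_le_mul_of_nonneg_left h5 (mul_nonneg hC0 he0.le)
      have h7 := (le_abs_self _).trans h3
      rw [hk]
      linarith
  refine key.trans ?_
  have h1 : k * s ≤ k := by nlinarith [hs.2]
  have h2 := mul_le_mul_of_nonneg_left (Real.exp_le_exp.2 (neg_le_neg h1)) hm0.le
  linarith

variable [T2Space M]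

/-- A cluster point inherits φ < 0, so it has a flow box whose duration ε is the same for all
starting times. The lift visits the box at times arbitrarily close to T, in particular within ε of
T, and the box carries it to T. -/
lemma exists_extension_of_mapClusterPt (H : TransportSetting (n := n) V π φ g γ) (hT0 : 0 < T)
    (hT : T ≤ 1) (h : IsTransport (n := n) V π φ g γ (Ico 0 T) c) {q : M} (hq : q ∈ V)
    (hqc : q ∉ crit (n := n) V π) (hcl : MapClusterPt q (𝓝[<] T) c) :
    ∃ c' : ℝ → M, c' 0 = c 0 ∧ IsTransport (n := n) V π φ g γ (Icc 0 T) c' := by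
  obtain ⟨δ, hδ, hle⟩ := h.exists_le_neg H hT0 hT
  have hφq : φ q < 0 := by
    by_contra h0
    have h1 : ∀ᶠ y in 𝓝 q, -δ < φ y :=
      (H.continuousAt q hq).eventually_const_lt (by linarith)
    obtain ⟨t, ht1, ht2⟩ := ((hcl.frequently h1).and_eventually (Ioo_mem_nhdsLT hT0)).exists
    exact absurd (hle t ⟨ht2.1.le, ht2.2⟩) (not_le.2 ht1)
  obtain ⟨N, hN, ε, hε, hbox⟩ := exists_transport_box H
    ⟨hq, fun hB => hφq.ne (H.zero q hB)⟩ hqc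
  have hlt : max 0 (T - ε) < T := max_lt hT0 (by linarith)
  obtain ⟨s, hsN, hs⟩ := ((hcl.frequently hN).and_eventually (Ioo_mem_nhdsLT hlt)).exists
  have hs0 : 0 ≤ s := (le_max_left _ _).trans hs.1.le
  obtain ⟨Φ, hΦ⟩ := hbox s T hs0 hs.2 hT (by linarith [le_max_right 0 (T - ε), hs.1])
  obtain ⟨d, hd1, -, hd⟩ := (hΦ (c s) hsN).2 (h s ⟨hs0, hs.2⟩).2.2.1
  exact ⟨_, by simp [hs0],
    (h.mono fun t ht => ⟨ht.1, ht.2.trans_lt hs.2⟩).glue H hs0 hs.2.le hd hd1.symm⟩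

/-- A curve in a compact set whose cluster points lie in a finite set converges. -/
lemma exists_tendsto_of_mapClusterPt_finite {X : Type*} [TopologicalSpace X] [T2Space X]
    {V K : Set X} (hV : IsCompact V) (hK : K.Finite) {c : ℝ → X} {a T : ℝ} (haT : a < T)
    (hc : ContinuousOn c (Ico a T)) (hcV : ∀ t ∈ Ico a T, c t ∈ V)
    (hcl : ∀ q ∈ V, MapClusterPt q (𝓝[<] T) c → q ∈ K) :
    ∃ q ∈ K, Tendsto c (𝓝[<] T) (𝓝 q) := by
  -- By compactness, a curve frequently outside U would have a cluster point outside U, hence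
  -- outside K.
  have hU : ∀ U : Set X, IsOpen U → K ⊆ U → ∀ᶠ t in 𝓝[<] T, c t ∈ U := fun U hU hKU => by
    by_contra hn
    obtain ⟨q, hq, hq'⟩ := (hV.diff hU).exists_mapClusterPt_of_frequently
      (((not_eventually.1 hn).and_eventually (Ico_mem_nhdsLT haT)).mono
        fun t ht => ⟨hcV t ht.2, ht.1⟩)
    exact hq.2 (hKU (hcl q hq.1 hq'))
  obtain ⟨U, hUo, hUd⟩ := hK.t2_separation
  have hev := hU (⋃ q ∈ K, U q) (isOpen_biUnion fun q _ => (hUo q).2)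
    fun q hq => mem_biUnion hq (hUo q).1
  obtain ⟨b, hb, hbT⟩ := (mem_nhdsLT_iff_exists_mem_Ico_Ioo_subset haT).1 hev
  obtain ⟨s, hs⟩ := nonempty_Ioo.2 hb.2
  obtain ⟨q, hqK, hq⟩ := mem_iUnion₂.1 (hbT hs)
  set R := ⋃ r ∈ K \ {q}, U r with hR
  have hRo : IsOpen R := isOpen_biUnion fun r _ => (hUo r).2
  have hdisj : Disjoint (U q) R := by
    rw [hR, disjoint_iUnion₂_right]
    exact fun r hr => hUd hqK hr.1 (Ne.symm hr.2)
  have hsplit : ∀ r ∈ K, ∀ x ∈ U r, x ∈ U q ∪ R := fun r hr x hx => by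
    by_cases hrq : r = q
    · exact Or.inl (hrq ▸ hx)
    · exact Or.inr (mem_biUnion (⟨hr, hrq⟩ : r ∈ K \ {q}) hx)
  -- Near T the curve lies in a union of disjoint open sets, so by connectedness it stays in a
  -- single one.
  have hsub : c '' Ioo b T ⊆ U q := by
    refine (isPreconnected_Ioo.image c (hc.mono fun t ht => ⟨hb.1.trans ht.1.le, ht.2⟩)
      ).subset_left_of_subset_union (hUo q).2 hRo hdisj ?_ ⟨c s, mem_image_of_mem c hs, hq⟩
    rintro _ ⟨t, ht, rfl⟩
    obtain ⟨r, hr, hrt⟩ := mem_iUnion₂.1 (hbT ht)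
    exact hsplit r hr _ hrt
  refine ⟨q, hqK, fun O hO => mem_map.2 ?_⟩
  obtain ⟨O', hO', hO'o, hqO'⟩ := mem_nhds_iff.1 hO
  have h1 := hU (O' ∪ R) (hO'o.union hRo) fun r hr => by
    by_cases hrq : r = q
    · exact Or.inl (hrq ▸ hqO')
    · exact Or.inr (mem_biUnion (⟨hr, hrq⟩ : r ∈ K \ {q}) (hUo r).1)
  filter_upwards [h1, Ioo_mem_nhdsLT hb.2] with t ht1 ht2
  rcases ht1 with h | h
  · exact hO' h
  · exact absurd h (disjoint_left.1 hdisj (hsub (mem_image_of_mem c ht2)))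

/-- Parallel transport over `[0, T)` converges to a critical point or extends to `[0, T]`. -/
lemma IsTransport.tendsto_crit_or_exists_extension (H : TransportSetting (n := n) V π φ g γ)
    (hT0 : 0 < T) (hT : T ≤ 1) (h : IsTransport (n := n) V π φ g γ (Ico 0 T) c) :
    (∃ q ∈ crit (n := n) V π, Tendsto c (𝓝[<] T) (𝓝 q)) ∨
      ∃ c' : ℝ → M, c' 0 = c 0 ∧ IsTransport (n := n) V π φ g γ (Icc 0 T) c' := by
  by_cases hcl : ∀ q ∈ V, MapClusterPt q (𝓝[<] T) c → q ∈ crit (n := n) V π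
  · exact Or.inl (exists_tendsto_of_mapClusterPt_finite H.fibration.compact
      H.fibration.crit_finite hT0 h.continuousOn (fun t ht => (h t ht).1.1) hcl)
  · push Not at hcl
    obtain ⟨q, hq, hq1, hq2⟩ := hcl
    exact Or.inr (exists_extension_of_mapClusterPt H hT0 hT h hq hq2 hq1)

lemma exists_isTransport_Ico (H : TransportSetting (n := n) V π φ g γ) (hT : T ≤ 1)
    (h : ∀ s < T, ∃ c : ℝ → M, c 0 = p ∧ IsTransport (n := n) V π φ g γ (Icc 0 s) c) :
    ∃ c : ℝ → M, c 0 = p ∧ IsTransport (n := n) V π φ g γ (Ico 0 T) c := by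
  have : Nonempty (ℝ → M) := ⟨fun _ => p⟩
  choose! C hC0 hC using h
  have hC' : ∀ t < T, ∀ s < T, 0 ≤ t → t ≤ s → C ((t + T) / 2) t = C s t := by
    intro t ht s hs h0 hts
    have ht2 : (t + T) / 2 < T := by linarith
    refine IsTransport.eqOn_Icc H (t₀ := 0) (t₁ := t) (Icc_subset_Icc le_rfl (by linarith))
      ((hC _ ht2).mono (Icc_subset_Icc le_rfl (by linarith)))
      ((hC s hs).mono (Icc_subset_Icc le_rfl hts)) ?_ ⟨h0, le_rfl⟩
    rw [hC0 _ ht2, hC0 s hs]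
  by_cases hT0 : 0 < T
  -- The value at t is taken from a lift that exists beyond t, so the derivative within [0, T) at t
  -- can be read off from it.
  · refine ⟨fun t => C ((t + T) / 2) t, hC0 _ (by linarith), fun t ht => ?_⟩
    have ht2 : (t + T) / 2 < T := by linarith [ht.2]
    have htm : t ∈ Icc 0 ((t + T) / 2) := ⟨ht.1, by linarith [ht.2]⟩
    obtain ⟨h1, h2, h3, h4⟩ := hC _ ht2 t htm
    refine ⟨h1, h2, h3, h4.congr_mono H.convex (H.regular _ h1 h2) (fun u hu => ?_) htm ?_⟩
    · exact hC' u (hu.2.trans_lt ht2) _ ht2 hu.1 hu.2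
    · have h5 : t < (t + T) / 2 := by linarith [ht.2]
      filter_upwards [self_mem_nhdsWithin, mem_nhdsWithin_of_mem_nhds (Iio_mem_nhds h5)]
        with s hs1 hs2 using ⟨hs1.1, le_of_lt hs2⟩
  · exact ⟨fun _ => p, rfl, fun t ht => absurd (ht.1.trans_lt ht.2) hT0⟩

/-- Every point of the transportable fibre is transported along the whole path. -/
lemma exists_isTransport (H : TransportSetting (n := n) V π φ g γ)
    (hp : p ∈ transportableFibre (n := n) V π φ g γ) :
    ∃ c : ℝ → M, c 0 = p ∧ IsTransport (n := n) V π φ g γ (Icc 0 1) c := by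
  obtain ⟨hpV, hpγ, hpc, hpT⟩ := hp
  set S := {s : ℝ | s ∈ Icc 0 1 ∧ ∃ c : ℝ → M, c 0 = p ∧
    IsTransport (n := n) V π φ g γ (Icc 0 s) c} with hS
  have hbdd : BddAbove S := ⟨1, fun s hs => hs.1.2⟩
  obtain ⟨s₀, hs₀, hs₀S⟩ : ∃ s₀ > 0, s₀ ∈ S := by
    obtain ⟨N, hN, ε, hε, hbox⟩ := exists_transport_box H hpV hpc
    obtain ⟨Φ, hΦ⟩ := hbox 0 (min ε 1) le_rfl (lt_min hε one_pos) (min_le_right _ _)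
      (by simp)
    obtain ⟨d, hd1, -, hd⟩ := (hΦ p (mem_of_mem_nhds hN)).2 hpγ
    exact ⟨min ε 1, lt_min hε one_pos, ⟨(lt_min hε one_pos).le, min_le_right _ _⟩, d, hd1, hd⟩
  set T := sSup S with hTdef
  have hT0 : 0 < T := hs₀.trans_le (le_csSup hbdd hs₀S)
  have hT1 : T ≤ 1 := csSup_le ⟨s₀, hs₀S⟩ fun s hs => hs.1.2
  obtain ⟨c, hc0, hc⟩ := exists_isTransport_Ico (p := p) H hT1 fun s hs => by
    obtain ⟨r, ⟨-, d, hd0, hd⟩, hsr⟩ := exists_lt_of_lt_csSup ⟨s₀, hs₀S⟩ hs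
    exact ⟨d, hd0, hd.mono (Icc_subset_Icc le_rfl hsr.le)⟩
  rcases hc.tendsto_crit_or_exists_extension H hT0 hT1 with ⟨q, hq, hcq⟩ | ⟨d, hd0, hd⟩
  -- Convergence to a critical point is what membership in the transportable fibre excludes.
  · exact absurd hcq (hpT T c hT0 hT1 hc0 hc.isHorizontalLift q hq)
  rw [hc0] at hd0
  rcases hT1.eq_or_lt with h1 | h1
  · exact ⟨d, hd0, h1 ▸ hd⟩
  have hTm : T ∈ Icc 0 T := ⟨hT0.le, le_rfl⟩
  obtain ⟨N, hN, ε, hε, hbox⟩ := exists_transport_box H (hd T hTm).1 (hd T hTm).2.1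
  have hlt : T < min (T + ε) 1 := lt_min (by linarith) h1
  obtain ⟨Φ, hΦ⟩ := hbox T (min (T + ε) 1) hT0.le hlt (min_le_right _ _)
    (by linarith [min_le_left (T + ε) 1])
  obtain ⟨d', hd'1, -, hd'⟩ := (hΦ _ (mem_of_mem_nhds hN)).2 (hd T hTm).2.2.1
  have hmem : min (T + ε) 1 ∈ S := ⟨⟨(hT0.trans hlt).le, min_le_right _ _⟩, _,
    by simp [hT0.le, hd0], hd.glue H hT0.le hlt.le hd' hd'1.symm⟩
  exact absurd (le_csSup hbdd hmem) (not_le.2 hlt)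

end Completeness

/-! ### Reversed paths, smooth dependence and completeness -/

section Reversal

variable {n : ℕ} {M : Type*} [TopologicalSpace M] [ChartedSpace (Cn n) M]
  {V : Set M} {π : M → ℂ} {φ φ' : M → ℝ} {g : ℝ → ℝ} {γ : ℝ → ℂ} {c c' : ℝ → M} {S : Set ℝ}
  {p : M} {t t₀ t₁ : ℝ}

lemma one_sub_mem_Icc {t : ℝ} (ht : t ∈ Icc (0 : ℝ) 1) : 1 - t ∈ Icc (0 : ℝ) 1 :=
  ⟨by linarith [ht.2], by linarith [ht.1]⟩

lemma IsSmoothPath.reverse (hγ : IsSmoothPath γ) : IsSmoothPath fun t => γ (1 - t) :=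
  ⟨hγ.1.comp (contDiff_const.sub contDiff_id).contDiffOn fun _ ht => one_sub_mem_Icc ht,
    fun _ ht => hγ.2 (one_sub_mem_Icc ht)⟩

lemma IsHorizontal.neg {v : Cn n} (h : IsHorizontal π φ g p v) : IsHorizontal π φ g p (-v) := by
  intro w hw
  have h1 := h w hw
  simp only [omegaForm, smul_neg, map_neg, neg_apply] at h1 ⊢
  linarith

variable [IsManifold 𝓘(ℂ, Cn n) ω M]

lemma TransportSetting.reverse (H : TransportSetting (n := n) V π φ g γ) :
    TransportSetting (n := n) V π φ g fun t => γ (1 - t) :=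
  { H with path := H.path.reverse }

lemma IsTransport.reverse (H : TransportSetting (n := n) V π φ g γ)
    (h : IsTransport (n := n) V π φ g γ (Icc 0 1) c) :
    IsTransport (n := n) V π φ g (fun t => γ (1 - t)) (Icc 0 1) fun t => c (1 - t) := by
  refine IsHorizontalLift.isTransport H.fibration H.path.reverse (uniqueDiffOn_Icc one_pos)
    Subset.rfl fun t ht => ?_
  obtain ⟨h1, h2, h3, v, hv, hc⟩ := h (1 - t) (one_sub_mem_Icc ht)
  refine ⟨h1, h2, h3, -v, hv.1.neg, ?_⟩
  have hs := mem_chart_source (Cn n) (c (1 - t))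
  rw [hasMFDerivWithinAt_toSpanSingleton_iff hs] at hc
  rw [hasMFDerivWithinAt_toSpanSingleton_iff (c := fun t => c (1 - t)) hs]
  have hd : HasDerivWithinAt (fun t : ℝ => 1 - t) (-1) (Icc 0 1) t :=
    (hasDerivWithinAt_id t _).const_sub 1
  have hm : MapsTo (fun t : ℝ => 1 - t) (Icc 0 1) (Icc 0 1) := fun _ ht => one_sub_mem_Icc ht
  refine ⟨hc.1.comp (f := fun t : ℝ => 1 - t) hd.continuousWithinAt hm, ?_⟩
  refine (HasDerivWithinAt.scomp t (h := fun t : ℝ => 1 - t) hc.2 hd hm).congr_deriv ?_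
  rw [map_neg, neg_one_smul]

variable [T2Space M]

/-- By uniqueness every lift of the reversed path from c 1 is c run backwards, so its limit at T is
c (1 - T), which is not critical. -/
lemma IsTransport.apply_one_mem (H : TransportSetting (n := n) V π φ g γ)
    (h : IsTransport (n := n) V π φ g γ (Icc 0 1) c) :
    c 1 ∈ transportableFibre (n := n) V π φ g fun t => γ (1 - t) := by
  obtain ⟨h1, h2, h3, -⟩ := h 1 ⟨zero_le_one, le_rfl⟩
  refine ⟨h1, by simpa using h3, h2, fun T d hT0 hT1 hd0 hd q hq hdq => ?_⟩
  have hr := h.reverse H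
  have hsub : Ico 0 T ⊆ Icc 0 1 := fun t ht => ⟨ht.1, ht.2.le.trans hT1⟩
  have hd' := hd.isTransport H.fibration H.path.reverse (uniqueDiffOn_Ico 0 T) hsub
  have heq : EqOn (fun t => c (1 - t)) d (Ico 0 T) := fun t ht =>
    IsTransport.eqOn_Icc H.reverse (Icc_subset_Icc le_rfl (ht.2.le.trans hT1))
      (hr.mono (Icc_subset_Icc le_rfl (ht.2.le.trans hT1)))
      (hd'.mono fun u hu => ⟨hu.1, hu.2.trans_lt ht.2⟩) (by simp [hd0]) ⟨ht.1, le_rfl⟩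
  have hTm : T ∈ Icc (0 : ℝ) 1 := ⟨hT0.le, hT1⟩
  have hlim : Tendsto d (𝓝[<] T) (𝓝 (c (1 - T))) := by
    have h4 : Tendsto (fun t => c (1 - t)) (𝓝[Ico 0 T] T) (𝓝 (c (1 - T))) :=
      ((hr.continuousOn T hTm).mono hsub)
    rw [nhdsWithin_Ico_eq_nhdsLT hT0] at h4
    refine h4.congr' ?_
    filter_upwards [Ico_mem_nhdsLT hT0] with t ht using heq ht
  rw [tendsto_nhds_unique hdq hlim] at hq
  exact (hr T hTm).2.1 hq

/-- Near `p`, transport over `[0, t]` is given by a map which is smooth at `p`. -/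
def SmoothTransport (V : Set M) (π : M → ℂ) (φ : M → ℝ) (g : ℝ → ℝ) (γ : ℝ → ℂ) (p : M)
    (t : ℝ) : Prop :=
  ∃ F : M → M, ContMDiffAt 𝓘(ℝ, Cn n) 𝓘(ℝ, Cn n) ∞ F p ∧ ∀ᶠ q in 𝓝 p, ∀ d : ℝ → M, d 0 = q →
    IsTransport (n := n) V π φ g γ (Icc 0 t) d → d t = F q

/-- For times close to s the curve is in the flow box around c s, whose map is smooth on an open set
of M. Composing with it carries smoothness from t₀ to t₁; compactness of [0, 1] later reduces to
finitely many such steps. -/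
lemma smoothTransport_step (H : TransportSetting (n := n) V π φ g γ)
    (h : IsTransport (n := n) V π φ g γ (Icc 0 1) c) {s : ℝ} (hs : s ∈ Icc (0 : ℝ) 1) :
    ∃ U ∈ 𝓝 s, ∀ t₀ ∈ U, ∀ t₁ ∈ U, 0 ≤ t₀ → t₀ ≤ t₁ → t₁ ≤ 1 →
      SmoothTransport (n := n) V π φ g γ (c 0) t₀ →
        SmoothTransport (n := n) V π φ g γ (c 0) t₁ := by
  obtain ⟨N, hN, ε, hε, hbox⟩ := exists_transport_box H (h s hs).1 (h s hs).2.1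
  have hev := (h.continuousOn s hs).eventually_mem (interior_mem_nhds.2 hN)
  rw [eventually_nhdsWithin_iff] at hev
  refine ⟨_, inter_mem hev (Metric.ball_mem_nhds s (half_pos hε)), ?_⟩
  rintro t₀ ⟨ht₀, hb₀⟩ t₁ ⟨ht₁, hb₁⟩ h0 h01 h1 ⟨F, hF, hFe⟩
  rcases h01.eq_or_lt with rfl | hlt
  · exact ⟨F, hF, hFe⟩
  have ht₀m : t₀ ∈ Icc (0 : ℝ) 1 := ⟨h0, h01.trans h1⟩
  have hFc : c t₀ = F (c 0) := hFe.self_of_nhds c rfl (h.mono (Icc_subset_Icc le_rfl ht₀m.2))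
  have hFN : F (c 0) ∈ interior N := hFc ▸ ht₀ ht₀m
  obtain ⟨Φ, hΦ⟩ := hbox t₀ t₁ h0 hlt h1 (by
    rw [Metric.mem_ball, Real.dist_eq, abs_lt] at hb₀ hb₁
    linarith [hb₀.1, hb₁.2])
  refine ⟨Φ ∘ F, ContMDiffAt.comp (c 0) (hΦ _ (interior_subset hFN)).1 hF, ?_⟩
  filter_upwards [hFe, hF.continuousAt.eventually_mem (isOpen_interior.mem_nhds hFN)]
    with q hq1 hq2 d hd0 hd
  have hdF := hq1 d hd0 (hd.mono (Icc_subset_Icc le_rfl h01))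
  obtain ⟨d', hd'0, hd'1, hd'⟩ := (hΦ (F q) (interior_subset hq2)).2
    (hdF ▸ (hd t₀ ⟨h0, h01⟩).2.2.1)
  rw [Function.comp_apply, ← hd'1]
  exact IsTransport.eqOn_Icc H (Icc_subset_Icc h0 h1) (hd.mono (Icc_subset_Icc h0 le_rfl)) hd'
    (hdF.trans hd'0.symm) ⟨h01, le_rfl⟩

lemma IsTransport.smoothTransport (H : TransportSetting (n := n) V π φ g γ)
    (h : IsTransport (n := n) V π φ g γ (Icc 0 1) c) :
    SmoothTransport (n := n) V π φ g γ (c 0) 1 := by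
  choose U hU hstep using fun s : Icc (0 : ℝ) 1 => smoothTransport_step H h s.2
  obtain ⟨τ, hτ0, hτm, ⟨m, hm⟩, hτ⟩ := exists_monotone_Icc_subset_open_cover_Icc
    (zero_le_one (α := ℝ)) (c := fun s => Subtype.val ⁻¹' interior (U s))
    (fun s => isOpen_interior.preimage continuous_subtype_val)
    (fun s _ => mem_iUnion.2 ⟨s, mem_interior_iff_mem_nhds.2 (hU s)⟩)
  have key : ∀ k, SmoothTransport (n := n) V π φ g γ (c 0) (τ k) := by
    intro k
    induction k with
    | zero =>
      rw [hτ0]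
      exact ⟨id, contMDiffAt_id, Eventually.of_forall fun q d hd _ => hd⟩
    | succ k ih =>
      obtain ⟨s, hs⟩ := hτ k
      have hle := hτm k.le_succ
      exact hstep s _ (interior_subset (hs ⟨le_rfl, hle⟩)) _ (interior_subset (hs ⟨hle, le_rfl⟩))
        (τ k).2.1 hle (τ (k + 1)).2.2 ih
  have h1 := key m
  rwa [hm m le_rfl] at h1

lemma contMDiffOn_transport (H : TransportSetting (n := n) V π φ g γ) {Φ : M → M}
    (hΦ : ∀ p ∈ transportableFibre (n := n) V π φ g γ, ∃ c : ℝ → M, c 0 = p ∧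
      IsTransport (n := n) V π φ g γ (Icc 0 1) c ∧ c 1 = Φ p) :
    ContMDiffOn 𝓘(ℝ, Cn n) 𝓘(ℝ, Cn n) ∞ Φ (transportableFibre (n := n) V π φ g γ) := by
  intro p hp
  obtain ⟨c, rfl, hc, -⟩ := hΦ p hp
  obtain ⟨F, hF, hFe⟩ := hc.smoothTransport H
  have key : ∀ᶠ q in 𝓝 (c 0), q ∈ transportableFibre (n := n) V π φ g γ → Φ q = F q := by
    filter_upwards [hFe] with q hq hq'
    obtain ⟨d, hd0, hd, hd1⟩ := hΦ q hq'
    rw [← hd1]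
    exact hq d hd0 hd
  exact hF.contMDiffWithinAt.congr_of_eventuallyEq
    (eventually_nhdsWithin_iff.2 key) (key.self_of_nhds hp)

/-- The inverse is transport along the reversed path: reversing a lift gives a lift of the reversed
path, and uniqueness identifies the round trip with the identity. -/
lemma connectionComplete_of_setting
    (H : ∀ γ, IsSmoothPath γ → TransportSetting (n := n) V π φ g γ) :
    ConnectionComplete (n := n) V π φ g := by
  intro γ hγ
  have h1 := H γ hγ
  have h2 := h1.reverse
  have hex : ∀ {γ : ℝ → ℂ}, TransportSetting (n := n) V π φ g γ → ∃ Φ : M → M,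
      ∀ p ∈ transportableFibre (n := n) V π φ g γ, ∃ c : ℝ → M, c 0 = p ∧
        IsTransport (n := n) V π φ g γ (Icc 0 1) c ∧ c 1 = Φ p := fun {γ} H => by
    have : ∀ p, ∃ y, p ∈ transportableFibre (n := n) V π φ g γ → ∃ c : ℝ → M, c 0 = p ∧
        IsTransport (n := n) V π φ g γ (Icc 0 1) c ∧ c 1 = y := fun p => by
      by_cases hp : p ∈ transportableFibre (n := n) V π φ g γ
      · obtain ⟨c, hc0, hc⟩ := exists_isTransport H hp
        exact ⟨c 1, fun _ => ⟨c, hc0, hc, rfl⟩⟩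
      · exact ⟨p, fun h => absurd h hp⟩
    choose Φ hΦ using this
    exact ⟨Φ, hΦ⟩
  have huniq : ∀ {γ : ℝ → ℂ}, TransportSetting (n := n) V π φ g γ → ∀ {c d : ℝ → M},
      IsTransport (n := n) V π φ g γ (Icc 0 1) c → IsTransport (n := n) V π φ g γ (Icc 0 1) d →
        c 0 = d 0 → c 1 = d 1 := fun H _ _ hc hd h0 =>
    IsTransport.eqOn_Icc H Subset.rfl hc hd h0 ⟨zero_le_one, le_rfl⟩
  obtain ⟨Φ, hΦ⟩ := hex h1
  obtain ⟨Ψ, hΨ⟩ := hex h2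
  have hrr : (fun t => γ (1 - (1 - t))) = γ := by simp
  refine ⟨⟨Φ, Ψ, transportableFibre (n := n) V π φ g γ,
    transportableFibre (n := n) V π φ g fun t => γ (1 - t), fun p hp => ?_, fun p hp => ?_,
    fun p hp => ?_, fun p hp => ?_⟩, rfl, rfl, fun p hp => ⟨?_, fun c hc0 hc => ?_⟩,
    contMDiffOn_transport h1 hΦ, contMDiffOn_transport h2 hΨ⟩
  · obtain ⟨c, -, hc, hc1⟩ := hΦ p hp
    exact hc1 ▸ hc.apply_one_mem h1
  · obtain ⟨c, -, hc, hc1⟩ := hΨ p hp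
    have := hc.apply_one_mem h2
    rwa [hc1, hrr] at this
  · obtain ⟨c, hc0, hc, hc1⟩ := hΦ p hp
    obtain ⟨d, hd0, hd, hd1⟩ := hΨ (Φ p) (hc1 ▸ hc.apply_one_mem h1)
    have h3 := huniq h2 hd (hc.reverse h1) (by simp [hd0, hc1])
    simpa [hd1, hc0] using h3
  · obtain ⟨c, hc0, hc, hc1⟩ := hΨ p hp
    have hm := hc.apply_one_mem h2
    have hr := hc.reverse h2
    rw [hrr] at hm hr
    obtain ⟨d, hd0, hd, hd1⟩ := hΦ (Ψ p) (hc1 ▸ hm)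
    have h3 := huniq h1 hd hr (by simp [hd0, hc1])
    simpa [hd1, hc0] using h3
  · obtain ⟨c, hc0, hc, -⟩ := hΦ p hp
    exact ⟨c, hc0, hc.isHorizontalLift⟩
  · obtain ⟨d, hd0, hd, hd1⟩ := hΦ p hp
    rw [huniq h1 (hc.isTransport h1.fibration hγ (uniqueDiffOn_Icc one_pos) Subset.rfl) hd
      (hc0.trans hd0.symm), hd1]

lemma connectionComplete_of_two_le (hn : 2 ≤ n) (hV : IsSteinLefschetzFibration (n := n) V π)
    (hφ : CutsOutHorizontalBoundary (n := n) V π φ) (hg : IsConvexExhaustion g)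
    (hg' : GrowthCondition g) : ConnectionComplete (n := n) V π φ g := by
  have hneg : ∀ p ∈ V \ horizontalBoundary V π, φ p < 0 := fun p hp =>
    neg_of_notMem_horizontalBoundary hV hφ hn hp
  exact connectionComplete_of_setting fun γ hγ =>
    { fibration := hV
      continuousAt := fun p hp => (hφ.eventually_smooth hp).self_of_nhds.continuousAt
      zero := fun p hp => (hφ.zero_iff p hp.1).2 hp
      regular := fun p hp hc => regularPoint_of_neg hV hφ hp.1 hc (hneg p hp)
      convex := hg
      bound := exists_uniform_horizontal_bound hV hφ hg hg' hneg
      path := hγ }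

/-! ### Fibres of dimension zero -/

lemma eq_zero_of_le_one (hn : n ≤ 1) {D : Cn n →L[ℂ] ℂ} (hD : D ≠ 0) {w : Cn n} (hw : D w = 0) :
    w = 0 := by
  by_contra h0
  refine hD (ContinuousLinearMap.ext fun v => ?_)
  obtain ⟨u, hu⟩ := finrank_le_one_iff.1 ((finrank_euclideanSpace_fin (𝕜 := ℂ)).trans_le hn)
  obtain ⟨a, rfl⟩ := hu w
  obtain ⟨b, rfl⟩ := hu v
  rw [map_smul, smul_eq_zero] at hw
  rw [map_smul, hw.resolve_left fun h => h0 (by rw [h, zero_smul]), smul_zero]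
  rfl

/-- A boundary point would provide a vertical vector on which dφ is nonzero, but at noncritical
points the vertical space is zero. -/
lemma horizontalBoundary_eq_empty (hn : n ≤ 1) (hV : IsSteinLefschetzFibration (n := n) V π)
    (hφ : CutsOutHorizontalBoundary (n := n) V π φ) : horizontalBoundary V π = ∅ := by
  refine eq_empty_of_forall_notMem fun p hp => ?_
  obtain ⟨w, hw, hw'⟩ := exists_ker_fderiv_chart_ne_zero hV hφ hp
  have hc : p ∉ crit (n := n) V π := fun h => hV.notMem_horizontalBoundary_of_mem_crit h hp
  rw [eq_zero_of_le_one hn (fderiv_chart_ne_zero (hV.eventually_holomorphic hp.1).self_of_nhds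
    (mem_chart_source (Cn n) p) (dPi_ne_zero_of_notMem_crit hp.1 hc)) hw] at hw'
  exact hw' (map_zero _)

lemma JConvexAt.sub_const (h : JConvexAt (n := n) φ p) (a : ℝ) :
    JConvexAt (n := n) (fun q => φ q - a) p := by
  have h1 : chartHessian (n := n) (fun q => φ q - a) p = chartHessian φ p := by
    have h2 : fderiv ℝ ((fun q => φ q - a) ∘ (chartAt (Cn n) p).symm) =
        fderiv ℝ (φ ∘ (chartAt (Cn n) p).symm) := by
      funext x
      exact fderiv_sub_const (f := φ ∘ (chartAt (Cn n) p).symm) a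
    rw [chartHessian, h2, chartHessian]
  intro v hv
  have h3 := h v hv
  rw [omegaForm] at h3 ⊢
  rwa [h1]

lemma ConnectionComplete.congr (h : ConnectionComplete (n := n) V π φ g)
    (hL : ∀ γ S c, IsHorizontalLift (n := n) V π φ g γ S c ↔
      IsHorizontalLift (n := n) V π φ' g γ S c) : ConnectionComplete (n := n) V π φ' g := by
  unfold ConnectionComplete transportableFibre at h ⊢
  simpa only [hL] using h

/-- The fibres have no positive-dimensional directions, so the maximum principle is unavailable and
φ may be positive, where g is arbitrary. The lifts do not depend on φ, however, so φ can be replaced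
by φ minus a constant that makes it at most -1 on V; the boundary estimate is then vacuous. -/
lemma connectionComplete_of_le_one (hn : n ≤ 1) (hV : IsSteinLefschetzFibration (n := n) V π)
    (hφ : CutsOutHorizontalBoundary (n := n) V π φ) (hg : IsConvexExhaustion g) :
    ConnectionComplete (n := n) V π φ g := by
  obtain ⟨b, hb⟩ := hV.compact.exists_bound_of_continuousOn fun p hp =>
    (hφ.eventually_smooth hp).self_of_nhds.continuousAt.continuousWithinAt
  have hle : ∀ p ∈ V, φ p - (b + 1) ≤ -1 := fun p hp => by
    linarith [(le_abs_self (φ p)).trans (hb p hp)]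
  have hB := horizontalBoundary_eq_empty hn hV hφ
  have hsmooth : ∀ p ∈ V, ∀ᶠ q in 𝓝 p,
      ContMDiffAt 𝓘(ℝ, Cn n) 𝓘(ℝ, ℝ) ∞ (fun q => φ q - (b + 1)) q := fun p hp =>
    (hφ.eventually_smooth hp).mono fun q hq => hq.sub contMDiffAt_const
  have hcomp : ConnectionComplete (n := n) V π (fun q => φ q - (b + 1)) g :=
    connectionComplete_of_setting fun γ hγ =>
    { fibration := hV
      continuousAt := fun p hp => (hsmooth p hp).self_of_nhds.continuousAt
      zero := fun p hp => by simp [hB] at hp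
      regular := fun p hp hc =>
        { holomorphic := hV.eventually_holomorphic hp.1
          smooth := hsmooth p hp.1
          jConvex := (hφ.jConvex p hp.1).sub_const _
          submersion := dPi_ne_zero_of_notMem_crit hp.1 hc
          neg := by linarith [hle p hp.1] }
      convex := hg
      bound := ⟨1, one_pos, 0, le_rfl, fun p hp h => absurd h (not_lt.2 (hle p hp))⟩
      path := hγ }
  -- The only vertical vector is 0, so every vector is horizontal for any function, whatever the
  -- values of g.
  have htriv : ∀ (ψ : M → ℝ) (p : M), p ∈ V → p ∉ crit (n := n) V π → ∀ v : Cn n,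
      IsHorizontal π ψ g p v := fun ψ p hp hc v w hw => by
    rw [eq_zero_of_le_one hn (dPi_ne_zero_of_notMem_crit hp hc) hw]
    simp [omegaForm]
  refine hcomp.congr fun γ S c => forall₂_congr fun t _ => ?_
  constructor <;> rintro ⟨h1, h2, h3, v, -, hc⟩ <;>
  exact ⟨h1, h2, h3, v, htriv _ _ h1.1 h2 v, hc⟩

lemma connectionComplete (hV : IsSteinLefschetzFibration (n := n) V π)
    (hφ : CutsOutHorizontalBoundary (n := n) V π φ) (hg : IsConvexExhaustion g)
    (hg' : GrowthCondition g) : ConnectionComplete (n := n) V π φ g := by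
  rcases Nat.lt_or_ge 1 n with hn | hn
  · exact connectionComplete_of_two_le hn hV hφ hg hg'
  · exact connectionComplete_of_le_one hn hV hφ hg

end Reversal

end SteinLefschetz

end

theorem mainTheorem8 :
    ContractibleSpace CompletingFunction ∧
    ∀ (n : ℕ) (M : Type*) [TopologicalSpace M] [T2Space M] [ChartedSpace (Cn n) M]
      [IsManifold 𝓘(ℂ, Cn n) ω M] (V : Set M) (π : M → ℂ) (φ : M → ℝ),
      IsSteinLefschetzFibration (n := n) V π → CutsOutHorizontalBoundary (n := n) V π φ →
        (∃ g : ℝ → ℝ, IsConvexExhaustion g ∧ ConnectionComplete (n := n) V π φ g) ∧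
        (∀ g : ℝ → ℝ, IsConvexExhaustion g → GrowthCondition g →
          ConnectionComplete (n := n) V π φ g) := by
  refine ⟨inferInstance, fun n M _ _ _ _ V π φ hV hφ =>
    ⟨⟨fun y => -Real.log (-y), isConvexExhaustion_neg_log_neg, ?_⟩, fun g hg hg' =>
      connectionComplete hV hφ hg hg'⟩⟩
  exact connectionComplete hV hφ isConvexExhaustion_neg_log_neg growthCondition_neg_log_neg
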